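/- **Setting.** Let $k\ge 1$, $d\ge 2$, let $\Omega^+=\{1,\dots,k\}^{\mathbb N}$ with the cylinder $\sigma$-algebra and the shift $(\sigma\omega)_i=\omega_{i+1}$, and let $\mathbb P$ be a $\sigma$-invariant Markovian probability measure on $\Omega^+$ that gives positive mass to every non-empty cylinder (a one-sided Markovian full shift). Put $P_{ij}=\mathbb P(\omega_0=i\mid\omega_1=j)$. Let $M_1,\dots,M_k\in GL(d,\mathbb R)$, $\mathfrak M(\omega)=M_{\omega_0}$, and let $\mathcal S$ be the semigroup (with identity) generated by $M_1,\dots,M_k$. Assume * *strong irreducibility*: there is no non-empty finite family $V_1,\dots,V_m$ of proper non-zero linear subspaces of $\mathbb R^d$ with $A(V_1\cup\dots\cup V_m)=V_1\cup\dots\cup V_m$ for all $A\in\mathcal S$; * *contraction*: there are $A_n\in\mathcal S$ such that $A_n/\|A_n\|$ converges to a matrix of rank one. Let $\mathcal X=\mathbb RP^{d-1}$ with $d_{\mathcal X}(x,y)=(1-\langle x,y\rangle^2)^{1/2}$ for unit representatives. For $0<\theta<1$ let $d_\theta(\omega,\tilde\omega)=\theta^N$, where $N$ is the largest integer with $\omega_i=\tilde\omega_i$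 for $0\le i<N$ (and $d_\theta(\omega,\omega)=0$). For $0<\theta<1$ and $\alpha>0$ let $\mathcal G_{\theta,\alpha}$ be the space of functions $f:\Omega^+\times\mathcal X\to\mathbb C$ that are Lipschitz in $\omega$ for $d_\theta$, uniformly in $x$, and $\alpha$-Hölder in $x$ for $d_{\mathcal X}$, uniformly in $\omega$, with the norm $$\|f\|_{\theta,\alpha}=\sup|f|+\sup_{(\omega,x)\ne(\tilde\omega,y)}\frac{|f(\omega,x)-f(\tilde\omega,y)|}{d_{\mathcal X}(x,y)^\alpha+d_\theta(\omega,\tilde\omega)} ,$$ and write $\|\cdot\|_{\theta,\alpha}$ also for the operator norm. Let $\mathcal L_0$ be the bounded operator on $\mathcal G_{\theta,\alpha}$ $$(\mathcal L_0w)(\omega,x)=\sum_{i=1}^kP_{i\,\omega_0}\,w(i\omega,M_i\cdot x),$$ where $i\omega=(i,\omega_0,\omega_1,\dots)$. Call a Borel probability measure $\nu$ on $\Omega^+\times\mathcal X$ *invariant* if its marginal on $\Omega^+$ is $\mathbb P$ and it is preserved by the skew product $\Phi(\omega,x)=(\sigma\omega,\mathfrak M(\omega)^{-1}\cdot x)$,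 and then put $\mathcal Q_\nu w=\int w\,d\nu$ (a constant function). **Theorem.** There are an invariant measure $\nu_0$ and an $\alpha_0>0$ such that for every $0<\alpha\le\alpha_0$ there is $\theta_0>0$ such that for all $\theta\in(0,1)$ with $\theta<\theta_0$: 1. for every invariant measure $\nu$ and all sufficiently large $n$, $\ \|\mathcal L_0^n-\mathcal Q_\nu\|_{\theta,\alpha}^{1/n}<1$; 2. $1$ is an eigenvalue of $\mathcal L_0$ of algebraic multiplicity one, and there is $r<1$ such that every other point $z$ of the spectrum of $\mathcal L_0$ satisfies $|z|\le r$; 3. $\mathcal Q_{\nu_0}\mathcal L_0=\mathcal L_0\mathcal Q_{\nu_0}=\mathcal Q_{\nu_0}$, and $\mathcal L_0-\mathcal Q_{\nu_0}$ has spectral radius less than $1$. -/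

import Mathlib

open MeasureTheory Filter Topology
open scoped Matrix LinearAlgebra.Projectivization

noncomputable section

namespace MarkovTransfer

/-! ### The one-sided Markovian full shift -/

/-- The one-sided sequence space `Ω⁺ = {1, …, k}^ℕ`, with the product (cylinder) σ-algebra. -/
abbrev SymbolSeq (k : ℕ) : Type := ℕ → Fin k

/-- The shift map `(σ ω)_i = ω_{i+1}`. -/
def shift {k : ℕ} (ω : SymbolSeq k) : SymbolSeq k := fun n => ω (n + 1)

/-- The sequence `i ω`, with first entry `i` and shift `ω`.  As `i` runs through the symbols,
these are exactly the preimages of `ω` under the shift (see `shift_eq_iff`). -/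
def consSeq {k : ℕ} (i : Fin k) (ω : SymbolSeq k) : SymbolSeq k
  | 0 => i
  | n + 1 => ω n

theorem shift_eq_iff {k : ℕ} (ω ω' : SymbolSeq k) : shift ω' = ω ↔ ∃ i, ω' = consSeq i ω := by
  constructor
  · rintro rfl
    refine ⟨ω' 0, funext fun n => ?_⟩
    cases n <;> rfl
  · rintro ⟨i, rfl⟩
    rfl

/-- `μ` makes the sequence space a Markovian full shift: `μ` is shift invariant, the coordinate
process is a Markov chain, and every non-empty cylinder has positive probability. -/
structure IsMarkovianFullShift {k : ℕ} (μ : Measure (SymbolSeq k)) : Prop where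
  isProbability : IsProbabilityMeasure μ
  invariant : MeasurePreserving shift μ μ
  markov : ∀ (n : ℕ) (a : SymbolSeq k), μ {ω | ∀ i ≤ n, ω i = a i} ≠ 0 →
    ProbabilityTheory.cond μ {ω | ∀ i ≤ n, ω i = a i} {ω | ω (n + 1) = a (n + 1)} =
      ProbabilityTheory.cond μ {ω | ω n = a n} {ω | ω (n + 1) = a (n + 1)}
  full : ∀ (n : ℕ) (a : SymbolSeq k), 0 < μ {ω | ∀ i ≤ n, ω i = a i}

/-- The matrix `P_{ij} = μ(ω₀ = i | ω₁ = j)`. -/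
def transProb {k : ℕ} (μ : Measure (SymbolSeq k)) (i j : Fin k) : ℝ :=
  (ProbabilityTheory.cond μ {ω | ω 1 = j}).real {ω | ω 0 = i}

open Classical in
/-- The metric `d_θ(ω, ω') = θ^N`, with `N` the length of the longest common initial segment. -/
def seqDist {k : ℕ} (θ : ℝ) (ω ω' : SymbolSeq k) : ℝ :=
  if ω = ω' then 0 else θ ^ PiNat.firstDiff ω ω'

/-! ### Real projective space -/

/-- The real projective space `ℝP^{d-1}`; `GL (Fin d) ℝ` acts on it by `g • [v] = [g v]`. -/
abbrev Proj (d : ℕ) : Type := ℙ ℝ (Fin d → ℝ)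

/-- The quotient topology from the nonzero vectors. -/
instance instTopologicalSpaceProj (d : ℕ) : TopologicalSpace (Proj d) :=
  inferInstanceAs (TopologicalSpace (Quotient (projectivizationSetoid ℝ (Fin d → ℝ))))

/-- The Borel σ-algebra. -/
instance instMeasurableSpaceProj (d : ℕ) : MeasurableSpace (Proj d) := borel _

instance instBorelSpaceProj (d : ℕ) : BorelSpace (Proj d) := ⟨rfl⟩

/-- The metric `d(x, y) = (1 - ⟨x, y⟩²)^{1/2}` for unit representatives `x, y`
(here arbitrary representatives are used, and normalised). -/
def projDist {d : ℕ} (x y : Proj d) : ℝ :=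
  √(1 - (x.rep ⬝ᵥ y.rep) ^ 2 / ((x.rep ⬝ᵥ x.rep) * (y.rep ⬝ᵥ y.rep)))

/-! ### Conditions on a finite family of invertible matrices -/

/-- The semigroup generated by the matrices `M i` (with the identity). -/
def matSemigroup {k d : ℕ} (M : Fin k → GL (Fin d) ℝ) : Submonoid (Matrix (Fin d) (Fin d) ℝ) :=
  Submonoid.closure (Set.range fun i => (M i : Matrix (Fin d) (Fin d) ℝ))

/-- Strong irreducibility: no union of a nonempty finite family of proper nonzero linear
subspaces is preserved by every element of the semigroup. -/
def StronglyIrreducible {k d : ℕ} (M : Fin k → GL (Fin d) ℝ) : Prop :=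
  ¬ ∃ F : Finset (Submodule ℝ (Fin d → ℝ)), F.Nonempty ∧ (∀ V ∈ F, V ≠ ⊥ ∧ V ≠ ⊤) ∧
    ∀ A ∈ matSemigroup M,
      (fun v => A *ᵥ v) '' (⋃ V ∈ F, (V : Set (Fin d → ℝ))) = ⋃ V ∈ F, (V : Set (Fin d → ℝ))

open scoped Matrix.Norms.L2Operator in
/-- The contracting property: for some sequence `A n` in the semigroup, `A n / ‖A n‖` converges
to a matrix of rank one. -/
def Contracting {k d : ℕ} (M : Fin k → GL (Fin d) ℝ) : Prop :=
  ∃ A : ℕ → Matrix (Fin d) (Fin d) ℝ, (∀ n, A n ∈ matSemigroup M) ∧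
    ∃ R : Matrix (Fin d) (Fin d) ℝ, R.rank = 1 ∧
      Tendsto (fun n => ‖A n‖⁻¹ • A n) atTop (𝓝 R)

/-! ### Invariant measures -/

/-- The skew product `Φ(ω, x) = (σ ω, 𝔐(ω)⁻¹ · x)`, where `𝔐(ω) = M_{ω₀}`. -/
def skewProduct {k d : ℕ} (M : Fin k → GL (Fin d) ℝ) (a : SymbolSeq k × Proj d) : SymbolSeq k × Proj d :=
  (shift a.1, (M (a.1 0))⁻¹ • a.2)

/-- `ν` is an invariant measure of the random dynamical system with `φ(1, ω) = 𝔐(ω)⁻¹`: it is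
invariant under the skew product and its marginal on the sequence space is `μ`. -/
def IsInvariantMeasure {k d : ℕ} (μ : Measure (SymbolSeq k)) (M : Fin k → GL (Fin d) ℝ)
    (ν : ProbabilityMeasure (SymbolSeq k × Proj d)) : Prop :=
  MeasurePreserving (skewProduct M) (ν : Measure (SymbolSeq k × Proj d)) (ν : Measure (SymbolSeq k × Proj d)) ∧
    (ν : Measure (SymbolSeq k × Proj d)).map Prod.fst = μ

/-! ### Elementary facts on the two metrics -/

section Metrics

variable {k d : ℕ}

theorem dot_self_nonneg (v : Fin d → ℝ) : 0 ≤ v ⬝ᵥ v :=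
  Finset.sum_nonneg fun _ _ => mul_self_nonneg _

theorem seqDist_nonneg (θ : Set.Ioo (0 : ℝ) 1) (ω ω' : SymbolSeq k) : 0 ≤ seqDist θ ω ω' := by
  unfold seqDist
  split_ifs
  · exact le_rfl
  · exact pow_nonneg θ.2.1.le _

theorem seqDist_le_one (θ : Set.Ioo (0 : ℝ) 1) (ω ω' : SymbolSeq k) : seqDist θ ω ω' ≤ 1 := by
  unfold seqDist
  split_ifs
  · exact zero_le_one
  · exact pow_le_one₀ θ.2.1.le θ.2.2.le

theorem seqDist_of_ne (θ : ℝ) {ω ω' : SymbolSeq k} (h : ω 0 ≠ ω' 0) : seqDist θ ω ω' = 1 := by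
  have hne : ω ≠ ω' := fun e => h (by rw [e])
  have : PiNat.firstDiff ω ω' = 0 := by
    by_contra h0
    exact h (PiNat.apply_eq_of_lt_firstDiff (Nat.pos_of_ne_zero h0))
  simp [seqDist, hne, this]

theorem seqDist_cons_le (θ : Set.Ioo (0 : ℝ) 1) (i : Fin k) (ω ω' : SymbolSeq k) :
    seqDist θ (consSeq i ω) (consSeq i ω') ≤ seqDist θ ω ω' := by
  by_cases h : ω = ω'
  · simp [h, seqDist]
  have h' : consSeq i ω ≠ consSeq i ω' := fun e => h (congrArg shift e)
  simp only [seqDist, h, h', if_false]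
  apply pow_le_pow_of_le_one θ.2.1.le θ.2.2.le
  by_contra hlt
  push Not at hlt
  set m := PiNat.firstDiff (consSeq i ω) (consSeq i ω') with hm
  have hne := PiNat.apply_firstDiff_ne h'
  rw [← hm] at hne
  cases hmm : m with
  | zero => rw [hmm] at hne; exact hne rfl
  | succ j =>
    rw [hmm] at hne
    exact hne (PiNat.apply_eq_of_lt_firstDiff (x := ω) (y := ω') (by omega))

theorem projDist_nonneg (x y : Proj d) : 0 ≤ projDist x y := Real.sqrt_nonneg _

theorem projDist_le_one (x y : Proj d) : projDist x y ≤ 1 := by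
  unfold projDist
  rw [Real.sqrt_le_one]
  have h1 : 0 ≤ x.rep ⬝ᵥ x.rep := dot_self_nonneg _
  have h2 : 0 ≤ y.rep ⬝ᵥ y.rep := dot_self_nonneg _
  have : 0 ≤ (x.rep ⬝ᵥ y.rep) ^ 2 / ((x.rep ⬝ᵥ x.rep) * (y.rep ⬝ᵥ y.rep)) := by positivity
  linarith

theorem dot_self_pos {v : Fin d → ℝ} (hv : v ≠ 0) : 0 < v ⬝ᵥ v :=
  lt_of_le_of_ne (dot_self_nonneg v)
    (fun h => hv (dotProduct_self_eq_zero.1 h.symm))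

theorem projDist_mk (v w : Fin d → ℝ) (hv : v ≠ 0) (hw : w ≠ 0) :
    projDist (Projectivization.mk ℝ v hv) (Projectivization.mk ℝ w hw) =
      √(1 - (v ⬝ᵥ w) ^ 2 / ((v ⬝ᵥ v) * (w ⬝ᵥ w))) := by
  obtain ⟨a, ha⟩ := Projectivization.exists_smul_eq_mk_rep ℝ v hv
  obtain ⟨b, hb⟩ := Projectivization.exists_smul_eq_mk_rep ℝ w hw
  have h1 := (dot_self_pos hv).ne'
  have h2 := (dot_self_pos hw).ne'
  have ha0 : (a : ℝ) ≠ 0 := a.ne_zero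
  have hb0 : (b : ℝ) ≠ 0 := b.ne_zero
  unfold projDist
  rw [← ha, ← hb]
  simp only [Units.smul_def, smul_dotProduct, dotProduct_smul, smul_eq_mul]
  congr 2
  field_simp

theorem dot_sq_le (v w : Fin d → ℝ) : (v ⬝ᵥ w) ^ 2 ≤ (v ⬝ᵥ v) * (w ⬝ᵥ w) := by
  have := Finset.sum_mul_sq_le_sq_mul_sq Finset.univ v w
  simpa [dotProduct, sq] using this

theorem projDist_sq_mk (v w : Fin d → ℝ) (hv : v ≠ 0) (hw : w ≠ 0) :
    projDist (Projectivization.mk ℝ v hv) (Projectivization.mk ℝ w hw) ^ 2 * (v ⬝ᵥ v) =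
      v ⬝ᵥ v - (v ⬝ᵥ w) ^ 2 / (w ⬝ᵥ w) := by
  have h1 := dot_self_pos hv
  have h2 := dot_self_pos hw
  rw [projDist_mk, Real.sq_sqrt]
  · field_simp
  · rw [sub_nonneg, div_le_one (by positivity)]
    exact dot_sq_le v w

/-- `d(x, y) |x|` is at most the distance from `x` to any point of the line through `y`. -/
theorem projDist_sq_le (v w : Fin d → ℝ) (hv : v ≠ 0) (hw : w ≠ 0) (t : ℝ) :
    projDist (Projectivization.mk ℝ v hv) (Projectivization.mk ℝ w hw) ^ 2 * (v ⬝ᵥ v) ≤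
      (v - t • w) ⬝ᵥ (v - t • w) := by
  have h2 := dot_self_pos hw
  rw [projDist_sq_mk]
  have : (v - t • w) ⬝ᵥ (v - t • w) - (v ⬝ᵥ v - (v ⬝ᵥ w) ^ 2 / (w ⬝ᵥ w)) =
      (t * (w ⬝ᵥ w) - v ⬝ᵥ w) ^ 2 / (w ⬝ᵥ w) := by
    simp only [sub_dotProduct, dotProduct_sub, smul_dotProduct, dotProduct_smul, smul_eq_mul,
      dotProduct_comm w v]
    field_simp
    ring
  have h3 : 0 ≤ (t * (w ⬝ᵥ w) - v ⬝ᵥ w) ^ 2 / (w ⬝ᵥ w) := by positivity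
  linarith

theorem mulVec_dot_le (A : Matrix (Fin d) (Fin d) ℝ) (v : Fin d → ℝ) :
    (A *ᵥ v) ⬝ᵥ (A *ᵥ v) ≤ (∑ i, A i ⬝ᵥ A i) * (v ⬝ᵥ v) := by
  rw [Finset.sum_mul]
  refine Finset.sum_le_sum fun i _ => ?_
  have := dot_sq_le (A i) v
  simpa [Matrix.mulVec, sq] using this

/-- An invertible matrix acts on projective space as a Lipschitz map. -/
theorem exists_projDist_smul_le (g : GL (Fin d) ℝ) :
    ∃ C : ℝ, 0 ≤ C ∧ ∀ x y : Proj d, projDist (g • x) (g • y) ≤ C * projDist x y := by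
  set A : Matrix (Fin d) (Fin d) ℝ := g.val with hA
  set B : Matrix (Fin d) (Fin d) ℝ := (g⁻¹ : GL (Fin d) ℝ).val with hB
  set a := ∑ i, A i ⬝ᵥ A i
  set b := ∑ i, B i ⬝ᵥ B i
  have ha : 0 ≤ a := Finset.sum_nonneg fun i _ => dot_self_nonneg _
  have hb : 0 ≤ b := Finset.sum_nonneg fun i _ => dot_self_nonneg _
  refine ⟨√(a * b), Real.sqrt_nonneg _, fun x y => ?_⟩
  revert y
  refine Projectivization.ind (fun v hv => ?_) x
  refine Projectivization.ind (fun w hw => ?_)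
  rw [Projectivization.smul_mk, Projectivization.smul_mk]
  have hgv : g • v = A *ᵥ v := rfl
  have hgw : g • w = A *ᵥ w := rfl
  have hgv0 : g • v ≠ 0 := (smul_ne_zero_iff_ne g).mpr hv
  have hgw0 : g • w ≠ 0 := (smul_ne_zero_iff_ne g).mpr hw
  set D := projDist (Projectivization.mk ℝ (g • v) hgv0) (Projectivization.mk ℝ (g • w) hgw0)
  set E := projDist (Projectivization.mk ℝ v hv) (Projectivization.mk ℝ w hw) with hE
  have hv2 := dot_self_pos hv
  have hw2 := dot_self_pos hw
  have hD0 : 0 ≤ D := projDist_nonneg _ _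
  have hE0 : 0 ≤ E := projDist_nonneg _ _
  set t := (v ⬝ᵥ w) / (w ⬝ᵥ w) with ht
  have e1 : E ^ 2 * (v ⬝ᵥ v) = (v - t • w) ⬝ᵥ (v - t • w) := by
    rw [hE, projDist_sq_mk]
    simp only [sub_dotProduct, dotProduct_sub, smul_dotProduct, dotProduct_smul, smul_eq_mul,
      dotProduct_comm w v, ht]
    field_simp
    ring
  have e2 : D ^ 2 * ((A *ᵥ v) ⬝ᵥ (A *ᵥ v)) ≤ a * (E ^ 2 * (v ⬝ᵥ v)) := by
    have := projDist_sq_le (g • v) (g • w) hgv0 hgw0 t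
    refine this.trans ?_
    rw [e1, hgv, hgw]
    have h3 : A *ᵥ v - t • A *ᵥ w = A *ᵥ (v - t • w) := by
      rw [Matrix.mulVec_sub, Matrix.mulVec_smul]
    rw [h3]
    exact mulVec_dot_le A _
  have e3 : v ⬝ᵥ v ≤ b * ((A *ᵥ v) ⬝ᵥ (A *ᵥ v)) := by
    have h4 : B *ᵥ (A *ᵥ v) = v := by
      rw [Matrix.mulVec_mulVec]
      have : B * A = 1 := by
        rw [hA, hB, ← Units.val_mul, inv_mul_cancel, Units.val_one]
      rw [this, Matrix.one_mulVec]
    have := mulVec_dot_le B (A *ᵥ v)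
    rwa [h4] at this
  have e4 : D ^ 2 ≤ (a * b) * E ^ 2 := by
    have h5 : D ^ 2 * (v ⬝ᵥ v) ≤ ((a * b) * E ^ 2) * (v ⬝ᵥ v) := by
      calc D ^ 2 * (v ⬝ᵥ v) ≤ D ^ 2 * (b * ((A *ᵥ v) ⬝ᵥ (A *ᵥ v))) := by gcongr
        _ = b * (D ^ 2 * ((A *ᵥ v) ⬝ᵥ (A *ᵥ v))) := by ring
        _ ≤ b * (a * (E ^ 2 * (v ⬝ᵥ v))) := by gcongr
        _ = ((a * b) * E ^ 2) * (v ⬝ᵥ v) := by ring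
    exact le_of_mul_le_mul_right h5 hv2
  calc D = √(D ^ 2) := (Real.sqrt_sq hD0).symm
    _ ≤ √((a * b) * E ^ 2) := Real.sqrt_le_sqrt e4
    _ = √(a * b) * E := by rw [Real.sqrt_mul (by positivity), Real.sqrt_sq hE0]

/-- The quantity `d_X^α + d_θ` on pairs of points of `Ω⁺ × X`. -/
def pairDist (θ α : ℝ) (a b : SymbolSeq k × Proj d) : ℝ :=
  projDist a.2 b.2 ^ α + seqDist θ a.1 b.1

theorem pairDist_nonneg (θ : Set.Ioo (0 : ℝ) 1) (α : ℝ) (a b : SymbolSeq k × Proj d) :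
    0 ≤ pairDist θ α a b :=
  add_nonneg (Real.rpow_nonneg (projDist_nonneg _ _) _) (seqDist_nonneg θ _ _)

theorem pairDist_le_two (θ : Set.Ioo (0 : ℝ) 1) (α : Set.Ioi (0 : ℝ)) (a b : SymbolSeq k × Proj d) :
    pairDist θ α a b ≤ 2 := by
  have h1 := Real.rpow_le_one (projDist_nonneg a.2 b.2) (projDist_le_one a.2 b.2)
    (le_of_lt α.2)
  have h2 := seqDist_le_one θ a.1 b.1
  unfold pairDist
  linarith

end Metrics

/-! ### The Banach space of functions that are Lipschitz in `ω` and `α`-Hölder in `x` -/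

/-- `f(ω, x)` is Lipschitz in `ω` for `d_θ`, uniformly in `x`, and `α`-Hölder in `x`,
uniformly in `ω`. -/
def IsHolder {k d : ℕ} (θ α : ℝ) (f : SymbolSeq k × Proj d → ℂ) : Prop :=
  (∃ C : ℝ, ∀ (x : Proj d) (ω ω' : SymbolSeq k), ‖f (ω, x) - f (ω', x)‖ ≤ C * seqDist θ ω ω') ∧
    ∃ C : ℝ, ∀ (ω : SymbolSeq k) (x y : Proj d), ‖f (ω, x) - f (ω, y)‖ ≤ C * projDist x y ^ α

/-- The complex vector space of these functions. -/
def holderSubmodule (k d : ℕ) (θ α : ℝ) : Submodule ℂ (SymbolSeq k × Proj d → ℂ) where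
  carrier := {f | IsHolder θ α f}
  zero_mem' := ⟨⟨0, by simp⟩, ⟨0, by simp⟩⟩
  add_mem' := by
    rintro f g ⟨⟨C₁, h₁⟩, ⟨C₂, h₂⟩⟩ ⟨⟨D₁, g₁⟩, ⟨D₂, g₂⟩⟩
    refine ⟨⟨C₁ + D₁, fun x ω ω' => ?_⟩, ⟨C₂ + D₂, fun ω x y => ?_⟩⟩
    · rw [add_mul]
      refine le_trans ?_ (add_le_add (h₁ x ω ω') (g₁ x ω ω'))
      rw [Pi.add_apply, Pi.add_apply, add_sub_add_comm]
      exact norm_add_le _ _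
    · rw [add_mul]
      refine le_trans ?_ (add_le_add (h₂ ω x y) (g₂ ω x y))
      rw [Pi.add_apply, Pi.add_apply, add_sub_add_comm]
      exact norm_add_le _ _
  smul_mem' := by
    rintro c f ⟨⟨C₁, h₁⟩, ⟨C₂, h₂⟩⟩
    refine ⟨⟨‖c‖ * C₁, fun x ω ω' => ?_⟩, ⟨‖c‖ * C₂, fun ω x y => ?_⟩⟩
    · rw [Pi.smul_apply, Pi.smul_apply, ← smul_sub, norm_smul, mul_assoc]
      exact mul_le_mul_of_nonneg_left (h₁ x ω ω') (norm_nonneg _)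
    · rw [Pi.smul_apply, Pi.smul_apply, ← smul_sub, norm_smul, mul_assoc]
      exact mul_le_mul_of_nonneg_left (h₂ ω x y) (norm_nonneg _)

/-- The function space, as a type of its own, so that it carries the norm below. -/
def HolderSpace (k d : ℕ) (θ : Set.Ioo (0 : ℝ) 1) (α : Set.Ioi (0 : ℝ)) : Type :=
  ↥(holderSubmodule k d θ α)

namespace HolderSpace

variable {k d : ℕ} {θ : Set.Ioo (0 : ℝ) 1} {α : Set.Ioi (0 : ℝ)}

instance : AddCommGroup (HolderSpace k d θ α) :=
  inferInstanceAs (AddCommGroup ↥(holderSubmodule k d θ α))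

instance : Module ℂ (HolderSpace k d θ α) :=
  inferInstanceAs (Module ℂ ↥(holderSubmodule k d θ α))

instance : CoeFun (HolderSpace k d θ α) (fun _ => SymbolSeq k × Proj d → ℂ) := ⟨fun f => f.1⟩

@[ext] theorem ext {f g : HolderSpace k d θ α} (h : ∀ a, f a = g a) : f = g :=
  Subtype.ext (funext h)

@[simp] theorem zero_apply (a : SymbolSeq k × Proj d) : (0 : HolderSpace k d θ α) a = 0 := rfl

@[simp] theorem add_apply (f g : HolderSpace k d θ α) (a : SymbolSeq k × Proj d) :
    (f + g) a = f a + g a := rfl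

@[simp] theorem smul_apply (c : ℂ) (f : HolderSpace k d θ α) (a : SymbolSeq k × Proj d) :
    (c • f) a = c * f a := rfl

/-- The supremum norm `|f|_∞`. -/
def supNorm (f : HolderSpace k d θ α) : ℝ := ⨆ a : SymbolSeq k × Proj d, ‖f a‖

/-- The seminorm `|f|_{θ,α}` (a pair of equal points contributes the value `0 / 0 = 0`). -/
def holderSeminorm (f : HolderSpace k d θ α) : ℝ :=
  ⨆ p : (SymbolSeq k × Proj d) × (SymbolSeq k × Proj d), ‖f p.1 - f p.2‖ / pairDist θ α p.1 p.2

/-- The norm `‖f‖_{θ,α} = |f|_∞ + |f|_{θ,α}`. -/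
instance : Norm (HolderSpace k d θ α) := ⟨fun f => supNorm f + holderSeminorm f⟩

theorem norm_def (f : HolderSpace k d θ α) : ‖f‖ = supNorm f + holderSeminorm f := rfl

theorem exists_bound (f : HolderSpace k d θ α) :
    ∃ C : ℝ, 0 ≤ C ∧ ∀ a b, ‖f a - f b‖ ≤ C * pairDist θ α a b := by
  obtain ⟨⟨C₁, h₁⟩, ⟨C₂, h₂⟩⟩ := f.2
  refine ⟨max 0 (max C₁ C₂), le_max_left _ _, ?_⟩
  rintro ⟨ω, x⟩ ⟨ω', y⟩
  have e1 : ‖f (ω, x) - f (ω, y)‖ ≤ max 0 (max C₁ C₂) * projDist x y ^ (α : ℝ) :=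
    (h₂ ω x y).trans (mul_le_mul_of_nonneg_right
      ((le_max_right _ _).trans (le_max_right _ _)) (Real.rpow_nonneg (projDist_nonneg _ _) _))
  have e2 : ‖f (ω, y) - f (ω', y)‖ ≤ max 0 (max C₁ C₂) * seqDist θ ω ω' :=
    (h₁ y ω ω').trans (mul_le_mul_of_nonneg_right
      ((le_max_left _ _).trans (le_max_right _ _)) (seqDist_nonneg θ _ _))
  calc ‖f (ω, x) - f (ω', y)‖
      = ‖(f (ω, x) - f (ω, y)) + (f (ω, y) - f (ω', y))‖ := by rw [sub_add_sub_cancel]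
    _ ≤ _ := norm_add_le _ _
    _ ≤ _ := add_le_add e1 e2
    _ = _ := by simp only [pairDist]; ring

theorem bddAbove_sup (f : HolderSpace k d θ α) :
    BddAbove (Set.range fun a : SymbolSeq k × Proj d => ‖f a‖) := by
  obtain ⟨C, hC, h⟩ := f.exists_bound
  rcases isEmpty_or_nonempty (SymbolSeq k × Proj d) with he | ⟨⟨a₀⟩⟩
  · exact ⟨0, by rintro _ ⟨a, rfl⟩; exact he.elim a⟩
  refine ⟨‖f a₀‖ + C * 2, ?_⟩
  rintro _ ⟨a, rfl⟩
  have h1 := (h a a₀).trans (mul_le_mul_of_nonneg_left (pairDist_le_two θ α a a₀) hC)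
  have h2 := norm_add_le (f a₀) (f a - f a₀)
  rw [add_sub_cancel] at h2
  show ‖f a‖ ≤ _
  linarith

theorem bddAbove_seminorm (f : HolderSpace k d θ α) :
    BddAbove (Set.range fun p : (SymbolSeq k × Proj d) × (SymbolSeq k × Proj d) =>
      ‖f p.1 - f p.2‖ / pairDist θ α p.1 p.2) := by
  obtain ⟨C, hC, h⟩ := f.exists_bound
  refine ⟨C, ?_⟩
  rintro _ ⟨p, rfl⟩
  exact div_le_of_le_mul₀ (pairDist_nonneg θ α _ _) hC (h _ _)

theorem supNorm_nonneg (f : HolderSpace k d θ α) : 0 ≤ supNorm f :=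
  Real.iSup_nonneg fun _ => norm_nonneg _

theorem holderSeminorm_nonneg (f : HolderSpace k d θ α) : 0 ≤ holderSeminorm f :=
  Real.iSup_nonneg fun _ => div_nonneg (norm_nonneg _) (pairDist_nonneg θ α _ _)

theorem norm_apply_le (f : HolderSpace k d θ α) (a : SymbolSeq k × Proj d) : ‖f a‖ ≤ supNorm f :=
  le_ciSup f.bddAbove_sup a

theorem norm_sub_le (f : HolderSpace k d θ α) (a b : SymbolSeq k × Proj d) :
    ‖f a - f b‖ ≤ holderSeminorm f * pairDist θ α a b := by
  rcases (pairDist_nonneg θ α a b).eq_or_lt with h0 | h0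
  · obtain ⟨C, -, h⟩ := f.exists_bound
    have := h a b
    rw [← h0, mul_zero] at this ⊢
    exact this
  · rw [← div_le_iff₀ h0]
    exact le_ciSup f.bddAbove_seminorm (a, b)

theorem supNorm_le (f : HolderSpace k d θ α) {A : ℝ} (hA : 0 ≤ A) (h : ∀ a, ‖f a‖ ≤ A) :
    supNorm f ≤ A :=
  Real.iSup_le h hA

theorem holderSeminorm_le (f : HolderSpace k d θ α) {B : ℝ} (hB : 0 ≤ B)
    (h : ∀ a b, ‖f a - f b‖ ≤ B * pairDist θ α a b) : holderSeminorm f ≤ B :=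
  Real.iSup_le (fun _ => div_le_of_le_mul₀ (pairDist_nonneg θ α _ _) hB (h _ _)) hB

theorem norm_smul_le' (c : ℂ) (f : HolderSpace k d θ α) : ‖c • f‖ ≤ ‖c‖ * ‖f‖ := by
  rw [norm_def, norm_def, mul_add]
  refine add_le_add (supNorm_le _ (mul_nonneg (norm_nonneg _) f.supNorm_nonneg) fun a => ?_)
    (holderSeminorm_le _ (mul_nonneg (norm_nonneg _) f.holderSeminorm_nonneg) fun a b => ?_)
  · rw [smul_apply, norm_mul]
    exact mul_le_mul_of_nonneg_left (f.norm_apply_le a) (norm_nonneg _)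
  · rw [smul_apply, smul_apply, ← mul_sub, norm_mul, mul_assoc]
    exact mul_le_mul_of_nonneg_left (f.norm_sub_le a b) (norm_nonneg _)

theorem normCore : NormedSpace.Core ℂ (HolderSpace k d θ α) where
  norm_nonneg f := add_nonneg f.supNorm_nonneg f.holderSeminorm_nonneg
  norm_smul c f := by
    refine le_antisymm (norm_smul_le' c f) ?_
    by_cases hc : c = 0
    · subst hc
      rw [norm_zero, zero_mul]
      exact add_nonneg (supNorm_nonneg _) (holderSeminorm_nonneg _)
    · have h := norm_smul_le' c⁻¹ (c • f)
      rw [inv_smul_smul₀ hc, norm_inv] at h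
      have hc' : 0 < ‖c‖ := norm_pos_iff.2 hc
      rwa [inv_mul_eq_div, le_div_iff₀ hc', mul_comm] at h
  norm_triangle f g := by
    have h1 : supNorm (f + g) ≤ supNorm f + supNorm g :=
      supNorm_le _ (add_nonneg f.supNorm_nonneg g.supNorm_nonneg) fun a =>
        (norm_add_le _ _).trans (add_le_add (f.norm_apply_le a) (g.norm_apply_le a))
    have h2 : holderSeminorm (f + g) ≤ holderSeminorm f + holderSeminorm g :=
      holderSeminorm_le _ (add_nonneg f.holderSeminorm_nonneg g.holderSeminorm_nonneg)
        fun a b => by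
          rw [add_apply, add_apply, add_sub_add_comm, add_mul]
          exact (norm_add_le _ _).trans (add_le_add (f.norm_sub_le a b) (g.norm_sub_le a b))
    rw [norm_def, norm_def, norm_def]
    linarith
  norm_eq_zero_iff f := by
    constructor
    · intro h
      rw [norm_def] at h
      have h1 : supNorm f = 0 := by
        linarith [f.supNorm_nonneg, f.holderSeminorm_nonneg]
      ext a
      exact norm_le_zero_iff.1 ((f.norm_apply_le a).trans_eq h1)
    · rintro rfl
      refine le_antisymm ?_ (add_nonneg (supNorm_nonneg _) (holderSeminorm_nonneg _))
      have h1 : supNorm (0 : HolderSpace k d θ α) ≤ 0 := supNorm_le _ le_rfl (by simp)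
      have h2 : holderSeminorm (0 : HolderSpace k d θ α) ≤ 0 :=
        holderSeminorm_le _ le_rfl (by simp)
      rw [norm_def]
      linarith

instance : NormedAddCommGroup (HolderSpace k d θ α) := NormedAddCommGroup.ofCore normCore

instance : NormedSpace ℂ (HolderSpace k d θ α) := NormedSpace.ofCore normCore

/-- A function with `|f(a) - f(b)| ≤ B (d_X^α + d_θ)` belongs to the space. -/
theorem isHolder_of_bound {f : SymbolSeq k × Proj d → ℂ} {B : ℝ}
    (h : ∀ a b, ‖f a - f b‖ ≤ B * pairDist θ α a b) : IsHolder (θ : ℝ) (α : ℝ) f := by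
  refine ⟨⟨B, fun x ω ω' => ?_⟩, ⟨B, fun ω x y => ?_⟩⟩
  · have h0 : projDist x x = 0 := by
      refine Projectivization.ind (fun v hv => ?_) x
      have := (dot_self_pos hv).ne'
      rw [projDist_mk, sq, div_self (by positivity), sub_self, Real.sqrt_zero]
    have := h (ω, x) (ω', x)
    rwa [pairDist, h0, Real.zero_rpow (ne_of_gt α.2), zero_add] at this
  · have := h (ω, x) (ω, y)
    rwa [pairDist, seqDist, if_pos rfl, add_zero] at this

end HolderSpace

/-! ### The transfer operator -/

section Transfer

variable {k d : ℕ}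

/-- The formula `(L₀ w)(ω, x) = ∑_{σ ω' = ω} p(ω, ω') w(ω', 𝔐(ω') · x)`, where the preimages are
`ω' = i ω`, and `p(ω, i ω) = P_{i ω₀}`, `𝔐(i ω) = M_i`. -/
def transferFun (μ : Measure (SymbolSeq k)) (M : Fin k → GL (Fin d) ℝ) (w : SymbolSeq k × Proj d → ℂ) :
    SymbolSeq k × Proj d → ℂ :=
  fun a => ∑ i : Fin k, (transProb μ i (a.1 0) : ℂ) * w (consSeq i a.1, M i • a.2)

theorem transProb_nonneg (μ : Measure (SymbolSeq k)) (i j : Fin k) : 0 ≤ transProb μ i j :=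
  measureReal_nonneg

theorem transProb_le_one (μ : Measure (SymbolSeq k)) (i j : Fin k) : transProb μ i j ≤ 1 :=
  measureReal_le_one

theorem exists_pairDist_le (M : Fin k → GL (Fin d) ℝ) (θ : Set.Ioo (0 : ℝ) 1)
    (α : Set.Ioi (0 : ℝ)) :
    ∃ C : ℝ, 0 ≤ C ∧ ∀ (i : Fin k) (a b : SymbolSeq k × Proj d),
      pairDist θ α (consSeq i a.1, M i • a.2) (consSeq i b.1, M i • b.2) ≤
        C * pairDist θ α a b := by
  choose K hK0 hK using fun i => exists_projDist_smul_le (M i)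
  have hKα : ∀ i, 0 ≤ K i ^ (α : ℝ) := fun i => Real.rpow_nonneg (hK0 i) _
  have hsum : 0 ≤ ∑ i, K i ^ (α : ℝ) := Finset.sum_nonneg fun i _ => hKα i
  refine ⟨1 + ∑ i, K i ^ (α : ℝ), by linarith, fun i a b => ?_⟩
  have hi : K i ^ (α : ℝ) ≤ ∑ i, K i ^ (α : ℝ) :=
    Finset.single_le_sum (f := fun i => K i ^ (α : ℝ)) (fun i _ => hKα i) (Finset.mem_univ i)
  have h1 : projDist (M i • a.2) (M i • b.2) ^ (α : ℝ) ≤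
      K i ^ (α : ℝ) * projDist a.2 b.2 ^ (α : ℝ) := by
    rw [← Real.mul_rpow (hK0 i) (projDist_nonneg _ _)]
    exact Real.rpow_le_rpow (projDist_nonneg _ _) (hK i _ _) (le_of_lt α.2)
  have h2 := seqDist_cons_le θ i a.1 b.1
  have h3 := seqDist_nonneg θ a.1 b.1
  have h4 : 0 ≤ projDist a.2 b.2 ^ (α : ℝ) := Real.rpow_nonneg (projDist_nonneg _ _) _
  simp only [pairDist]
  nlinarith [mul_le_mul_of_nonneg_right hi h4, mul_nonneg hsum h3]

variable {θ : Set.Ioo (0 : ℝ) 1} {α : Set.Ioi (0 : ℝ)}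

theorem transferFun_norm_le (μ : Measure (SymbolSeq k)) (M : Fin k → GL (Fin d) ℝ)
    (w : HolderSpace k d θ α) (a : SymbolSeq k × Proj d) :
    ‖transferFun μ M w a‖ ≤ k * w.supNorm := by
  refine (norm_sum_le _ _).trans ?_
  refine (Finset.sum_le_card_nsmul _ _ w.supNorm fun i _ => ?_).trans (by simp)
  rw [norm_mul, Complex.norm_real, Real.norm_of_nonneg (transProb_nonneg μ _ _)]
  have h1 := w.norm_apply_le (consSeq i a.1, M i • a.2)
  have h2 := mul_le_mul (transProb_le_one μ i (a.1 0)) h1 (norm_nonneg _) zero_le_one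
  simpa using h2

theorem exists_transferFun_bound (μ : Measure (SymbolSeq k)) (M : Fin k → GL (Fin d) ℝ)
    (θ : Set.Ioo (0 : ℝ) 1) (α : Set.Ioi (0 : ℝ)) :
    ∃ C : ℝ, 0 ≤ C ∧ ∀ (w : HolderSpace k d θ α) (a b : SymbolSeq k × Proj d),
      ‖transferFun μ M w a - transferFun μ M w b‖ ≤
        (k * (w.supNorm + C * w.holderSeminorm)) * pairDist θ α a b := by
  obtain ⟨C, hC, h⟩ := exists_pairDist_le M θ α
  refine ⟨C, hC, fun w a b => ?_⟩
  unfold transferFun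
  rw [← Finset.sum_sub_distrib]
  refine (norm_sum_le _ _).trans ?_
  refine (Finset.sum_le_card_nsmul _ _
    ((w.supNorm + C * w.holderSeminorm) * pairDist θ α a b) fun i _ => ?_).trans
      (by simp [mul_assoc])
  set u := w (consSeq i a.1, M i • a.2)
  set v := w (consSeq i b.1, M i • b.2)
  set p := transProb μ i (a.1 0)
  set q := transProb μ i (b.1 0)
  have hp0 : 0 ≤ p := transProb_nonneg _ _ _
  have hq0 : 0 ≤ q := transProb_nonneg _ _ _
  have hp1 : p ≤ 1 := transProb_le_one _ _ _
  have hq1 : q ≤ 1 := transProb_le_one _ _ _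
  have hu : ‖u‖ ≤ w.supNorm := w.norm_apply_le _
  have huv : ‖u - v‖ ≤ w.holderSeminorm * (C * pairDist θ α a b) :=
    (w.norm_sub_le _ _).trans (mul_le_mul_of_nonneg_left (h i a b) w.holderSeminorm_nonneg)
  have hρ : 0 ≤ projDist a.2 b.2 ^ (α : ℝ) := Real.rpow_nonneg (projDist_nonneg _ _) _
  have hpq : |p - q| ≤ pairDist θ α a b := by
    by_cases h0 : a.1 0 = b.1 0
    · have : p = q := by simp only [p, q, h0]
      rw [this, sub_self, abs_zero]
      exact pairDist_nonneg θ α a b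
    · rw [pairDist, seqDist_of_ne _ h0, abs_le]
      constructor <;> linarith
  calc ‖(p : ℂ) * u - (q : ℂ) * v‖
      = ‖((p - q : ℝ) : ℂ) * u + (q : ℂ) * (u - v)‖ := by push_cast; ring_nf
    _ ≤ ‖((p - q : ℝ) : ℂ) * u‖ + ‖(q : ℂ) * (u - v)‖ := norm_add_le _ _
    _ = |p - q| * ‖u‖ + q * ‖u - v‖ := by
        rw [norm_mul, norm_mul, Complex.norm_real, Complex.norm_real, Real.norm_eq_abs,
          Real.norm_of_nonneg hq0]
    _ ≤ pairDist θ α a b * w.supNorm + 1 * (w.holderSeminorm * (C * pairDist θ α a b)) := by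
        have := pairDist_nonneg θ α a b
        gcongr
    _ = (w.supNorm + C * w.holderSeminorm) * pairDist θ α a b := by ring

/-- The Markovian transfer operator `L₀` as a bounded operator on the function space. -/
def transferOp (μ : Measure (SymbolSeq k)) (M : Fin k → GL (Fin d) ℝ) (θ : Set.Ioo (0 : ℝ) 1)
    (α : Set.Ioi (0 : ℝ)) : HolderSpace k d θ α →L[ℂ] HolderSpace k d θ α :=
  LinearMap.mkContinuousOfExistsBound
    { toFun := fun w => ⟨transferFun μ M w,
        HolderSpace.isHolder_of_bound ((exists_transferFun_bound μ M θ α).choose_spec.2 w)⟩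
      map_add' := fun w w' => by
        ext a
        show transferFun μ M (w + w') a = transferFun μ M w a + transferFun μ M w' a
        simp only [transferFun, Pi.add_apply, mul_add, Finset.sum_add_distrib]
      map_smul' := fun c w => by
        ext a
        show transferFun μ M (c • w) a = c * transferFun μ M w a
        simp only [transferFun, Pi.smul_apply, smul_eq_mul, Finset.mul_sum]
        exact Finset.sum_congr rfl fun i _ => by ring }
    (by
      obtain ⟨C, hC, h⟩ := exists_transferFun_bound (d := d) μ M θ α
      refine ⟨k * (2 + C), fun w => ?_⟩
      have hs := w.supNorm_nonneg
      have ht := w.holderSeminorm_nonneg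
      have hk : (0 : ℝ) ≤ k := k.cast_nonneg
      have e1 := HolderSpace.supNorm_le (θ := θ) (α := α) ⟨transferFun μ M w, HolderSpace.isHolder_of_bound
        (h w)⟩ (mul_nonneg hk hs) (transferFun_norm_le μ M w)
      have e2 := HolderSpace.holderSeminorm_le (θ := θ) (α := α) ⟨transferFun μ M w,
        HolderSpace.isHolder_of_bound (h w)⟩ (by positivity) (h w)
      refine (add_le_add e1 e2).trans ?_
      rw [HolderSpace.norm_def]
      have : 0 ≤ (k : ℝ) * (2 * w.holderSeminorm + C * w.supNorm) := by positivity
      linarith)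

@[simp] theorem transferOp_apply (μ : Measure (SymbolSeq k)) (M : Fin k → GL (Fin d) ℝ)
    (w : HolderSpace k d θ α) (a : SymbolSeq k × Proj d) :
    transferOp μ M θ α w a =
      ∑ i : Fin k, (transProb μ i (a.1 0) : ℂ) * w (consSeq i a.1, M i • a.2) := rfl

end Transfer

/-! ### The operator `Q` -/

section Mean

variable {k d : ℕ} {θ : Set.Ioo (0 : ℝ) 1} {α : Set.Ioi (0 : ℝ)}

theorem continuous_projDist (x : Proj d) : Continuous (projDist x) := by
  refine Projectivization.ind (fun v hv => ?_) x
  refine continuous_coinduced_dom.2 ?_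
  have : projDist (Projectivization.mk ℝ v hv) ∘ Quotient.mk (projectivizationSetoid ℝ (Fin d → ℝ))
      = fun w => √(1 - (v ⬝ᵥ w.1) ^ 2 / ((v ⬝ᵥ v) * (w.1 ⬝ᵥ w.1))) :=
    funext fun w => projDist_mk v w.1 hv w.2
  refine this ▸ ?_
  refine Real.continuous_sqrt.comp (continuous_const.sub (Continuous.div ?_ ?_ fun w => ?_))
  · exact ((continuous_const.dotProduct continuous_subtype_val).pow 2)
  · exact continuous_const.mul (continuous_subtype_val.dotProduct continuous_subtype_val)
  · exact mul_ne_zero (dot_self_pos hv).ne' (dot_self_pos w.2).ne'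

theorem tendsto_seqDist (θ : Set.Ioo (0 : ℝ) 1) (ω : SymbolSeq k) :
    Tendsto (seqDist (θ : ℝ) ω) (𝓝 ω) (𝓝 0) := by
  rw [Metric.tendsto_nhds]
  intro ε hε
  obtain ⟨N, hN⟩ := exists_pow_lt_of_lt_one hε θ.2.2
  filter_upwards [(PiNat.isOpen_cylinder (fun _ : ℕ => Fin k) ω N).mem_nhds
    (PiNat.self_mem_cylinder ω N)] with ω' h
  rw [Real.dist_eq, sub_zero, abs_of_nonneg (seqDist_nonneg θ _ _)]
  by_cases e : ω = ω'
  · rwa [seqDist, if_pos e]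
  · rw [seqDist, if_neg e]
    refine lt_of_le_of_lt (pow_le_pow_of_le_one θ.2.1.le θ.2.2.le ?_) hN
    rw [PiNat.firstDiff_comm]
    exact (PiNat.mem_cylinder_iff_le_firstDiff (Ne.symm e) N).1 h

theorem HolderSpace.continuous (w : HolderSpace k d θ α) : Continuous w.1 := by
  rw [continuous_iff_continuousAt]
  intro a
  rw [ContinuousAt, tendsto_iff_norm_sub_tendsto_zero]
  have h0 : projDist a.2 a.2 = 0 := by
    refine Projectivization.ind (fun v hv => ?_) a.2
    have := (dot_self_pos hv).ne'
    rw [projDist_mk, sq, div_self (by positivity), sub_self, Real.sqrt_zero]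
  have h1 : Tendsto (fun b : SymbolSeq k × Proj d => projDist a.2 b.2 ^ (α : ℝ)) (𝓝 a) (𝓝 0) := by
    have : Continuous fun b : SymbolSeq k × Proj d => projDist a.2 b.2 ^ (α : ℝ) :=
      ((continuous_projDist a.2).comp continuous_snd).rpow_const fun _ => Or.inr (le_of_lt α.2)
    have h := this.tendsto a
    rwa [h0, Real.zero_rpow (ne_of_gt α.2)] at h
  have h2 : Tendsto (fun b : SymbolSeq k × Proj d => seqDist (θ : ℝ) a.1 b.1) (𝓝 a) (𝓝 0) :=
    (tendsto_seqDist θ a.1).comp continuous_fst.continuousAt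
  have h3 : Tendsto (fun b => w.holderSeminorm * pairDist θ α a b) (𝓝 a) (𝓝 0) := by
    simpa [pairDist] using (h1.add h2).const_mul w.holderSeminorm
  refine squeeze_zero (fun _ => norm_nonneg _) (fun b => ?_) h3
  rw [norm_sub_rev]
  exact w.norm_sub_le a b

theorem HolderSpace.integrable (w : HolderSpace k d θ α)
    (ν : ProbabilityMeasure (SymbolSeq k × Proj d)) :
    Integrable w.1 (ν : Measure (SymbolSeq k × Proj d)) :=
  Integrable.of_bound w.continuous.measurable.aestronglyMeasurable w.supNorm
    (Eventually.of_forall w.norm_apply_le)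

theorem isHolder_const (θ : Set.Ioo (0 : ℝ) 1) (α : Set.Ioi (0 : ℝ)) (c : ℂ) :
    IsHolder (k := k) (d := d) (θ : ℝ) (α : ℝ) (fun _ => c) :=
  HolderSpace.isHolder_of_bound (B := 0) fun _ _ => by simp

/-- The operator `(Q w)(ω, x) = ∫ w dν`, with values in the constant functions. -/
def meanOp (ν : ProbabilityMeasure (SymbolSeq k × Proj d)) (θ : Set.Ioo (0 : ℝ) 1)
    (α : Set.Ioi (0 : ℝ)) : HolderSpace k d θ α →L[ℂ] HolderSpace k d θ α :=
  LinearMap.mkContinuous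
    { toFun := fun w => ⟨fun _ => ∫ b, w b ∂(ν : Measure (SymbolSeq k × Proj d)),
        isHolder_const θ α _⟩
      map_add' := fun w w' => by
        ext a
        exact integral_add (w.integrable ν) (w'.integrable ν)
      map_smul' := fun c w => by
        ext a
        exact integral_const_mul c _ }
    1 (fun w => by
      have e0 : ‖∫ b, w b ∂(ν : Measure (SymbolSeq k × Proj d))‖ ≤ w.supNorm := by
        simpa using norm_integral_le_of_norm_le_const (μ := (ν : Measure (SymbolSeq k × Proj d)))
          (Eventually.of_forall w.norm_apply_le)
      set c := ∫ b, w b ∂(ν : Measure (SymbolSeq k × Proj d))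
      let g : HolderSpace k d θ α := ⟨fun _ => c, isHolder_const θ α c⟩
      have e1 : g.supNorm ≤ w.supNorm := HolderSpace.supNorm_le g w.supNorm_nonneg fun _ => e0
      have e2 : g.holderSeminorm ≤ 0 :=
        HolderSpace.holderSeminorm_le g le_rfl fun _ _ => by simp [g]
      refine (add_le_add e1 e2).trans ?_
      rw [HolderSpace.norm_def]
      linarith [w.holderSeminorm_nonneg])

@[simp] theorem meanOp_apply (ν : ProbabilityMeasure (SymbolSeq k × Proj d))
    (w : HolderSpace k d θ α) (a : SymbolSeq k × Proj d) :
    meanOp ν θ α w a = ∫ b, w b ∂(ν : Measure (SymbolSeq k × Proj d)) := rfl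

end Mean

end MarkovTransfer

end

open MarkovTransfer

/-! The operator L₀ averages over one step of a chain: with probability P_{iω₀} the symbol i is put
in front of ω and x moves to M_i x. Everything follows from an exponential contraction of the Hölder
seminorm by the powers of L₀ (`exists_holderSeminorm_contraction`). A function minus its mean is
controlled in norm by its seminorm, so L₀^n converges in operator norm to the mean operator Q of any
measure ν₀ fixed by the dual of L₀. The relations QL₀ = L₀Q = Q = Q² then give the spectral
statements. Any other invariant measure has the same marginal on sequences, which puts its mean
operator within 2/3 of Q (`norm_meanOp_sub_meanOp_le`) and so within distance less than 1 of L₀^n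
for large n.

In the sequence variable the contraction is elementary: a factor θ when the first symbols agree, and
otherwise a Doeblin coupling, available because all P_{ij} are positive. In the projective variable
one needs that, for a random product g of some fixed length, the expectation of d(gx, gy)^α is at
most 3/4 d(x, y)^α (`exists_moment_contraction`).

That estimate is obtained from martingales, without Lyapunov exponents. Take measures ν_j on unit
vectors that are stationary for the transposed matrices. By strong irreducibility they do not charge
hyperplanes (`measure_hyperplane`). For f homogeneous of degree zero, the mean of f(y g) over ν_j is
harmonic for the chain that multiplies g on the left by the M_i (`step_dualMean`). Two choices of f
are used.

If f is the indicator of near orthogonality to v, Doob's inequality shows that g rarely ever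
contracts v far below its own norm. Hence distances rarely ever grow by a large factor (`hit_le`),
and small moments of the distance stay bounded (`step_iterate_distPow_le`).

If f runs through the entries of the projection onto a line, the martingale is bounded, so its
increments tend to zero in mean square. By strong irreducibility and contraction its conditional
variance is positive at every matrix of rank at least two (`exists_varMean_pos`). So with high
probability g is nearly of rank one, and distances shrink (`exists_contraction_in_probability`).
Contraction in probability and bounded moments together contract a small moment
(`exists_step_iterate_distPow_le`). -/

noncomputable section

namespace MarkovTransfer

/-! ### Averaging over one step of a finite Markov chain -/

section Step

variable {k : ℕ} {X Y : Type*}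

/-- The operator `f ↦ ∑ i, P i j f(i, s i x)` on functions of a symbol and a point. -/
def step (P : Fin k → Fin k → ℝ) (s : Fin k → X → X) (f : Fin k → X → ℝ) : Fin k → X → ℝ :=
  fun j x => ∑ i, P i j * f i (s i x)

theorem step_mono {P : Fin k → Fin k → ℝ} (hP : ∀ i j, 0 ≤ P i j) (s : Fin k → X → X)
    {f g : Fin k → X → ℝ} (h : ∀ j x, f j x ≤ g j x) (j : Fin k) (x : X) :
    step P s f j x ≤ step P s g j x :=
  Finset.sum_le_sum fun i _ => mul_le_mul_of_nonneg_left (h i _) (hP i j)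

theorem step_iterate_mono {P : Fin k → Fin k → ℝ} (hP : ∀ i j, 0 ≤ P i j) (s : Fin k → X → X)
    {f g : Fin k → X → ℝ} (h : ∀ j x, f j x ≤ g j x) (n : ℕ) (j : Fin k) (x : X) :
    (step P s)^[n] f j x ≤ (step P s)^[n] g j x := by
  induction n generalizing j x with
  | zero => exact h j x
  | succ n ih =>
    rw [Function.iterate_succ_apply', Function.iterate_succ_apply']
    exact step_mono hP s ih j x

theorem step_add (P : Fin k → Fin k → ℝ) (s : Fin k → X → X) (f g : Fin k → X → ℝ) :
    step P s (f + g) = step P s f + step P s g := by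
  funext j x
  simp [step, mul_add, Finset.sum_add_distrib]

theorem step_smul (P : Fin k → Fin k → ℝ) (s : Fin k → X → X) (c : ℝ) (f : Fin k → X → ℝ) :
    step P s (c • f) = c • step P s f := by
  funext j x
  simp only [step, Pi.smul_apply, smul_eq_mul, Finset.mul_sum]
  exact Finset.sum_congr rfl fun i _ => by ring

/-- `step` as a linear map. -/
def stepLin (P : Fin k → Fin k → ℝ) (s : Fin k → X → X) :
    (Fin k → X → ℝ) →ₗ[ℝ] (Fin k → X → ℝ) where
  toFun := step P s
  map_add' := step_add P s
  map_smul' := step_smul P s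

theorem step_iterate_eq (P : Fin k → Fin k → ℝ) (s : Fin k → X → X) (n : ℕ)
    (f : Fin k → X → ℝ) : (step P s)^[n] f = (stepLin P s ^ n) f := by
  rw [Module.End.pow_apply]
  rfl

theorem step_iterate_add (P : Fin k → Fin k → ℝ) (s : Fin k → X → X) (n : ℕ)
    (f g : Fin k → X → ℝ) :
    (step P s)^[n] (f + g) = (step P s)^[n] f + (step P s)^[n] g := by
  simp only [step_iterate_eq, map_add]

theorem step_iterate_sub (P : Fin k → Fin k → ℝ) (s : Fin k → X → X) (n : ℕ)
    (f g : Fin k → X → ℝ) :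
    (step P s)^[n] (f - g) = (step P s)^[n] f - (step P s)^[n] g := by
  simp only [step_iterate_eq, map_sub]

theorem step_iterate_smul (P : Fin k → Fin k → ℝ) (s : Fin k → X → X) (n : ℕ)
    (c : ℝ) (f : Fin k → X → ℝ) :
    (step P s)^[n] (c • f) = c • (step P s)^[n] f := by
  simp only [step_iterate_eq, map_smul]

theorem step_const {P : Fin k → Fin k → ℝ} (hP : ∀ j, ∑ i, P i j = 1) (s : Fin k → X → X)
    (c : ℝ) : step P s (fun _ _ => c) = fun _ _ => c := by
  funext j x
  simp [step, ← Finset.sum_mul, hP]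

theorem step_iterate_const {P : Fin k → Fin k → ℝ} (hP : ∀ j, ∑ i, P i j = 1)
    (s : Fin k → X → X) (c : ℝ) (n : ℕ) :
    (step P s)^[n] (fun _ _ => c) = fun _ _ => c :=
  Function.iterate_fixed (step_const hP s c) n

theorem step_iterate_nonneg {P : Fin k → Fin k → ℝ} (hP : ∀ i j, 0 ≤ P i j) (s : Fin k → X → X)
    {f : Fin k → X → ℝ} (h : ∀ j x, 0 ≤ f j x) (n : ℕ) (j : Fin k) (x : X) :
    0 ≤ (step P s)^[n] f j x := by
  induction n generalizing j x with
  | zero => exact h j x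
  | succ n ih =>
    rw [Function.iterate_succ_apply']
    exact Finset.sum_nonneg fun i _ => mul_nonneg (hP i j) (ih i _)

/-- `step` commutes with pulling back along an equivariant map. -/
theorem step_iterate_comp (P : Fin k → Fin k → ℝ) {s : Fin k → X → X} {t : Fin k → Y → Y}
    {π : X → Y} (h : ∀ i x, π (s i x) = t i (π x)) (f : Fin k → Y → ℝ) (n : ℕ)
    (j : Fin k) (x : X) :
    (step P s)^[n] (fun j x => f j (π x)) j x = (step P t)^[n] f j (π x) := by
  induction n generalizing j x with
  | zero => rfl
  | succ n ih =>
    rw [Function.iterate_succ_apply', Function.iterate_succ_apply']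
    exact Finset.sum_congr rfl fun i _ => by rw [ih, h]

end Step

/-! ### The transition probabilities of a Markovian full shift -/

section Shift

variable {k : ℕ} {μ : Measure (SymbolSeq k)}

theorem measurable_shift : Measurable (shift : SymbolSeq k → SymbolSeq k) :=
  measurable_pi_lambda _ fun n => measurable_pi_apply (n + 1)

theorem continuous_consSeq (i : Fin k) : Continuous (consSeq i) := by
  refine continuous_pi fun n => ?_
  cases n with
  | zero => exact continuous_const
  | succ n => exact continuous_apply n

theorem measurableSet_coord (n : ℕ) (a : Fin k) : MeasurableSet {ω : SymbolSeq k | ω n = a} :=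
  (measurable_pi_apply n : Measurable fun ω : SymbolSeq k => ω n) (measurableSet_singleton a)

theorem measurableSet_cyl (n : ℕ) (a : SymbolSeq k) :
    MeasurableSet {ω : SymbolSeq k | ∀ i ≤ n, ω i = a i} := by
  have : {ω : SymbolSeq k | ∀ i ≤ n, ω i = a i} = ⋂ i ∈ Set.Iic n, {ω | ω i = a i} := by
    ext ω; simp
  rw [this]
  exact MeasurableSet.biInter (Set.to_countable _) fun i _ => measurableSet_coord i _

theorem IsMarkovianFullShift.measure_coord_pos (hμ : IsMarkovianFullShift μ) (n : ℕ) (a : Fin k) :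
    0 < μ {ω | ω n = a} :=
  (hμ.full n fun _ => a).trans_le (measure_mono fun _ h => h n le_rfl)

theorem IsMarkovianFullShift.measure_coord (hμ : IsMarkovianFullShift μ) (n : ℕ) (a : Fin k) :
    μ {ω | ω (n + 1) = a} = μ {ω | ω n = a} :=
  hμ.invariant.measure_preimage (measurableSet_coord n a).nullMeasurableSet

theorem IsMarkovianFullShift.measure_coord_pair (hμ : IsMarkovianFullShift μ) (n : ℕ)
    (a b : Fin k) :
    μ ({ω | ω (n + 1) = a} ∩ {ω | ω (n + 2) = b}) = μ ({ω | ω n = a} ∩ {ω | ω (n + 1) = b}) :=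
  hμ.invariant.measure_preimage
    ((measurableSet_coord n a).inter (measurableSet_coord (n + 1) b)).nullMeasurableSet

theorem IsMarkovianFullShift.transProb_pos (hμ : IsMarkovianFullShift μ) (i j : Fin k) :
    0 < transProb μ i j := by
  have := hμ.isProbability
  have h1 : 0 < μ ({ω | ω 1 = j} ∩ {ω | ω 0 = i}) := by
    refine (hμ.full 1 (fun n => if n = 0 then i else j)).trans_le (measure_mono fun ω h => ?_)
    exact ⟨by simpa using h 1 le_rfl, by simpa using h 0 zero_le_one⟩
  unfold transProb
  rw [Measure.real, ProbabilityTheory.cond_apply (measurableSet_coord 1 j)]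
  refine ENNReal.toReal_pos ?_ ?_
  · exact mul_ne_zero (ENNReal.inv_ne_zero.2 (measure_ne_top _ _)) h1.ne'
  · exact ENNReal.mul_ne_top (ENNReal.inv_ne_top.2 (hμ.measure_coord_pos 1 j).ne')
      (measure_ne_top _ _)

theorem IsMarkovianFullShift.sum_transProb (hμ : IsMarkovianFullShift μ) (j : Fin k) :
    ∑ i, transProb μ i j = 1 := by
  have := hμ.isProbability
  have := ProbabilityTheory.cond_isProbabilityMeasure (hμ.measure_coord_pos 1 j).ne'
  have h := measureReal_biUnion_finset (μ := ProbabilityTheory.cond μ {ω | ω 1 = j})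
    (s := (Finset.univ : Finset (Fin k))) (f := fun i => {ω : SymbolSeq k | ω 0 = i})
    (fun a _ b _ hab => Set.disjoint_left.2 fun ω h1 h2 => hab (h1.symm.trans h2))
    (fun i _ => measurableSet_coord 0 i)
  unfold transProb
  rw [← h]
  have : (⋃ i ∈ (Finset.univ : Finset (Fin k)), {ω : SymbolSeq k | ω 0 = i}) = Set.univ := by
    ext ω; simp
  rw [this]
  simp

/-- `P_{ij} μ(ω₀ = j) = μ(ω₀ = i, ω₁ = j)`. -/
theorem IsMarkovianFullShift.transProb_mul (hμ : IsMarkovianFullShift μ) (i j : Fin k) :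
    ENNReal.ofReal (transProb μ i j) * μ {ω | ω 0 = j} = μ ({ω | ω 0 = i} ∩ {ω | ω 1 = j}) := by
  have := hμ.isProbability
  unfold transProb
  rw [ofReal_measureReal, ← hμ.measure_coord 0 j, zero_add,
    ProbabilityTheory.cond_mul_eq_inter (measurableSet_coord 1 j), Set.inter_comm]

/-- The Markov property: adding one symbol at the end of a word multiplies the measure of its
cylinder by a factor that depends on the last two symbols only. -/
theorem IsMarkovianFullShift.measure_cyl_succ (hμ : IsMarkovianFullShift μ) (n : ℕ)
    (a : SymbolSeq k) :
    μ {ω | ∀ i ≤ n + 1, ω i = a i} =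
      ProbabilityTheory.cond μ {ω | ω 0 = a n} {ω | ω 1 = a (n + 1)} *
        μ {ω | ∀ i ≤ n, ω i = a i} := by
  have := hμ.isProbability
  have h1 : {ω : SymbolSeq k | ∀ i ≤ n + 1, ω i = a i} =
      {ω | ∀ i ≤ n, ω i = a i} ∩ {ω | ω (n + 1) = a (n + 1)} := by
    ext ω
    constructor
    · exact fun h => ⟨fun i hi => h i (by omega), h _ le_rfl⟩
    · rintro ⟨h, h'⟩ i hi
      rcases Nat.lt_or_ge i (n + 1) with hlt | hge
      · exact h i (by omega)
      · obtain rfl : i = n + 1 := by omega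
        exact h'
  rw [h1, ← ProbabilityTheory.cond_mul_eq_inter (measurableSet_cyl n a),
    hμ.markov n a (hμ.full n a).ne']
  congr 1
  rw [ProbabilityTheory.cond_apply (measurableSet_coord n _),
    ProbabilityTheory.cond_apply (measurableSet_coord 0 _)]
  have h2 : ∀ (n : ℕ) (b : Fin k), μ {ω | ω n = b} = μ {ω | ω 0 = b} := fun n b => by
    induction n with
    | zero => rfl
    | succ n ih => rw [hμ.measure_coord, ih]
  have h3 : ∀ (n : ℕ) (b c : Fin k), μ ({ω | ω n = b} ∩ {ω | ω (n + 1) = c}) =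
      μ ({ω | ω 0 = b} ∩ {ω | ω 1 = c}) := fun n b c => by
    induction n with
    | zero => rfl
    | succ n ih => rw [hμ.measure_coord_pair, ih]
  rw [h2, h3]

/-- The Markov property controls the symbol appended at the end of a word, whereas here one is put
at the front. Induction on the length reconciles the two: lengthening a word at its end multiplies
both sides by the same factor, which does not see the first symbol. -/
theorem IsMarkovianFullShift.measure_cyl_cons (hμ : IsMarkovianFullShift μ) (i : Fin k) (n : ℕ)
    (a : SymbolSeq k) :
    μ {ω | ∀ m ≤ n + 1, ω m = consSeq i a m} =
      ENNReal.ofReal (transProb μ i (a 0)) * μ {ω | ∀ m ≤ n, ω m = a m} := by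
  induction n with
  | zero =>
    have e1 : {ω : SymbolSeq k | ∀ m ≤ 0, ω m = a m} = {ω | ω 0 = a 0} := by
      ext ω; simp
    have e2 : {ω : SymbolSeq k | ∀ m ≤ 0 + 1, ω m = consSeq i a m} =
        {ω | ω 0 = i} ∩ {ω | ω 1 = a 0} := by
      ext ω
      constructor
      · exact fun h => ⟨h 0 (by omega), h 1 (by omega)⟩
      · rintro ⟨h, h'⟩ m hm
        rcases Nat.le_one_iff_eq_zero_or_eq_one.1 hm with rfl | rfl
        · exact h
        · exact h'
    rw [e1, e2, hμ.transProb_mul]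
  | succ n ih =>
    rw [hμ.measure_cyl_succ (n + 1), ih, hμ.measure_cyl_succ n]
    show _ * (_ * _) = _ * (_ * _)
    rw [mul_left_comm]
    rfl

/-- Together with the empty set, the cylinders over words of length at least two form a generating
π-system. Words of length one are left out because removing the first symbol must leave a non-empty
word. -/
theorem measure_ext_cyl {m m' : Measure (SymbolSeq k)} [IsFiniteMeasure m]
    (huniv : m Set.univ = m' Set.univ)
    (h : ∀ (n : ℕ) (a : SymbolSeq k),
      m {ω | ∀ i ≤ n + 1, ω i = a i} = m' {ω | ∀ i ≤ n + 1, ω i = a i}) : m = m' := by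
  set C : Set (Set (SymbolSeq k)) :=
    insert ∅ (Set.range fun p : ℕ × SymbolSeq k => {ω | ∀ i ≤ p.1 + 1, ω i = p.2 i}) with hC
  have hgen : MeasurableSpace.pi = MeasurableSpace.generateFrom C := by
    refine le_antisymm ?_ ?_
    · refine iSup_le fun n => ?_
      rw [← measurable_iff_comap_le]
      refine @measurable_to_countable' _ _ _ _ (MeasurableSpace.generateFrom C) _ fun b => ?_
      -- A condition on coordinate `n` is a finite union of cylinders over words of length `n + 2`.
      -- Each word is padded to a sequence with the irrelevant value `b`.
      have : (fun ω : SymbolSeq k => ω n) ⁻¹' {b} =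
          ⋃ c : Fin (n + 2) → Fin k, ⋃ (_ : c ⟨n, by omega⟩ = b),
            {ω : SymbolSeq k | ∀ i ≤ n + 1, ω i = if h : i < n + 2 then c ⟨i, h⟩ else b} := by
        ext ω
        simp only [Set.mem_preimage, Set.mem_singleton_iff, Set.mem_iUnion, Set.mem_ofPred_eq]
        constructor
        · intro hb
          refine ⟨fun i => ω i, hb, fun i hi => ?_⟩
          rw [dif_pos (by omega)]
        · rintro ⟨c, hc, h⟩
          have := h n (by omega)
          rw [dif_pos (by omega)] at this
          rw [this, ← hc]
      rw [this]
      refine MeasurableSet.iUnion fun c => MeasurableSet.iUnion fun _ => ?_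
      exact MeasurableSpace.measurableSet_generateFrom
        (Or.inr ⟨(n, fun i => if h : i < n + 2 then c ⟨i, h⟩ else b), rfl⟩)
    · refine MeasurableSpace.generateFrom_le ?_
      rintro _ (rfl | ⟨p, rfl⟩)
      · exact MeasurableSet.empty
      · exact measurableSet_cyl (p.1 + 1) p.2
  refine ext_of_generate_finite C hgen ?_ ?_ huniv
  · rintro _ (rfl | ⟨⟨n, a⟩, rfl⟩) _ (rfl | ⟨⟨n', a'⟩, rfl⟩) hne
    · exact Or.inl (by simp)
    · exact Or.inl (by simp)
    · exact Or.inl (by simp)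
    · obtain ⟨ω₀, h₁, h₂⟩ := hne
      refine Or.inr ⟨(max n n', ω₀), ?_⟩
      ext ω
      simp only [Set.mem_ofPred_eq, Set.mem_inter_iff] at h₁ h₂ ⊢
      constructor
      · exact fun h => ⟨fun i hi => (h i (by omega)).trans (h₁ i hi),
          fun i hi => (h i (by omega)).trans (h₂ i hi)⟩
      · rintro ⟨h3, h4⟩ i hi
        rcases le_total n n' with h5 | h5
        · exact (h4 i (by omega)).trans (h₂ i (by omega)).symm
        · exact (h3 i (by omega)).trans (h₁ i (by omega)).symm
  · rintro _ (rfl | ⟨⟨n, a⟩, rfl⟩)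
    · simp
    · exact h n a

theorem measurable_transProb_zero (μ : Measure (SymbolSeq k)) (i : Fin k) :
    Measurable fun ω : SymbolSeq k => ENNReal.ofReal (transProb μ i (ω 0)) :=
  (measurable_of_countable (fun j => ENNReal.ofReal (transProb μ i j))).comp
    (measurable_pi_apply 0)

theorem IsMarkovianFullShift.sum_ofReal_transProb (hμ : IsMarkovianFullShift μ) (j : Fin k) :
    ∑ i, ENNReal.ofReal (transProb μ i j) = 1 := by
  rw [← ENNReal.ofReal_sum_of_nonneg fun i _ => transProb_nonneg μ i j, hμ.sum_transProb,
    ENNReal.ofReal_one]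

/-- The measure is invariant under the dual of the transfer operator. -/
theorem IsMarkovianFullShift.sum_map_cons (hμ : IsMarkovianFullShift μ) :
    ∑ i, (μ.withDensity fun ω => ENNReal.ofReal (transProb μ i (ω 0))).map (consSeq i) = μ := by
  have := hμ.isProbability
  have hm : ∀ i : Fin k, Measurable (consSeq i) := fun i => (continuous_consSeq i).measurable
  refine (measure_ext_cyl ?_ fun n a => ?_).symm
  · rw [Measure.finsetSum_apply]
    simp only [Measure.map_apply (hm _) MeasurableSet.univ, Set.preimage_univ,
      withDensity_apply _ MeasurableSet.univ, Measure.restrict_univ]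
    rw [← lintegral_finsetSum _ fun i _ => measurable_transProb_zero μ i]
    simp [hμ.sum_ofReal_transProb]
  · have ha : a = consSeq (a 0) (shift a) := by
      funext m; cases m <;> rfl
    -- Only the branch that prepends `a 0` meets the cylinder. The preimage under that branch is the
    -- cylinder of the shifted word, on which the density is constant.
    rw [Measure.finsetSum_apply, Finset.sum_eq_single (a 0)]
    · rw [Measure.map_apply (hm _) (measurableSet_cyl _ _)]
      have : consSeq (a 0) ⁻¹' {ω | ∀ i ≤ n + 1, ω i = a i} = {ω | ∀ i ≤ n, ω i = shift a i} := by
        ext ω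
        constructor
        · exact fun h i hi => h (i + 1) (by omega)
        · intro h i hi
          cases i with
          | zero => rfl
          | succ i => exact h i (by omega)
      rw [this, withDensity_apply _ (measurableSet_cyl _ _),
        setLIntegral_congr_fun (g := fun _ => ENNReal.ofReal (transProb μ (a 0) (shift a 0)))
          (measurableSet_cyl _ _), setLIntegral_const, ← hμ.measure_cyl_cons, ← ha]
      intro ω h
      show ENNReal.ofReal (transProb μ (a 0) (ω 0)) = _
      rw [h 0 (Nat.zero_le _)]
    · intro i _ hi
      rw [Measure.map_apply (hm _) (measurableSet_cyl _ _)]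
      have : consSeq i ⁻¹' {ω | ∀ i ≤ n + 1, ω i = a i} = ∅ := by
        ext ω
        simp only [Set.mem_preimage, Set.mem_ofPred_eq, Set.mem_empty_iff_false, iff_false]
        exact fun h => hi (h 0 (Nat.zero_le _))
      rw [this, measure_empty]
    · simp

end Shift

/-! ### Cesàro limits of probability measures on a compact space -/

section Cesaro

variable {X J : Type*} [TopologicalSpace X] [CompactSpace X] [MeasurableSpace X] [BorelSpace X]

theorem _root_.ContinuousMap.integrable_of_compact (f : C(X, ℝ)) (m : Measure X)
    [IsFiniteMeasure m] : Integrable f m :=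
  Integrable.of_bound f.continuous.measurable.aestronglyMeasurable ‖f‖
    (Eventually.of_forall f.norm_coe_le_norm)

variable [T2Space X]

/-- The limit of the time averages is taken along an ultrafilter, which exists by compactness of the
product of the spaces of probability measures. A linear relation between times t + 1 and t
telescopes in the averages up to an error 2‖f‖/(n + 1), hence holds exactly in the limit. The second
clause keeps integrals that do not depend on time, such as those that determine a marginal. -/
theorem exists_cesaro_limit (a : ℕ → J → ProbabilityMeasure X) :
    ∃ ν : J → ProbabilityMeasure X,
      (∀ {ι : Type} [Fintype ι] (j : J) (f : C(X, ℝ)) (g : ι → C(X, ℝ)) (e : ι → J),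
        (∀ t, ∫ x, f x ∂(a (t + 1) j : Measure X) = ∑ i, ∫ x, g i x ∂(a t (e i) : Measure X)) →
          ∫ x, f x ∂(ν j : Measure X) = ∑ i, ∫ x, g i x ∂(ν (e i) : Measure X)) ∧
      ∀ (j : J) (f : C(X, ℝ)) (c : ℝ), (∀ t, ∫ x, f x ∂(a t j : Measure X) = c) →
        ∫ x, f x ∂(ν j : Measure X) = c := by
  have hprob : ∀ (n : ℕ) (j : J), IsProbabilityMeasure
      (((n : ENNReal) + 1)⁻¹ • ∑ t ∈ Finset.range (n + 1), (a t j : Measure X)) := fun n j => by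
    constructor
    rw [Measure.smul_apply, Measure.finsetSum_apply]
    simp only [measure_univ, Finset.sum_const, Finset.card_range, smul_eq_mul, nsmul_eq_mul,
      mul_one]
    push_cast
    exact ENNReal.inv_mul_cancel (by simp) (by finiteness)
  let avg : ℕ → J → ProbabilityMeasure X := fun n j => ⟨_, hprob n j⟩
  have havg : ∀ n j (f : C(X, ℝ)), ∫ x, f x ∂(avg n j : Measure X) =
      ((n : ℝ) + 1)⁻¹ * ∑ t ∈ Finset.range (n + 1), ∫ x, f x ∂(a t j : Measure X) := by
    intro n j f
    show ∫ x, f x ∂(((n : ENNReal) + 1)⁻¹ •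
      ∑ t ∈ Finset.range (n + 1), (a t j : Measure X)) = _
    rw [integral_smul_measure, integral_finsetSum_measure fun i _ => f.integrable_of_compact _,
      smul_eq_mul, ENNReal.toReal_inv, ENNReal.toReal_add (by simp) (by simp)]
    simp
  let U : Ultrafilter ℕ := hyperfilter ℕ
  have hU : (U : Filter ℕ) ≤ atTop := Nat.hyperfilter_le_atTop
  have : Nonempty (J → ProbabilityMeasure X) := ⟨a 0⟩
  let ν : J → ProbabilityMeasure X := (U.map avg).lim
  have hlim : Tendsto avg U (𝓝 ν) := (U.map avg).le_nhds_lim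
  have hlim' : ∀ j (f : C(X, ℝ)), Tendsto (fun n => ∫ x, f x ∂(avg n j : Measure X)) U
      (𝓝 (∫ x, f x ∂(ν j : Measure X))) := fun j f =>
    ProbabilityMeasure.tendsto_iff_forall_integral_tendsto.1 (tendsto_pi_nhds.1 hlim j)
      (BoundedContinuousFunction.mkOfCompact f)
  refine ⟨ν, fun j f g e h => ?_, fun j f c h => ?_⟩
  · have h1 : Tendsto (fun n => ∫ x, f x ∂(avg n j : Measure X) -
        ∑ i, ∫ x, g i x ∂(avg n (e i) : Measure X)) U
        (𝓝 (∫ x, f x ∂(ν j : Measure X) - ∑ i, ∫ x, g i x ∂(ν (e i) : Measure X))) :=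
      (hlim' j f).sub (tendsto_finsetSum _ fun i _ => hlim' (e i) (g i))
    have h2 : Tendsto (fun n : ℕ => ((n : ℝ) + 1)⁻¹ * (2 * ‖f‖)) U (𝓝 0) := by
      have : Tendsto (fun n : ℕ => (1 / ((n : ℝ) + 1))) atTop (𝓝 0) :=
        tendsto_one_div_add_atTop_nhds_zero_nat
      simpa using (this.mono_left hU).mul_const (2 * ‖f‖)
    have hb : ∀ t, |∫ x, f x ∂(a t j : Measure X)| ≤ ‖f‖ := fun t => by
      simpa using norm_integral_le_of_norm_le_const (μ := (a t j : Measure X))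
        (Eventually.of_forall f.norm_coe_le_norm)
    have h3 : Tendsto (fun n => ∫ x, f x ∂(avg n j : Measure X) -
        ∑ i, ∫ x, g i x ∂(avg n (e i) : Measure X)) U (𝓝 0) := by
      refine squeeze_zero_norm (fun n => ?_) h2
      simp only [havg]
      rw [← Finset.mul_sum, Finset.sum_comm]
      simp only [← h]
      rw [← mul_sub, ← Finset.sum_sub_distrib, Finset.sum_range_sub', norm_mul, Real.norm_eq_abs,
        Real.norm_eq_abs, abs_of_pos (by positivity)]
      refine mul_le_mul_of_nonneg_left ?_ (by positivity)
      exact (abs_sub _ _).trans (by linarith [hb 0, hb (n + 1)])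
    exact sub_eq_zero.1 (tendsto_nhds_unique h1 h3)
  · refine tendsto_nhds_unique (hlim' j f) (tendsto_const_nhds.congr fun n => ?_)
    rw [havg, Finset.sum_congr rfl fun t _ => h t]
    simp
    field_simp

variable [HasOuterApproxClosed X]

/-- The Krylov–Bogolyubov argument: iterate the map on families of measures from a Dirac mass and
pass to a Cesàro limit. -/
theorem exists_stationary_family {k : ℕ} {P : Fin k → Fin k → ℝ} (hP : ∀ i j, 0 ≤ P i j)
    (hP1 : ∀ j, ∑ i, P i j = 1) {s : Fin k → X → X} (hs : ∀ i, Continuous (s i)) (x₀ : X) :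
    ∃ ν : Fin k → ProbabilityMeasure X, ∀ j,
      (ν j : Measure X) = ∑ i, ENNReal.ofReal (P i j) • (ν i : Measure X).map (s i) := by
  have hprob : ∀ (m : Fin k → ProbabilityMeasure X) j, IsProbabilityMeasure
      (∑ i, ENNReal.ofReal (P i j) • (m i : Measure X).map (s i)) := fun m j => by
    constructor
    rw [Measure.finsetSum_apply]
    simp only [Measure.smul_apply, Measure.map_apply (hs _).measurable MeasurableSet.univ,
      Set.preimage_univ, measure_univ, smul_eq_mul, mul_one]
    rw [← ENNReal.ofReal_sum_of_nonneg fun i _ => hP i j, hP1, ENNReal.ofReal_one]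
  let S : (Fin k → ProbabilityMeasure X) → Fin k → ProbabilityMeasure X := fun m j => ⟨_, hprob m j⟩
  have hS : ∀ (m : Fin k → ProbabilityMeasure X) j (f : C(X, ℝ)), ∫ x, f x ∂(S m j : Measure X) =
      ∑ i, ∫ x, (P i j • f.comp ⟨s i, hs i⟩ : C(X, ℝ)) x ∂(m i : Measure X) := by
    intro m j f
    show ∫ x, f x ∂(∑ i, ENNReal.ofReal (P i j) • (m i : Measure X).map (s i)) = _
    have := fun i => Measure.isProbabilityMeasure_map (μ := (m i : Measure X))
      (hs i).measurable.aemeasurable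
    rw [integral_finsetSum_measure fun i _ =>
      (f.integrable_of_compact _).smul_measure ENNReal.ofReal_ne_top]
    refine Finset.sum_congr rfl fun i _ => ?_
    rw [integral_smul_measure, integral_map (hs i).measurable.aemeasurable
      f.continuous.measurable.aestronglyMeasurable, ENNReal.toReal_ofReal (hP i j)]
    simp [integral_const_mul]
  let m₀ : Fin k → ProbabilityMeasure X := fun _ => ⟨Measure.dirac x₀, inferInstance⟩
  let a : ℕ → Fin k → ProbabilityMeasure X := fun n => S^[n] m₀
  obtain ⟨ν, hν, -⟩ := exists_cesaro_limit a
  refine ⟨ν, fun j => ?_⟩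
  have := hprob ν j
  refine ext_of_forall_integral_eq_of_IsFiniteMeasure fun f => ?_
  have h1 := hν j f.toContinuousMap (fun i => P i j • f.toContinuousMap.comp ⟨s i, hs i⟩) id
    fun t => by
      have : a (t + 1) = S (a t) := Function.iterate_succ_apply' S t m₀
      rw [this, hS]
      rfl
  exact h1.trans (hS ν j f.toContinuousMap).symm

end Cesaro

/-! ### Unit vectors -/

/-- The unit sphere of `ℝ^d`. -/
abbrev UnitVec (d : ℕ) : Type := {v : Fin d → ℝ // v ⬝ᵥ v = 1}

section UnitVec

variable {d : ℕ}

theorem abs_apply_le_of_dot_self_le {v : Fin d → ℝ} {c : ℝ} (hc : 0 ≤ c) (h : v ⬝ᵥ v ≤ c ^ 2)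
    (i : Fin d) : |v i| ≤ c := by
  refine abs_le_of_sq_le_sq ?_ hc
  refine le_trans ?_ h
  rw [sq]
  exact Finset.single_le_sum (f := fun i => v i * v i) (fun i _ => mul_self_nonneg _)
    (Finset.mem_univ i)

instance : CompactSpace (UnitVec d) := by
  suffices h : IsCompact {v : Fin d → ℝ | v ⬝ᵥ v = 1} from isCompact_iff_compactSpace.1 h
  refine (isCompact_univ_pi fun _ : Fin d => isCompact_Icc (a := (-1 : ℝ)) (b := 1)).of_isClosed_subset
    (isClosed_eq (continuous_id.dotProduct continuous_id) continuous_const) fun v hv i _ => ?_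
  have hv' : v ⬝ᵥ v = 1 := hv
  exact abs_le.1 (abs_apply_le_of_dot_self_le zero_le_one (by rw [hv']; norm_num) i)

theorem UnitVec.ne_zero (v : UnitVec d) : v.1 ≠ 0 := fun h => by
  have := v.2
  rw [h] at this
  simp at this

/-- The unit vector in the direction of a nonzero vector. -/
def unitOf (z : Fin d → ℝ) (hz : z ≠ 0) : UnitVec d :=
  ⟨(√(z ⬝ᵥ z))⁻¹ • z, by
    have := dot_self_pos hz
    rw [smul_dotProduct, dotProduct_smul, smul_eq_mul, smul_eq_mul, ← mul_assoc, ← mul_inv,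
      Real.mul_self_sqrt this.le, inv_mul_cancel₀ this.ne']⟩

theorem continuous_unitOf {X : Type*} [TopologicalSpace X] {f : X → Fin d → ℝ}
    (hf : Continuous f) (h0 : ∀ x, f x ≠ 0) : Continuous fun x => unitOf (f x) (h0 x) := by
  refine Continuous.subtype_mk ?_ _
  have h : Continuous fun x => √(f x ⬝ᵥ f x) := Real.continuous_sqrt.comp (hf.dotProduct hf)
  exact (h.inv₀ fun x => (Real.sqrt_pos.2 (dot_self_pos (h0 x))).ne').smul hf

theorem exists_unitOf_eq (z : Fin d → ℝ) (hz : z ≠ 0) : ∃ c : ℝ, c ≠ 0 ∧ (unitOf z hz).1 = c • z :=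
  ⟨_, inv_ne_zero (Real.sqrt_pos.2 (dot_self_pos hz)).ne', rfl⟩

theorem vecMul_GL_ne_zero (g : GL (Fin d) ℝ) {y : Fin d → ℝ} (hy : y ≠ 0) :
    y ᵥ* (g : Matrix (Fin d) (Fin d) ℝ) ≠ 0 := fun h => hy <| by
  have := congrArg (fun z => z ᵥ* ((g⁻¹ : GL (Fin d) ℝ) : Matrix (Fin d) (Fin d) ℝ)) h
  simpa [Matrix.vecMul_vecMul, ← Units.val_mul] using this

theorem mulVec_GL_ne_zero (g : GL (Fin d) ℝ) {y : Fin d → ℝ} (hy : y ≠ 0) :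
    (g : Matrix (Fin d) (Fin d) ℝ) *ᵥ y ≠ 0 := fun h => hy <| by
  have := congrArg (fun z => ((g⁻¹ : GL (Fin d) ℝ) : Matrix (Fin d) (Fin d) ℝ) *ᵥ z) h
  simpa [Matrix.mulVec_mulVec, ← Units.val_mul] using this

theorem exists_unitVec (hd : 0 < d) : Nonempty (UnitVec d) := by
  have : (fun _ : Fin d => (1 : ℝ)) ≠ 0 := fun h => by
    have := congrFun h ⟨0, hd⟩
    simp at this
  exact ⟨unitOf _ this⟩

end UnitVec

/-! ### Stationary families of measures for the transposed matrices -/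

section Dual

variable {k d : ℕ}

/-- The action of the transpose of an invertible matrix on unit vectors. -/
def dualAct (g : GL (Fin d) ℝ) (y : UnitVec d) : UnitVec d :=
  unitOf (y.1 ᵥ* (g : Matrix (Fin d) (Fin d) ℝ)) (vecMul_GL_ne_zero g y.ne_zero)

theorem continuous_dualAct (g : GL (Fin d) ℝ) : Continuous (dualAct g) :=
  continuous_unitOf (continuous_subtype_val.matrix_vecMul continuous_const) _

/-- `ν_j = ∑ i, P i j (M_iᵀ)_* ν_i`. -/
def IsDualStationary (P : Fin k → Fin k → ℝ) (M : Fin k → GL (Fin d) ℝ)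
    (ν : Fin k → ProbabilityMeasure (UnitVec d)) : Prop :=
  ∀ j, (ν j : Measure (UnitVec d)) =
    ∑ i, ENNReal.ofReal (P i j) • (ν i : Measure (UnitVec d)).map (dualAct (M i))

variable {P : Fin k → Fin k → ℝ} {M : Fin k → GL (Fin d) ℝ}
  {ν : Fin k → ProbabilityMeasure (UnitVec d)}

/-- Left multiplication by the matrices `M i`. -/
def leftMul (M : Fin k → GL (Fin d) ℝ) (i : Fin k) (g : Matrix (Fin d) (Fin d) ℝ) :
    Matrix (Fin d) (Fin d) ℝ :=
  (M i : Matrix (Fin d) (Fin d) ℝ) * g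

/-- The mean of `f` over the image of `ν j` under the transpose of `g`. -/
def dualMean (ν : Fin k → ProbabilityMeasure (UnitVec d)) (f : (Fin d → ℝ) → ℝ) (j : Fin k)
    (g : Matrix (Fin d) (Fin d) ℝ) : ℝ :=
  ∫ y, f (y.1 ᵥ* g) ∂(ν j : Measure (UnitVec d))

theorem measurable_comp_vecMul {f : (Fin d → ℝ) → ℝ} (hf : Measurable f)
    (g : Matrix (Fin d) (Fin d) ℝ) : Measurable fun y : UnitVec d => f (y.1 ᵥ* g) :=
  hf.comp (continuous_subtype_val.matrix_vecMul continuous_const).measurable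

theorem integrable_comp_vecMul {f : (Fin d → ℝ) → ℝ} (hf : Measurable f) {B : ℝ}
    (hB : ∀ z, |f z| ≤ B) (g : Matrix (Fin d) (Fin d) ℝ) (m : Measure (UnitVec d))
    [IsFiniteMeasure m] : Integrable (fun y : UnitVec d => f (y.1 ᵥ* g)) m :=
  Integrable.of_bound (measurable_comp_vecMul hf g).aestronglyMeasurable B
    (Eventually.of_forall fun _ => hB _)

/-- Since y (M_i g) = (y M_i) g, left multiplication of g by M_i amounts to the action of the
transpose of M_i on y, and stationarity absorbs the average over i. Homogeneity of f disposes of the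
normalisation to unit length. This is the source of all martingales below. -/
theorem IsDualStationary.step_dualMean (hν : IsDualStationary P M ν) (hP : ∀ i j, 0 ≤ P i j)
    {f : (Fin d → ℝ) → ℝ} (hf : Measurable f) {B : ℝ} (hB : ∀ z, |f z| ≤ B)
    (hsc : ∀ (c : ℝ) (z), c ≠ 0 → f (c • z) = f z) :
    step P (leftMul M) (dualMean ν f) = dualMean ν f := by
  funext j g
  unfold dualMean step
  conv_rhs => rw [hν j]
  have := fun i => Measure.isProbabilityMeasure_map (μ := (ν i : Measure (UnitVec d)))
      (continuous_dualAct (M i)).measurable.aemeasurable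
  rw [integral_finsetSum_measure fun i _ =>
      (integrable_comp_vecMul hf hB g _).smul_measure ENNReal.ofReal_ne_top]
  refine Finset.sum_congr rfl fun i _ => ?_
  rw [integral_smul_measure, integral_map (continuous_dualAct (M i)).measurable.aemeasurable
    (measurable_comp_vecMul hf g).aestronglyMeasurable, ENNReal.toReal_ofReal (hP i j),
    smul_eq_mul]
  congr 1
  refine integral_congr_ae (Eventually.of_forall fun y => ?_)
  obtain ⟨c, hc, h⟩ := exists_unitOf_eq (y.1 ᵥ* (M i : Matrix (Fin d) (Fin d) ℝ))
    (vecMul_GL_ne_zero (M i) y.ne_zero)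
  show f (y.1 ᵥ* leftMul M i g) = f ((dualAct (M i) y).1 ᵥ* g)
  rw [dualAct, h, Matrix.smul_vecMul, hsc c _ hc, Matrix.vecMul_vecMul]
  rfl

/-- The unit vectors that are orthogonal to a subspace. -/
def perpSet (W : Submodule ℝ (Fin d → ℝ)) : Set (UnitVec d) := {y | ∀ x ∈ W, y.1 ⬝ᵥ x = 0}

theorem isClosed_perpSet (W : Submodule ℝ (Fin d → ℝ)) : IsClosed (perpSet W) := by
  have : perpSet W = ⋂ x ∈ W, {y : UnitVec d | y.1 ⬝ᵥ x = 0} := by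
    ext y; simp [perpSet]
  rw [this]
  exact isClosed_biInter fun x _ =>
    isClosed_eq (continuous_subtype_val.dotProduct continuous_const) continuous_const

theorem perpSet_top : perpSet (⊤ : Submodule ℝ (Fin d → ℝ)) = ∅ := by
  ext y
  simp only [Set.mem_empty_iff_false, iff_false]
  intro h
  exact one_ne_zero (y.2.symm.trans (h y.1 trivial))

theorem perpSet_inter (W W' : Submodule ℝ (Fin d → ℝ)) :
    perpSet W ∩ perpSet W' ⊆ perpSet (W ⊔ W') := by
  rintro y ⟨h, h'⟩ x hx
  obtain ⟨a, ha, b, hb, rfl⟩ := Submodule.mem_sup.1 hx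
  rw [dotProduct_add, h a ha, h' b hb, add_zero]

/-- The image of a subspace under an invertible matrix. -/
def mapSubspace (g : GL (Fin d) ℝ) (W : Submodule ℝ (Fin d → ℝ)) : Submodule ℝ (Fin d → ℝ) :=
  W.map (Matrix.mulVecLin (g : Matrix (Fin d) (Fin d) ℝ))

theorem mulVecLin_injective (g : GL (Fin d) ℝ) :
    Function.Injective (Matrix.mulVecLin (g : Matrix (Fin d) (Fin d) ℝ)) := by
  rw [injective_iff_map_eq_zero]
  intro x hx
  by_contra h
  exact mulVec_GL_ne_zero g h hx

theorem finrank_mapSubspace (g : GL (Fin d) ℝ) (W : Submodule ℝ (Fin d → ℝ)) :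
    Module.finrank ℝ (mapSubspace g W) = Module.finrank ℝ W :=
  (Submodule.equivMapOfInjective _ (mulVecLin_injective g) W).finrank_eq.symm

theorem mapSubspace_injective (g : GL (Fin d) ℝ) :
    Function.Injective (mapSubspace g) :=
  Submodule.map_injective_of_injective (mulVecLin_injective g)

theorem preimage_perpSet (g : GL (Fin d) ℝ) (W : Submodule ℝ (Fin d → ℝ)) :
    dualAct g ⁻¹' perpSet W = perpSet (mapSubspace g W) := by
  ext y
  obtain ⟨c, hc, h⟩ := exists_unitOf_eq (y.1 ᵥ* (g : Matrix (Fin d) (Fin d) ℝ))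
    (vecMul_GL_ne_zero g y.ne_zero)
  have key : ∀ x, (dualAct g y).1 ⬝ᵥ x = 0 ↔
      y.1 ⬝ᵥ ((g : Matrix (Fin d) (Fin d) ℝ) *ᵥ x) = 0 := fun x => by
    rw [dualAct, h, smul_dotProduct, smul_eq_mul, Matrix.dotProduct_mulVec]
    simp [hc]
  simp [perpSet, mapSubspace, key]

theorem IsDualStationary.real_perpSet (hν : IsDualStationary P M ν) (hP : ∀ i j, 0 ≤ P i j)
    (j : Fin k) (W : Submodule ℝ (Fin d → ℝ)) :
    (ν j : Measure (UnitVec d)).real (perpSet W) =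
      ∑ i, P i j * (ν i : Measure (UnitVec d)).real (perpSet (mapSubspace (M i) W)) := by
  conv_lhs => rw [hν j]
  rw [Measure.real, Measure.finsetSum_apply, ENNReal.toReal_sum]
  · refine Finset.sum_congr rfl fun i _ => ?_
    rw [Measure.smul_apply, Measure.map_apply (continuous_dualAct _).measurable
      (isClosed_perpSet W).measurableSet, preimage_perpSet, smul_eq_mul, ENNReal.toReal_mul,
      ENNReal.toReal_ofReal (hP i j)]
    rfl
  · intro i _
    rw [Measure.smul_apply, Measure.map_apply (continuous_dualAct _).measurable
      (isClosed_perpSet W).measurableSet, smul_eq_mul]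
    exact ENNReal.mul_ne_top ENNReal.ofReal_ne_top (measure_ne_top _ _)

/-- A finite invariant family of proper nonzero subspaces contradicts strong irreducibility. -/
theorem StronglyIrreducible.false_of_finite (hirr : StronglyIrreducible M)
    {F : Set (Submodule ℝ (Fin d → ℝ))} (hfin : F.Finite) (hne : F.Nonempty)
    (hF : ∀ W ∈ F, W ≠ ⊥ ∧ W ≠ ⊤) (hinv : ∀ W ∈ F, ∀ i, mapSubspace (M i) W ∈ F) : False := by
  classical
  lift F to Finset (Submodule ℝ (Fin d → ℝ)) using hfin
  refine hirr ⟨F, hne, hF, fun A hA => ?_⟩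
  induction hA using Submonoid.closure_induction with
  | mem A hA =>
    obtain ⟨i, rfl⟩ := hA
    -- An injective map of a finite family into itself is onto, so invariance by inclusion is
    -- invariance by equality.
    have himg : F.image (mapSubspace (M i)) = F := by
      refine Finset.eq_of_subset_of_card_le (Finset.image_subset_iff.2 fun W hW => hinv W hW i) ?_
      rw [Finset.card_image_of_injective _ (mapSubspace_injective (M i))]
    conv_rhs => rw [← himg]
    rw [Set.image_iUnion₂, Finset.set_biUnion_finset_image]
    rfl
  | one => simp
  | mul A B _ _ hA hB =>
    conv_rhs => rw [← hA, ← hB]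
    rw [← Set.image_comp]
    refine Set.image_congr fun v _ => ?_
    simp

/-- Furstenberg's argument. Let l be the largest dimension of a W such that some ν_j charges the
unit vectors orthogonal to W. For distinct W, W' of dimension l the two orthogonal sets meet in a
null set, because W + W' has larger dimension. So only finitely many exceed a given mass, and a
maximal mass is attained. By stationarity this maximum is an average, with positive weights, of the
masses for the subspaces M_i W. All of these are therefore maximal too, and the maximisers form a
finite invariant family. -/
theorem IsDualStationary.real_perpSet_eq_zero (hν : IsDualStationary P M ν)
    (hP : ∀ i j, 0 < P i j) (hP1 : ∀ j, ∑ i, P i j = 1) (hirr : StronglyIrreducible M)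
    (j : Fin k) {W : Submodule ℝ (Fin d → ℝ)} (hW : W ≠ ⊥) :
    (ν j : Measure (UnitVec d)).real (perpSet W) = 0 := by
  classical
  set m : Fin k → Submodule ℝ (Fin d → ℝ) → ℝ :=
    fun j W => (ν j : Measure (UnitVec d)).real (perpSet W) with hm
  have hm0 : ∀ j W, 0 ≤ m j W := fun _ _ => measureReal_nonneg
  by_contra hne
  let pos : ℕ → Prop := fun l =>
    ∃ W : Submodule ℝ (Fin d → ℝ), Module.finrank ℝ W = l ∧ ∃ j, m j W ≠ 0
  set l := Nat.findGreatest pos d with hl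
  have hbd : ∀ W : Submodule ℝ (Fin d → ℝ), Module.finrank ℝ W ≤ d := fun W => by
    simpa using W.finrank_le
  have hle : Module.finrank ℝ W ≤ l := Nat.le_findGreatest (hbd W) ⟨W, rfl, j, hne⟩
  have hl1 : 1 ≤ l := (Nat.one_le_iff_ne_zero.2 fun h => hW (Submodule.finrank_eq_zero.1 h)).trans hle
  obtain ⟨W₀, hW₀, j₀, h₀⟩ : pos l := Nat.findGreatest_spec (hbd W) ⟨W, rfl, j, hne⟩
  have hnull : ∀ (W : Submodule ℝ (Fin d → ℝ)) j, l < Module.finrank ℝ W → m j W = 0 := by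
    intro W j hlt
    by_contra h
    exact absurd (Nat.le_findGreatest (hbd W) ⟨W, rfl, j, h⟩) (not_le.2 hlt)
  have hfin : ∀ j, {W : {W : Submodule ℝ (Fin d → ℝ) // Module.finrank ℝ W = l} |
      ENNReal.ofReal (m j₀ W₀) ≤ (ν j : Measure (UnitVec d)) (perpSet W.1)}.Finite := by
    intro j
    refine Measure.finite_const_le_meas_of_disjoint_iUnion₀ _
      (ENNReal.ofReal_pos.2 (lt_of_le_of_ne (hm0 _ _) h₀.symm))
      (fun W => (isClosed_perpSet W.1).measurableSet.nullMeasurableSet) ?_ (measure_ne_top _ _)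
    intro W₁ W₂ h12
    have hlt : W₁.1 < W₁.1 ⊔ W₂.1 := by
      refine lt_of_le_of_ne le_sup_left fun h => h12 ?_
      have h21 : W₂.1 ≤ W₁.1 := by rw [h]; exact le_sup_right
      exact Subtype.ext (Submodule.eq_of_le_of_finrank_eq h21 (W₂.2.trans W₁.2.symm)).symm
    have h0 := hnull (W₁.1 ⊔ W₂.1) j (W₁.2.symm.trans_lt (Submodule.finrank_lt_finrank_of_lt hlt))
    exact measure_mono_null (perpSet_inter _ _) ((measureReal_eq_zero_iff).1 h0)
  let B : Set (Fin k × Submodule ℝ (Fin d → ℝ)) :=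
    {p | Module.finrank ℝ p.2 = l ∧ m j₀ W₀ ≤ m p.1 p.2}
  have hB : B.Finite := by
    refine ((Set.finite_iUnion fun j => (hfin j).image fun W => (j, W.1))).subset ?_
    rintro ⟨j, W⟩ ⟨h1, h2⟩
    refine Set.mem_iUnion.2 ⟨j, ⟨W, h1⟩, ?_, rfl⟩
    exact (ENNReal.ofReal_le_ofReal h2).trans_eq (ofReal_measureReal (measure_ne_top _ _))
  obtain ⟨⟨j₁, W₁⟩, ⟨h1, h2⟩, hmax⟩ := hB.exists_maximalFor (fun p => m p.1 p.2) B
    ⟨(j₀, W₀), hW₀, le_rfl⟩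
  have hmax' : ∀ (W : Submodule ℝ (Fin d → ℝ)) j, Module.finrank ℝ W = l → m j W ≤ m j₁ W₁ := by
    intro W j hWl
    rcases le_total (m j₀ W₀) (m j W) with h | h
    · by_contra hcon
      exact hcon (hmax (j := (j, W)) ⟨hWl, h⟩ (le_of_not_ge hcon))
    · exact h.trans h2
  have hpos : 0 < m j₁ W₁ := (lt_of_le_of_ne (hm0 _ _) h₀.symm).trans_le h2
  refine hirr.false_of_finite (F := {W | Module.finrank ℝ W = l ∧ ∃ j, m j W = m j₁ W₁})
    ((hB.image Prod.snd).subset ?_) ⟨W₁, h1, j₁, rfl⟩ ?_ ?_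
  · rintro W ⟨hWl, j, hj⟩
    exact ⟨(j, W), ⟨hWl, h2.trans_eq hj.symm⟩, rfl⟩
  · rintro W ⟨hWl, j, hj⟩
    refine ⟨?_, ?_⟩
    · rintro rfl
      rw [finrank_bot] at hWl
      omega
    · rintro rfl
      rw [← hj, hm] at hpos
      simp [perpSet_top] at hpos
  · rintro W ⟨hWl, j, hj⟩ i
    refine ⟨(finrank_mapSubspace _ _).trans hWl, i, ?_⟩
    by_contra hne
    have hlt := lt_of_le_of_ne
      (hmax' (mapSubspace (M i) W) i ((finrank_mapSubspace _ _).trans hWl)) hne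
    have : m j W < ∑ i, P i j * m j₁ W₁ := by
      rw [hm]
      simp only
      rw [hν.real_perpSet (fun i j => (hP i j).le)]
      refine Finset.sum_lt_sum (fun i _ => mul_le_mul_of_nonneg_left
        (hmax' _ i ((finrank_mapSubspace _ _).trans hWl)) (hP i j).le) ⟨i, Finset.mem_univ i, ?_⟩
      exact mul_lt_mul_of_pos_left hlt (hP i j)
    rw [← Finset.sum_mul, hP1, one_mul, hj] at this
    exact lt_irrefl _ this

/-- A stationary family gives no mass to hyperplanes. -/
theorem IsDualStationary.measure_hyperplane (hν : IsDualStationary P M ν)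
    (hP : ∀ i j, 0 < P i j) (hP1 : ∀ j, ∑ i, P i j = 1) (hirr : StronglyIrreducible M)
    (j : Fin k) {x : Fin d → ℝ} (hx : x ≠ 0) :
    (ν j : Measure (UnitVec d)) {y | y.1 ⬝ᵥ x = 0} = 0 := by
  have h := hν.real_perpSet_eq_zero hP hP1 hirr j (W := ℝ ∙ x)
    (by rwa [Ne, Submodule.span_singleton_eq_bot])
  refine measure_mono_null ?_ ((measureReal_eq_zero_iff).1 h)
  intro y hy z hz
  obtain ⟨c, rfl⟩ := Submodule.mem_span_singleton.1 hz
  rw [dotProduct_smul, show y.1 ⬝ᵥ x = 0 from hy, smul_zero]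

end Dual

/-! ### Concentration near hyperplanes -/

section Concentration

variable {k d : ℕ}

/-- A form of Dini's theorem for integrals that depend on a parameter in a compact space. -/
theorem exists_forall_integral_lt {X Y : Type*} [TopologicalSpace X] [CompactSpace X]
    [FirstCountableTopology X] [TopologicalSpace Y] [MeasurableSpace Y] [OpensMeasurableSpace Y]
    (m : Measure Y) [IsProbabilityMeasure m] {F : ℕ → X → Y → ℝ}
    (hFc : ∀ n, Continuous fun p : X × Y => F n p.1 p.2) (hF0 : ∀ n u y, 0 ≤ F n u y)
    (hF1 : ∀ n u y, F n u y ≤ 1) (hFa : ∀ n n' u y, n ≤ n' → F n' u y ≤ F n u y)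
    (hF : ∀ u, ∀ᵐ y ∂m, Tendsto (fun n => F n u y) atTop (𝓝 0)) {η : ℝ} (hη : 0 < η) :
    ∃ n, ∀ u, Integrable (F n u) m ∧ ∫ y, F n u y ∂m < η := by
  have hFn : ∀ n u y, ‖F n u y‖ ≤ 1 := fun n u y => by
    rw [Real.norm_of_nonneg (hF0 n u y)]; exact hF1 n u y
  have hFm : ∀ n u, AEStronglyMeasurable (F n u) m := fun n u =>
    ((hFc n).comp (Continuous.prodMk_right u)).measurable.aestronglyMeasurable
  have hFi : ∀ n u, Integrable (F n u) m := fun n u =>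
    Integrable.of_bound (hFm n u) 1 (Eventually.of_forall (hFn n u))
  have hψc : ∀ n, Continuous fun u => ∫ y, F n u y ∂m := fun n =>
    continuous_of_dominated (bound := fun _ => 1) (hFm n)
      (fun u => Eventually.of_forall (hFn n u)) (integrable_const 1)
      (Eventually.of_forall fun y => (hFc n).comp (Continuous.prodMk_left y))
  have hψ0 : ∀ u, Tendsto (fun n => ∫ y, F n u y ∂m) atTop (𝓝 0) := fun u => by
    have h := tendsto_integral_of_dominated_convergence (F := fun n => F n u) (f := fun _ => (0 : ℝ))
      (fun _ => 1) (fun n => hFm n u) (integrable_const (1 : ℝ))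
      (fun n => Eventually.of_forall (hFn n u)) (hF u)
    simpa using h
  obtain ⟨n, hn⟩ := isCompact_univ.elim_directed_cover (fun n => {u : X | ∫ y, F n u y ∂m < η})
    (fun n => isOpen_lt (hψc n) continuous_const) (fun u _ => by
      obtain ⟨n, hn⟩ := ((hψ0 u).eventually (gt_mem_nhds hη)).exists
      exact Set.mem_iUnion.2 ⟨n, hn⟩)
    (directed_of_isDirected_le fun a b hab u hu =>
      (integral_mono (hFi b u) (hFi a u) fun y => hFa a b u y hab).trans_lt hu)
  exact ⟨n, fun u => ⟨hFi n u, hn (Set.mem_univ u)⟩⟩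

theorem measurableSet_sq_dot_le (x : Fin d → ℝ) (c : ℝ) :
    MeasurableSet {y : UnitVec d | (y.1 ⬝ᵥ x) ^ 2 ≤ c} :=
  (isClosed_le ((continuous_subtype_val.dotProduct continuous_const).pow 2)
    continuous_const).measurableSet

/-- The tents max(0, 1 - (n + 1) t²) with t = y · u are continuous, decrease with n to zero off the
hyperplane u^⊥, and are at least 1/2 on the slab in question. Dini's theorem makes their integrals
small uniformly in u. -/
theorem exists_concentration_le_aux (m : Measure (UnitVec d)) [IsProbabilityMeasure m]
    (hm : ∀ x : Fin d → ℝ, x ≠ 0 → m {y | y.1 ⬝ᵥ x = 0} = 0) {η : ℝ} (hη : 0 < η) :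
    ∃ n : ℕ, ∀ u : UnitVec d, m.real {y | (y.1 ⬝ᵥ u.1) ^ 2 ≤ 1 / (2 * (n + 1))} ≤ η := by
  have hdot : Continuous fun p : UnitVec d × UnitVec d => p.2.1 ⬝ᵥ p.1.1 :=
    (continuous_subtype_val.comp continuous_snd).dotProduct
      (continuous_subtype_val.comp continuous_fst)
  obtain ⟨n, hn⟩ := exists_forall_integral_lt m
    (F := fun (n : ℕ) (u y : UnitVec d) => max 0 (1 - (n + 1) * (y.1 ⬝ᵥ u.1) ^ 2))
    (fun n => continuous_const.max (continuous_const.sub (continuous_const.mul (hdot.pow 2))))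
    (fun _ _ _ => le_max_left _ _)
    (fun n u y => max_le zero_le_one (sub_le_self _ (by positivity)))
    (fun n n' u y hnn => by
      refine max_le_max le_rfl (sub_le_sub_left (mul_le_mul_of_nonneg_right ?_ (sq_nonneg _)) _)
      exact_mod_cast Nat.succ_le_succ hnn)
    (fun u => by
      have hae : ∀ᵐ y ∂m, ¬ y.1 ⬝ᵥ u.1 = 0 := by
        rw [ae_iff]
        simpa using hm u.1 u.ne_zero
      filter_upwards [hae] with y hy
      have hpos : 0 < (y.1 ⬝ᵥ u.1) ^ 2 := by positivity
      obtain ⟨N, hN⟩ := exists_nat_gt (1 / (y.1 ⬝ᵥ u.1) ^ 2)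
      refine tendsto_const_nhds.congr' ?_
      filter_upwards [eventually_ge_atTop N] with n hn
      refine (max_eq_left ?_).symm
      rw [div_lt_iff₀ hpos] at hN
      have : (N : ℝ) ≤ n := by exact_mod_cast hn
      nlinarith) (half_pos hη)
  refine ⟨n, fun u => ?_⟩
  obtain ⟨hi, hu⟩ := hn u
  have hms := measurableSet_sq_dot_le u.1 (1 / (2 * ((n : ℝ) + 1)))
  have : 1 / 2 * m.real {y : UnitVec d | (y.1 ⬝ᵥ u.1) ^ 2 ≤ 1 / (2 * ((n : ℝ) + 1))} ≤
      ∫ y, max 0 (1 - ((n : ℝ) + 1) * (y.1 ⬝ᵥ u.1) ^ 2) ∂m := by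
    rw [← integral_indicator_one hms, ← integral_const_mul]
    refine integral_mono (((integrable_const (1 : ℝ)).indicator hms).const_mul _) hi fun y => ?_
    by_cases hy : (y.1 ⬝ᵥ u.1) ^ 2 ≤ 1 / (2 * ((n : ℝ) + 1))
    · simp only [Set.indicator, Set.mem_ofPred_eq, hy, if_true, Pi.one_apply, mul_one]
      refine le_max_of_le_right ?_
      rw [le_div_iff₀ (by positivity)] at hy
      linarith
    · simp only [Set.indicator, Set.mem_ofPred_eq, hy, if_false, mul_zero]
      exact le_max_left _ _
  linarith

theorem exists_concentration_le {ν : Fin k → ProbabilityMeasure (UnitVec d)}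
    (hm : ∀ j, ∀ x : Fin d → ℝ, x ≠ 0 → (ν j : Measure (UnitVec d)) {y | y.1 ⬝ᵥ x = 0} = 0)
    {η : ℝ} (hη : 0 < η) :
    ∃ δ : ℝ, 0 < δ ∧ ∀ δ' ≤ δ, ∀ j (u : UnitVec d),
      (ν j : Measure (UnitVec d)).real {y | (y.1 ⬝ᵥ u.1) ^ 2 ≤ δ'} ≤ η := by
  choose n hn using fun j => exists_concentration_le_aux (ν j : Measure (UnitVec d)) (hm j) hη
  refine ⟨1 / (2 * ((Finset.univ.sup n : ℕ) + 1)), by positivity, fun δ' hδ j u => ?_⟩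
  refine (measureReal_mono fun y hy => ?_).trans (hn j u)
  refine (le_trans hy hδ).trans ?_
  have : (n j : ℝ) ≤ (Finset.univ.sup n : ℕ) := by
    exact_mod_cast Finset.le_sup (f := n) (Finset.mem_univ j)
  exact one_div_le_one_div_of_le (by positivity) (by linarith)

end Concentration

/-! ### A maximal inequality -/

section Maximal

open Classical in
/-- The probability that the chain started at `(j, x)` visits `B` at one of the times `0, …, n`. -/
def hit {k : ℕ} {X : Type*} (P : Fin k → Fin k → ℝ) (s : Fin k → X → X) (B : Set X) :
    ℕ → Fin k → X → ℝ
  | 0 => fun _ x => if x ∈ B then 1 else 0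
  | n + 1 => fun j x => if x ∈ B then 1 else ∑ i, P i j * hit P s B n i (s i x)

variable {k : ℕ} {X Y : Type*} {P : Fin k → Fin k → ℝ}

theorem hit_of_mem {s : Fin k → X → X} {B : Set X} (n : ℕ) (j : Fin k) {x : X} (hx : x ∈ B) :
    hit P s B n j x = 1 := by
  cases n <;> simp [hit, hx]

theorem hit_succ_of_notMem {s : Fin k → X → X} {B : Set X} (n : ℕ) (j : Fin k) {x : X}
    (hx : x ∉ B) : hit P s B (n + 1) j x = ∑ i, P i j * hit P s B n i (s i x) := by
  simp [hit, hx]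

theorem hit_nonneg (hP : ∀ i j, 0 ≤ P i j) (s : Fin k → X → X) (B : Set X) (n : ℕ) (j : Fin k)
    (x : X) : 0 ≤ hit P s B n j x := by
  induction n generalizing j x with
  | zero => unfold hit; split_ifs <;> norm_num
  | succ n ih =>
    unfold hit
    split_ifs
    · norm_num
    · exact Finset.sum_nonneg fun i _ => mul_nonneg (hP i j) (ih i _)

/-- Doob's maximal inequality for a nonnegative harmonic function. -/
theorem hit_le_of_harmonic (hP : ∀ i j, 0 ≤ P i j) {s : Fin k → X → X} {t : Fin k → Y → Y}
    {π : Y → X} (hπ : ∀ i y, π (t i y) = s i (π y)) {φ : Fin k → Y → ℝ} (hφ : ∀ j y, 0 ≤ φ j y)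
    (hharm : ∀ j y, step P t φ j y = φ j y) {B : Set X}
    (hB : ∀ j y, π y ∈ B → 1 / 2 ≤ φ j y) (n : ℕ) (j : Fin k) (y : Y) :
    hit P s B n j (π y) ≤ 2 * φ j y := by
  induction n generalizing j y with
  | zero =>
    unfold hit
    split_ifs with h
    · linarith [hB j y h]
    · linarith [hφ j y]
  | succ n ih =>
    unfold hit
    split_ifs with h
    · linarith [hB j y h]
    · rw [← hharm, step, Finset.mul_sum]
      refine Finset.sum_le_sum fun i _ => ?_
      rw [← hπ, mul_left_comm]
      exact mul_le_mul_of_nonneg_left (ih i _) (hP i j)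

end Maximal

/-! ### Distances rarely grow by a large factor. -/

section Escape

variable {k d : ℕ}

/-- The square of the Frobenius norm. -/
def frobSq (g : Matrix (Fin d) (Fin d) ℝ) : ℝ := ∑ i, g i ⬝ᵥ g i

theorem frobSq_nonneg (g : Matrix (Fin d) (Fin d) ℝ) : 0 ≤ frobSq g :=
  Finset.sum_nonneg fun _ _ => dot_self_nonneg _

theorem frobSq_transpose (g : Matrix (Fin d) (Fin d) ℝ) : ∑ i, gᵀ i ⬝ᵥ gᵀ i = frobSq g := by
  simp only [frobSq, dotProduct, Matrix.transpose_apply]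
  exact Finset.sum_comm

theorem frobSq_eq_zero {g : Matrix (Fin d) (Fin d) ℝ} : frobSq g = 0 ↔ g = 0 := by
  constructor
  · intro h
    funext i
    exact dotProduct_self_eq_zero.1
      ((Finset.sum_eq_zero_iff_of_nonneg fun i _ => dot_self_nonneg (g i)).1 h i
        (Finset.mem_univ i))
  · rintro rfl
    exact Finset.sum_eq_zero fun i _ => dotProduct_self_eq_zero.2 rfl

theorem frobSq_pos {g : Matrix (Fin d) (Fin d) ℝ} (hg : g ≠ 0) : 0 < frobSq g :=
  lt_of_le_of_ne (frobSq_nonneg g) fun h => hg (frobSq_eq_zero.1 h.symm)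

theorem GL_val_ne_zero (hd : 0 < d) (g : GL (Fin d) ℝ) : (g : Matrix (Fin d) (Fin d) ℝ) ≠ 0 := by
  intro h
  obtain ⟨v⟩ := exists_unitVec hd
  apply mulVec_GL_ne_zero g v.ne_zero
  rw [h, Matrix.zero_mulVec]

theorem exists_column_ge (hd : 0 < d) (g : Matrix (Fin d) (Fin d) ℝ) :
    ∃ i, frobSq g ≤ d * (gᵀ i ⬝ᵥ gᵀ i) := by
  by_contra! h
  have : Nonempty (Fin d) := ⟨⟨0, hd⟩⟩
  have h1 : ∑ i : Fin d, d * (gᵀ i ⬝ᵥ gᵀ i) < ∑ _i : Fin d, frobSq g :=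
    Finset.sum_lt_sum_of_nonempty Finset.univ_nonempty fun i _ => h i
  rw [← Finset.mul_sum, frobSq_transpose] at h1
  simp at h1

open Classical in
/-- The indicator of the vectors that are nearly orthogonal to `v`. -/
def nearPerp (v : Fin d → ℝ) (ε : ℝ) (z : Fin d → ℝ) : ℝ :=
  if (v ⬝ᵥ z) ^ 2 ≤ ε * (z ⬝ᵥ z) then 1 else 0

theorem measurable_nearPerp (v : Fin d → ℝ) (ε : ℝ) : Measurable (nearPerp v ε) := by
  refine Measurable.ite (IsClosed.measurableSet ?_) measurable_const measurable_const
  exact isClosed_le ((continuous_const.dotProduct continuous_id).pow 2)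
    (continuous_const.mul (continuous_id.dotProduct continuous_id))

theorem nearPerp_nonneg (v : Fin d → ℝ) (ε : ℝ) (z : Fin d → ℝ) : 0 ≤ nearPerp v ε z := by
  unfold nearPerp
  split_ifs <;> norm_num

theorem abs_nearPerp_le (v : Fin d → ℝ) (ε : ℝ) (z : Fin d → ℝ) : |nearPerp v ε z| ≤ 1 := by
  unfold nearPerp
  split_ifs <;> norm_num

theorem nearPerp_smul (v : Fin d → ℝ) (ε c : ℝ) (z : Fin d → ℝ) (hc : c ≠ 0) :
    nearPerp v ε (c • z) = nearPerp v ε z := by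
  have : (v ⬝ᵥ c • z) ^ 2 ≤ ε * (c • z ⬝ᵥ c • z) ↔ (v ⬝ᵥ z) ^ 2 ≤ ε * (z ⬝ᵥ z) := by
    simp only [dotProduct_smul, smul_dotProduct, smul_eq_mul]
    rw [show ε * (c * (c * (z ⬝ᵥ z))) = c ^ 2 * (ε * (z ⬝ᵥ z)) by ring, mul_pow]
    exact mul_le_mul_iff_right₀ (by positivity)
  simp only [nearPerp, this]

variable {P : Fin k → Fin k → ℝ} {M : Fin k → GL (Fin d) ℝ}
  {ν : Fin k → ProbabilityMeasure (UnitVec d)}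

theorem dualMean_nearPerp_nonneg (v : Fin d → ℝ) (ε : ℝ) (j : Fin k)
    (g : Matrix (Fin d) (Fin d) ℝ) : 0 ≤ dualMean ν (nearPerp v ε) j g :=
  integral_nonneg fun _ => nearPerp_nonneg _ _ _

theorem dualMean_nearPerp_one (v : Fin d → ℝ) (ε : ℝ) (j : Fin k) :
    dualMean ν (nearPerp v ε) j 1 =
      (ν j : Measure (UnitVec d)).real {y | (y.1 ⬝ᵥ v) ^ 2 ≤ ε} := by
  have hms := measurableSet_sq_dot_le v ε
  rw [← integral_indicator_one hms]
  refine integral_congr_ae (Eventually.of_forall fun y => ?_)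
  simp only [nearPerp, Matrix.vecMul_one, y.2, mul_one, Set.indicator, Set.mem_ofPred_eq,
    dotProduct_comm v, Pi.one_apply]

/-- If `g` contracts `v` too much, then its transpose maps most unit vectors near `v^⊥`. -/
theorem half_le_dualMean_nearPerp (hd : 0 < d) {ε : ℝ} (hε : 0 < ε)
    (h2 : ∀ j (u : UnitVec d),
      (ν j : Measure (UnitVec d)).real {y | (y.1 ⬝ᵥ u.1) ^ 2 ≤ d * ε} ≤ 1 / 2)
    {g : Matrix (Fin d) (Fin d) ℝ} (hg : g ≠ 0) {v : Fin d → ℝ}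
    (hv : (g *ᵥ v) ⬝ᵥ (g *ᵥ v) ≤ ε ^ 2 * frobSq g) (j : Fin k) :
    1 / 2 ≤ dualMean ν (nearPerp v ε) j g := by
  obtain ⟨i, hi⟩ := exists_column_ge hd g
  have hf := frobSq_pos hg
  have hd' : (0 : ℝ) < d := by exact_mod_cast hd
  -- The column `a` carries at least 1/d of the squared norm of g, and |y g| ≥ |y · a|. So y outside
  -- the slab around the direction of `a` has |y g|² ≥ ε ‖g‖². On the other hand (v · y g)² = (y · g
  -- v)² ≤ |g v|² ≤ ε² ‖g‖², whence y g is nearly orthogonal to v.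
  set a := gᵀ i with ha
  have haa : 0 < a ⬝ᵥ a := by
    by_contra h
    nlinarith [dot_self_nonneg a]
  have ha0 : a ≠ 0 := fun h => by rw [h] at haa; simp at haa
  set u := unitOf a ha0 with hu
  have hms := measurableSet_sq_dot_le u.1 (d * ε)
  have hi1 : Integrable ({y : UnitVec d | (y.1 ⬝ᵥ u.1) ^ 2 ≤ d * ε}.indicator (1 : UnitVec d → ℝ))
      (ν j : Measure (UnitVec d)) := (integrable_const (1 : ℝ)).indicator hms
  have h3 : ∫ y, (1 - {y : UnitVec d | (y.1 ⬝ᵥ u.1) ^ 2 ≤ d * ε}.indicator 1 y)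
      ∂(ν j : Measure (UnitVec d)) ≤ dualMean ν (nearPerp v ε) j g := by
    refine integral_mono ((integrable_const (1 : ℝ)).sub hi1)
      (integrable_comp_vecMul (measurable_nearPerp v ε) (abs_nearPerp_le v ε) g _) fun y => ?_
    by_cases hy : (y.1 ⬝ᵥ u.1) ^ 2 ≤ d * ε
    · simp only [Set.indicator, Set.mem_ofPred_eq, hy, if_true, Pi.one_apply, sub_self]
      exact nearPerp_nonneg _ _ _
    · simp only [Set.indicator, Set.mem_ofPred_eq, hy, if_false, sub_zero]
      push Not at hy
      have e1 : (y.1 ⬝ᵥ a) ^ 2 = (a ⬝ᵥ a) * (y.1 ⬝ᵥ u.1) ^ 2 := by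
        rw [hu, unitOf, dotProduct_smul, smul_eq_mul, mul_pow, inv_pow, Real.sq_sqrt haa.le]
        field_simp
      have e2 : (y.1 ⬝ᵥ a) ^ 2 ≤ (y.1 ᵥ* g) ⬝ᵥ (y.1 ᵥ* g) := by
        have : y.1 ⬝ᵥ a = (y.1 ᵥ* g) i := rfl
        rw [this, sq]
        exact Finset.single_le_sum (f := fun i => (y.1 ᵥ* g) i * (y.1 ᵥ* g) i)
          (fun i _ => mul_self_nonneg _) (Finset.mem_univ i)
      have e3 : ε * frobSq g ≤ (y.1 ᵥ* g) ⬝ᵥ (y.1 ᵥ* g) := by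
        have := mul_le_mul_of_nonneg_left hy.le haa.le
        nlinarith
      have e4 : (v ⬝ᵥ (y.1 ᵥ* g)) ^ 2 ≤ (g *ᵥ v) ⬝ᵥ (g *ᵥ v) := by
        rw [dotProduct_comm, ← Matrix.dotProduct_mulVec]
        simpa [y.2] using dot_sq_le y.1 (g *ᵥ v)
      have : (v ⬝ᵥ (y.1 ᵥ* g)) ^ 2 ≤ ε * ((y.1 ᵥ* g) ⬝ᵥ (y.1 ᵥ* g)) := by nlinarith
      rw [nearPerp, if_pos this]
  rw [integral_sub (integrable_const (1 : ℝ)) hi1, integral_indicator_one hms] at h3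
  simp only [integral_const, probReal_univ, smul_eq_mul, mul_one] at h3
  linarith [h2 j u]

/-- The diagonal action of the matrices `M i` on pairs of points. -/
def pairAct (M : Fin k → GL (Fin d) ℝ) (i : Fin k) (p : Proj d × Proj d) : Proj d × Proj d :=
  (M i • p.1, M i • p.2)

/-- The distance d(x, y) is the length of v - t w for the best t, and g stretches that vector by at
most ‖g‖. Consequently a large growth of the distance forces |g v| to be small compared with ‖g‖. -/
theorem projDist_smul_sq_le (g : GL (Fin d) ℝ) (v : UnitVec d) (y : Proj d) :
    projDist (g • Projectivization.mk ℝ v.1 v.ne_zero) (g • y) ^ 2 *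
        (((g : Matrix (Fin d) (Fin d) ℝ) *ᵥ v.1) ⬝ᵥ ((g : Matrix (Fin d) (Fin d) ℝ) *ᵥ v.1)) ≤
      frobSq (g : Matrix (Fin d) (Fin d) ℝ) *
        projDist (Projectivization.mk ℝ v.1 v.ne_zero) y ^ 2 := by
  refine Projectivization.ind (fun w hw => ?_) y
  have hw2 := dot_self_pos hw
  rw [Projectivization.smul_mk, Projectivization.smul_mk]
  set t := (v.1 ⬝ᵥ w) / (w ⬝ᵥ w) with ht
  have h1 := projDist_sq_le (g • v.1) (g • w) ((smul_ne_zero_iff_ne g).mpr v.ne_zero)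
    ((smul_ne_zero_iff_ne g).mpr hw) t
  have h2 : g • v.1 - t • g • w = (g : Matrix (Fin d) (Fin d) ℝ) *ᵥ (v.1 - t • w) := by
    rw [Matrix.mulVec_sub, Matrix.mulVec_smul]
    rfl
  rw [h2] at h1
  refine (h1.trans (mulVec_dot_le _ _)).trans_eq ?_
  have h3 := projDist_sq_mk v.1 w v.ne_zero hw
  rw [v.2, mul_one] at h3
  rw [h3]
  congr 1
  simp only [sub_dotProduct, dotProduct_sub, smul_dotProduct, dotProduct_smul, smul_eq_mul,
    dotProduct_comm w v.1, ht, v.2]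
  field_simp
  ring

theorem exists_unitVec_mk_eq (x : Proj d) :
    ∃ v : UnitVec d, Projectivization.mk ℝ v.1 v.ne_zero = x := by
  refine Projectivization.ind (fun w hw => ?_) x
  obtain ⟨c, hc, h⟩ := exists_unitOf_eq w hw
  exact ⟨unitOf w hw, (Projectivization.mk_eq_mk_iff' ℝ _ _ _ _).2 ⟨c, h.symm⟩⟩

theorem IsDualStationary.harmonic_nearPerp (hν : IsDualStationary P M ν)
    (hP : ∀ i j, 0 ≤ P i j) (v : Fin d → ℝ) (ε : ℝ) :
    step P (leftMul M) (dualMean ν (nearPerp v ε)) = dualMean ν (nearPerp v ε) :=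
  hν.step_dualMean hP (measurable_nearPerp v ε) (abs_nearPerp_le v ε)
    fun c z hc => nearPerp_smul v ε c z hc

/-- The distance of two points is rarely ever multiplied by a large factor. -/
theorem IsDualStationary.hit_le (hν : IsDualStationary P M ν) (hP : ∀ i j, 0 ≤ P i j)
    (hd : 0 < d) {ε η : ℝ} (hε : 0 < ε)
    (h1 : ∀ j (u : UnitVec d),
      (ν j : Measure (UnitVec d)).real {y | (y.1 ⬝ᵥ u.1) ^ 2 ≤ ε} ≤ η)
    (h2 : ∀ j (u : UnitVec d),
      (ν j : Measure (UnitVec d)).real {y | (y.1 ⬝ᵥ u.1) ^ 2 ≤ d * ε} ≤ 1 / 2)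
    (n : ℕ) (j : Fin k) (x y : Proj d) :
    hit P (pairAct M) {p | projDist x y / ε < projDist p.1 p.2} n j (x, y) ≤ 2 * η := by
  obtain ⟨v, rfl⟩ := exists_unitVec_mk_eq x
  set x := Projectivization.mk ℝ v.1 v.ne_zero
  -- The chain of pairs is lifted to the chain of products g started at the identity. A large growth
  -- of the distance makes the harmonic function at least 1/2, while its value at the identity is
  -- the mass of a thin slab.
  have key := hit_le_of_harmonic hP (s := pairAct M) (t := fun i (g : GL (Fin d) ℝ) => M i * g)
    (π := fun g : GL (Fin d) ℝ => (g • x, g • y))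
    (fun i g => by simp [pairAct, mul_smul])
    (φ := fun j g => dualMean ν (nearPerp v.1 ε) j g)
    (fun j g => dualMean_nearPerp_nonneg _ _ _ _)
    (fun j g => congrFun (congrFun (hν.harmonic_nearPerp hP v.1 ε) j)
      (g : Matrix (Fin d) (Fin d) ℝ))
    (B := {p | projDist x y / ε < projDist p.1 p.2}) (fun j g hg => by
      refine half_le_dualMean_nearPerp hd hε h2 (GL_val_ne_zero hd g) ?_ j
      have e1 := projDist_smul_sq_le g v y
      have e2 : projDist x y / ε < projDist (g • x) (g • y) := hg
      rw [div_lt_iff₀ hε] at e2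
      set D := projDist (g • x) (g • y)
      set E := projDist x y
      set G := (g : Matrix (Fin d) (Fin d) ℝ)
      have hE : 0 ≤ E := projDist_nonneg _ _
      have hD : 0 < D := by
        by_contra h
        nlinarith [projDist_nonneg (g • x) (g • y)]
      have e3 : E ^ 2 ≤ D ^ 2 * ε ^ 2 := by
        rw [← mul_pow]
        exact pow_le_pow_left₀ hE e2.le 2
      have e4 : D ^ 2 * ((G *ᵥ v.1) ⬝ᵥ (G *ᵥ v.1)) ≤ D ^ 2 * (ε ^ 2 * frobSq G) := by
        refine e1.trans ?_
        have := mul_le_mul_of_nonneg_left e3 (frobSq_nonneg G)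
        linarith
      exact le_of_mul_le_mul_left e4 (by positivity)) n j 1
  simp only [one_smul, Units.val_one] at key
  refine key.trans ?_
  rw [dualMean_nearPerp_one]
  linarith [h1 j v]

end Escape

/-! ### Moments of the distance of two points -/

section Moments

variable {k d : ℕ} {P : Fin k → Fin k → ℝ} {M : Fin k → GL (Fin d) ℝ}

/-- The function `d(x, y)^β` on pairs of points. -/
def distPow (k d : ℕ) (β : ℝ) : Fin k → Proj d × Proj d → ℝ := fun _ p => projDist p.1 p.2 ^ β

theorem exists_common_lipschitz (M : Fin k → GL (Fin d) ℝ) :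
    ∃ C : ℝ, 1 ≤ C ∧ ∀ i (x y : Proj d), projDist (M i • x) (M i • y) ≤ C * projDist x y := by
  choose K hK0 hK using fun i => exists_projDist_smul_le (M i)
  refine ⟨1 + ∑ i, K i, by linarith [Finset.sum_nonneg fun i (_ : i ∈ Finset.univ) => hK0 i],
    fun i x y => (hK i x y).trans (mul_le_mul_of_nonneg_right ?_ (projDist_nonneg _ _))⟩
  have := Finset.single_le_sum (f := K) (fun i _ => hK0 i) (Finset.mem_univ i)
  linarith

/-- If distances rarely ever grow by the factor `1 / ε`, then small moments of the distance stay
bounded. -/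
theorem step_iterate_distPow_le (hP : ∀ i j, 0 ≤ P i j) (hP1 : ∀ j, ∑ i, P i j = 1)
    {C ε β : ℝ} (hC : 1 ≤ C)
    (hlip : ∀ i (x y : Proj d), projDist (M i • x) (M i • y) ≤ C * projDist x y)
    (hε : 0 < ε) (hε1 : ε ≤ 1) (hβ : 0 < β) (hβ2 : (C / ε) ^ β ≤ 2)
    (hhit : ∀ n j (x y : Proj d),
      hit P (pairAct M) {p | projDist x y / ε < projDist p.1 p.2} n j (x, y) ≤ 1 / 8)
    (n : ℕ) (j : Fin k) (p : Proj d × Proj d) :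
    (step P (pairAct M))^[n] (distPow k d β) j p ≤ 4 * projDist p.1 p.2 ^ β := by
  induction n using Nat.strong_induction_on generalizing j p with
  | _ n IH =>
  have hC0 : 0 ≤ C := zero_le_one.trans hC
  -- Stop at the first time the distance exceeds r. Without such a time the final distance is at
  -- most r. At that time the distance is at most C r, since one step multiplies it by at most C,
  -- and the induction hypothesis bounds what follows.
  have claim : ∀ r : ℝ, 0 ≤ r → ∀ m < n, ∀ j p, projDist p.1 p.2 ≤ C * r →
      (step P (pairAct M))^[m] (distPow k d β) j p ≤
        r ^ β + 4 * (C * r) ^ β * hit P (pairAct M) {p | r < projDist p.1 p.2} m j p := by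
    intro r hr m
    have hrβ : 0 ≤ r ^ β := Real.rpow_nonneg hr _
    have hCrβ : 0 ≤ (C * r) ^ β := Real.rpow_nonneg (by positivity) _
    induction m with
    | zero =>
      intro hm j p hp
      by_cases h : r < projDist p.1 p.2
      · rw [hit_of_mem 0 j (x := p) h, mul_one]
        have := Real.rpow_le_rpow (projDist_nonneg _ _) hp hβ.le
        show projDist p.1 p.2 ^ β ≤ _
        linarith
      · have := Real.rpow_le_rpow (projDist_nonneg _ _) (not_lt.1 h) hβ.le
        have h2 := mul_nonneg (mul_nonneg zero_le_four hCrβ)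
          (hit_nonneg hP (pairAct M) {p | r < projDist p.1 p.2} 0 j p)
        show projDist p.1 p.2 ^ β ≤ _
        linarith
    | succ m ih =>
      intro hm j p hp
      by_cases h : r < projDist p.1 p.2
      · rw [hit_of_mem (m + 1) j (x := p) h, mul_one]
        have h1 := IH (m + 1) hm j p
        have h2 := Real.rpow_le_rpow (projDist_nonneg _ _) hp hβ.le
        linarith
      · have h' : p ∉ {p : Proj d × Proj d | r < projDist p.1 p.2} := h
        rw [hit_succ_of_notMem m j h', Function.iterate_succ_apply', step, Finset.mul_sum]
        have e : r ^ β = ∑ i, P i j * r ^ β := by rw [← Finset.sum_mul, hP1, one_mul]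
        conv_rhs => rw [e]
        rw [← Finset.sum_add_distrib]
        refine Finset.sum_le_sum fun i _ => ?_
        have h3 := ih (by omega) i (pairAct M i p) ((hlip i _ _).trans
          (mul_le_mul_of_nonneg_left (not_lt.1 h) hC0))
        have h4 := mul_le_mul_of_nonneg_left h3 (hP i j)
        linarith
  rcases n with _ | n
  · show projDist p.1 p.2 ^ β ≤ _
    linarith [Real.rpow_nonneg (projDist_nonneg p.1 p.2) β]
  · set D := projDist p.1 p.2 with hD
    have hD0 : 0 ≤ D := projDist_nonneg _ _
    have hr : 0 ≤ D / ε := by positivity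
    have hle : D ≤ D / ε := le_div_self hD0 hε hε1
    have h' : p ∉ {q : Proj d × Proj d | D / ε < projDist q.1 q.2} := not_lt.2 hle
    have h1 := hhit (n + 1) j p.1 p.2
    rw [Prod.mk.eta, ← hD, hit_succ_of_notMem n j h'] at h1
    -- The claim covers fewer steps than the induction is at, so the first step is taken by hand.
    -- The start lies outside the target set because D ≤ D / ε.
    have h2 : (step P (pairAct M))^[n + 1] (distPow k d β) j p ≤
        (D / ε) ^ β + 4 * (C * (D / ε)) ^ β * ∑ i, P i j *
          hit P (pairAct M) {q | D / ε < projDist q.1 q.2} n i (pairAct M i p) := by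
      rw [Function.iterate_succ_apply', step, Finset.mul_sum]
      have e : (D / ε) ^ β = ∑ i, P i j * (D / ε) ^ β := by rw [← Finset.sum_mul, hP1, one_mul]
      conv_rhs => rw [e]
      rw [← Finset.sum_add_distrib]
      refine Finset.sum_le_sum fun i _ => ?_
      have h3 := claim (D / ε) hr n (by omega) i (pairAct M i p) ((hlip i _ _).trans
          (mul_le_mul_of_nonneg_left hle hC0))
      have h4 := mul_le_mul_of_nonneg_left h3 (hP i j)
      linarith
    -- With the hitting probability at most 1/8 the total is at most 2 D^β + 4 · 2 D^β / 8 = 3 D^β.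
    have h3 : (C * (D / ε)) ^ β ≤ 2 * D ^ β := by
      rw [show C * (D / ε) = C / ε * D by ring, Real.mul_rpow (by positivity) hD0]
      exact mul_le_mul_of_nonneg_right hβ2 (Real.rpow_nonneg hD0 _)
    have h4 : (D / ε) ^ β ≤ (C * (D / ε)) ^ β :=
      Real.rpow_le_rpow hr (le_mul_of_one_le_left hr hC) hβ.le
    have h5 : 0 ≤ (C * (D / ε)) ^ β := Real.rpow_nonneg (by positivity) _
    have h6 := mul_le_mul_of_nonneg_left h1 (mul_nonneg zero_le_four h5)
    have h7 : 0 ≤ D ^ β := Real.rpow_nonneg hD0 _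
    linarith

open Classical in
/-- Contraction in probability and bounded moments give contraction of small moments. -/
theorem exists_step_iterate_distPow_le (hP : ∀ i j, 0 ≤ P i j) (hP1 : ∀ j, ∑ i, P i j = 1)
    {α : ℝ} (hα : 0 < α)
    (h1 : ∀ n j p, (step P (pairAct M))^[n] (distPow k d α) j p ≤ 4 * projDist p.1 p.2 ^ α)
    (h2 : ∀ n j p, (step P (pairAct M))^[n] (distPow k d (2 * α)) j p ≤
      4 * projDist p.1 p.2 ^ (2 * α))
    (hprob : ∀ η : ℝ, 0 < η → ∃ n, ∀ j (x y : Proj d), (step P (pairAct M))^[n]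
      (fun _ q => if η * projDist x y < projDist q.1 q.2 then 1 else 0) j (x, y) ≤ η) :
    ∃ n, ∀ j p, (step P (pairAct M))^[n] (distPow k d α) j p ≤ 3 / 4 * projDist p.1 p.2 ^ α := by
  obtain ⟨η, hη, hη1, hη2⟩ : ∃ η : ℝ, 0 < η ∧ η ≤ 1 / 16 ∧ η ^ α ≤ 1 / 4 := by
    refine ⟨min (1 / 16) ((1 / 4) ^ (1 / α)), lt_min (by norm_num) (by positivity),
      min_le_left _ _, ?_⟩
    calc (min (1 / 16) ((1 / 4) ^ (1 / α)) : ℝ) ^ α ≤ ((1 / 4 : ℝ) ^ (1 / α)) ^ α :=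
          Real.rpow_le_rpow (le_min (by norm_num) (by positivity)) (min_le_right _ _) hα.le
      _ = 1 / 4 := by
          rw [← Real.rpow_mul (by norm_num), one_div_mul_cancel hα.ne', Real.rpow_one]
  obtain ⟨n, hn⟩ := hprob η hη
  refine ⟨n, fun j p => ?_⟩
  obtain ⟨x, y⟩ := p
  rcases (projDist_nonneg x y).eq_or_lt with h0 | hpos
  · have := h1 n j (x, y)
    simp only [← h0, Real.zero_rpow hα.ne', mul_zero] at this ⊢
    exact this
  · set D := projDist x y
    set T := D ^ α with hT
    have hTpos : 0 < T := Real.rpow_pos_of_pos hpos _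
    let I : Fin k → Proj d × Proj d → ℝ :=
      fun _ q => if η * D < projDist q.1 q.2 then 1 else 0
    -- With t the α-th power of the new distance: either t ≤ η^α T, or the event `I` occurs and t ≤
    -- 4T + t²/(16T), by completing the square. The three terms then have expectations at most T/4
    -- each, by the two conditions on η and by the bound 4T² on the second moment.
    let R : Fin k → Proj d × Proj d → ℝ :=
      (fun _ _ => η ^ α * T) + (4 * T) • I + (16 * T)⁻¹ • distPow k d (2 * α)
    have hle : ∀ j q, distPow k d α j q ≤ R j q := by
      intro j q
      have ht : 0 ≤ projDist q.1 q.2 ^ α := Real.rpow_nonneg (projDist_nonneg _ _) _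
      have hsq : projDist q.1 q.2 ^ (2 * α) = (projDist q.1 q.2 ^ α) ^ 2 := by
        rw [mul_comm, Real.rpow_mul (projDist_nonneg _ _)]
        norm_num
      simp only [Pi.add_apply, Pi.smul_apply, smul_eq_mul, distPow, hsq, I, R]
      split_ifs with h
      · have h3 : (16 * T)⁻¹ * (projDist q.1 q.2 ^ α) ^ 2 + 4 * T - projDist q.1 q.2 ^ α =
            (projDist q.1 q.2 ^ α - 8 * T) ^ 2 / (16 * T) := by
          field_simp
          ring
        have h4 : 0 ≤ (projDist q.1 q.2 ^ α - 8 * T) ^ 2 / (16 * T) := by positivity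
        have h5 : 0 ≤ η ^ α * T := by positivity
        linarith
      · have h3 := Real.rpow_le_rpow (projDist_nonneg _ _) (not_lt.1 h) hα.le
        rw [Real.mul_rpow hη.le hpos.le] at h3
        have h4 : 0 ≤ (16 * T)⁻¹ * (projDist q.1 q.2 ^ α) ^ 2 := by positivity
        linarith
    have h3 := step_iterate_mono hP (pairAct M) hle n j (x, y)
    rw [show R = (fun _ _ => η ^ α * T) + (4 * T) • I + (16 * T)⁻¹ • distPow k d (2 * α) from rfl,
      step_iterate_add, step_iterate_add, step_iterate_smul, step_iterate_smul,
      step_iterate_const hP1] at h3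
    simp only [Pi.add_apply, Pi.smul_apply, smul_eq_mul] at h3
    have h4 := mul_le_mul_of_nonneg_left (hn j x y) (by positivity : 0 ≤ 4 * T)
    have h5 := mul_le_mul_of_nonneg_left (h2 n j (x, y)) (by positivity : 0 ≤ (16 * T)⁻¹)
    have hsq : D ^ (2 * α) = T ^ 2 := by
      rw [hT, mul_comm, Real.rpow_mul hpos.le]
      norm_num
    have h6 : (16 * T)⁻¹ * (4 * D ^ (2 * α)) = T / 4 := by
      rw [hsq]; field_simp; norm_num
    have h7 := mul_le_mul_of_nonneg_right hη2 hTpos.le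
    have h8 := mul_le_mul_of_nonneg_right hη1 hTpos.le
    show _ ≤ 3 / 4 * T
    simp only [I] at h3
    rw [h6] at h5
    linarith

end Moments

/-! ### Contraction in probability -/

section Veronese

variable {k d : ℕ}

/-- The entries of the orthogonal projection to the line through `z`. -/
def projEntry (a b : Fin d) (z : Fin d → ℝ) : ℝ := z a * z b / (z ⬝ᵥ z)

theorem measurable_projEntry (a b : Fin d) : Measurable (projEntry a b) :=
  ((measurable_pi_apply a).mul (measurable_pi_apply b)).div
    (continuous_id.dotProduct continuous_id).measurable

theorem abs_projEntry_le (a b : Fin d) (z : Fin d → ℝ) : |projEntry a b z| ≤ 1 := by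
  have h0 := dot_self_nonneg z
  have h : ∀ a, |z a| ≤ √(z ⬝ᵥ z) := fun a =>
    abs_apply_le_of_dot_self_le (Real.sqrt_nonneg _) (Real.sq_sqrt h0).ge a
  rw [projEntry, abs_div, abs_of_nonneg h0]
  refine div_le_one_of_le₀ ?_ h0
  rw [abs_mul]
  exact (mul_le_mul (h a) (h b) (abs_nonneg _) (Real.sqrt_nonneg _)).trans_eq (Real.mul_self_sqrt h0)

theorem projEntry_smul (a b : Fin d) (c : ℝ) (z : Fin d → ℝ) (hc : c ≠ 0) :
    projEntry a b (c • z) = projEntry a b z := by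
  simp only [projEntry, Pi.smul_apply, smul_eq_mul, dotProduct_smul, smul_dotProduct]
  rw [show c * z a * (c * z b) = c * c * (z a * z b) by ring, ← mul_assoc c c (z ⬝ᵥ z)]
  exact mul_div_mul_left _ _ (mul_ne_zero hc hc)

theorem continuousAt_projEntry (a b : Fin d) {z : Fin d → ℝ} (hz : z ≠ 0) :
    ContinuousAt (projEntry a b) z :=
  ContinuousAt.div ((continuous_apply a).mul (continuous_apply b)).continuousAt
    (continuous_id.dotProduct continuous_id).continuousAt (dot_self_pos hz).ne'

/-- The squared cosine with p, times |p|², is linear in the projection onto the line of z, so its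
mean is read off from the mean projection. -/
theorem dot_sq_eq_sum_projEntry (p z : Fin d → ℝ) :
    (z ⬝ᵥ p) ^ 2 / (z ⬝ᵥ z) = ∑ a, ∑ b, p a * p b * projEntry a b z := by
  simp only [projEntry, sq, dotProduct, Finset.sum_mul_sum, Finset.sum_div]
  exact Finset.sum_congr rfl fun a _ => Finset.sum_congr rfl fun b _ => by ring

variable {P : Fin k → Fin k → ℝ} {M : Fin k → GL (Fin d) ℝ}
  {ν : Fin k → ProbabilityMeasure (UnitVec d)}

/-- Stationary families without mass on hyperplanes. -/
structure IsProperStationary (P : Fin k → Fin k → ℝ) (M : Fin k → GL (Fin d) ℝ)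
    (ν : Fin k → ProbabilityMeasure (UnitVec d)) : Prop where
  stationary : IsDualStationary P M ν
  proper : ∀ j (x : Fin d → ℝ), x ≠ 0 → (ν j : Measure (UnitVec d)) {y | y.1 ⬝ᵥ x = 0} = 0

instance : FirstCountableTopology (Matrix (Fin d) (Fin d) ℝ) :=
  inferInstanceAs (FirstCountableTopology (Fin d → Fin d → ℝ))

theorem IsProperStationary.ae_vecMul_ne_zero (hν : IsProperStationary P M ν) (j : Fin k)
    {g : Matrix (Fin d) (Fin d) ℝ} (hg : g ≠ 0) :
    ∀ᵐ y ∂(ν j : Measure (UnitVec d)), y.1 ᵥ* g ≠ 0 := by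
  obtain ⟨i, hi⟩ : ∃ i, gᵀ i ≠ 0 := by
    by_contra! h
    exact hg (Matrix.transpose_injective (funext h))
  rw [ae_iff]
  refine measure_mono_null (fun y hy => ?_) (hν.proper j (gᵀ i) hi)
  have hy' : y.1 ᵥ* g = 0 := by simpa using hy
  exact congrFun hy' i

/-- The integrand is discontinuous only where y g = 0, a null set as soon as g ≠ 0. Continuity thus
holds at singular matrices as well, such as the rank-one limits given by the contraction hypothesis.
-/
theorem IsProperStationary.continuousAt_dualMean (hν : IsProperStationary P M ν) (j : Fin k)
    (a b : Fin d) {g : Matrix (Fin d) (Fin d) ℝ} (hg : g ≠ 0) :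
    ContinuousAt (dualMean ν (projEntry a b) j) g := by
  refine continuousAt_of_dominated (bound := fun _ => 1)
    (Eventually.of_forall fun g =>
      (measurable_comp_vecMul (measurable_projEntry a b) g).aestronglyMeasurable)
    (Eventually.of_forall fun g => Eventually.of_forall fun y => abs_projEntry_le a b _)
    (integrable_const _) ?_
  filter_upwards [hν.ae_vecMul_ne_zero j hg] with y hy
  exact ContinuousAt.comp (f := fun g => y.1 ᵥ* g) (continuousAt_projEntry a b hy)
    (continuous_const.matrix_vecMul continuous_id).continuousAt

theorem dualMean_smul {f : (Fin d → ℝ) → ℝ}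
    (hsc : ∀ (c : ℝ) (z), c ≠ 0 → f (c • z) = f z) {t : ℝ} (ht : t ≠ 0) (j : Fin k)
    (g : Matrix (Fin d) (Fin d) ℝ) : dualMean ν f j (t • g) = dualMean ν f j g :=
  integral_congr_ae (Eventually.of_forall fun y => by
    simp only [Matrix.vecMul_smul]
    exact hsc t _ ht)

/-- The sum of the squares of the entries of the mean of the projections. -/
def sqMean (ν : Fin k → ProbabilityMeasure (UnitVec d)) (j : Fin k)
    (g : Matrix (Fin d) (Fin d) ℝ) : ℝ :=
  ∑ a, ∑ b, dualMean ν (projEntry a b) j g ^ 2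

theorem abs_dualMean_le (a b : Fin d) (j : Fin k) (g : Matrix (Fin d) (Fin d) ℝ) :
    |dualMean ν (projEntry a b) j g| ≤ 1 := by
  simpa [dualMean] using norm_integral_le_of_norm_le_const (μ := (ν j : Measure (UnitVec d)))
    (f := fun y => projEntry a b (y.1 ᵥ* g)) (C := 1)
    (Eventually.of_forall fun y => abs_projEntry_le a b _)

theorem sqMean_le (j : Fin k) (g : Matrix (Fin d) (Fin d) ℝ) : sqMean ν j g ≤ d * d := by
  have : ∀ a b : Fin d, dualMean ν (projEntry a b) j g ^ 2 ≤ 1 := fun a b => by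
    rw [sq_le_one_iff_abs_le_one]
    exact abs_dualMean_le a b j g
  calc sqMean ν j g ≤ ∑ _a : Fin d, ∑ _b : Fin d, (1 : ℝ) :=
        Finset.sum_le_sum fun a _ => Finset.sum_le_sum fun b _ => this a b
    _ = d * d := by simp

/-- The variance of the mean projection after `m` steps. -/
def varMean (P : Fin k → Fin k → ℝ) (M : Fin k → GL (Fin d) ℝ)
    (ν : Fin k → ProbabilityMeasure (UnitVec d)) (m : ℕ) : Fin k → Matrix (Fin d) (Fin d) ℝ → ℝ :=
  (step P (leftMul M))^[m] (sqMean ν) - sqMean ν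

/-- For a martingale X the mean of X_m² - X_0² equals that of (X_m - X_0)²: the cross term is
evaluated by harmonicity. This is applied to each entry of the mean projection. -/
theorem IsDualStationary.varMean_eq (hν : IsDualStationary P M ν) (hP : ∀ i j, 0 ≤ P i j)
    (hP1 : ∀ j, ∑ i, P i j = 1) (m : ℕ) (j : Fin k) (g : Matrix (Fin d) (Fin d) ℝ) :
    varMean P M ν m j g = ∑ a, ∑ b, (step P (leftMul M))^[m] (fun i h =>
      (dualMean ν (projEntry a b) i h - dualMean ν (projEntry a b) j g) ^ 2) j g := by
  have h1 : sqMean ν = ∑ a, ∑ b, fun i h => dualMean ν (projEntry a b) i h ^ 2 := by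
    funext j g
    simp [sqMean]
  have h2 : ∀ a b, (step P (leftMul M))^[m] (fun i h =>
      (dualMean ν (projEntry a b) i h - dualMean ν (projEntry a b) j g) ^ 2) j g =
      (step P (leftMul M))^[m] (fun i h => dualMean ν (projEntry a b) i h ^ 2) j g -
        dualMean ν (projEntry a b) j g ^ 2 := by
    intro a b
    set c := dualMean ν (projEntry a b) j g with hc
    have e : (fun i h => (dualMean ν (projEntry a b) i h - c) ^ 2) =
        (fun i h => dualMean ν (projEntry a b) i h ^ 2) + ((-2 * c) • dualMean ν (projEntry a b) +
          fun _ _ => c ^ 2) := by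
      funext i h
      simp only [Pi.add_apply, Pi.smul_apply, smul_eq_mul]
      ring
    have hharm := hν.step_dualMean hP (measurable_projEntry a b) (abs_projEntry_le a b)
      (fun c z hc => projEntry_smul a b c z hc)
    rw [e, step_iterate_add, step_iterate_add, step_iterate_smul, step_iterate_const hP1,
      Function.iterate_fixed hharm]
    simp only [Pi.add_apply, Pi.smul_apply, smul_eq_mul, ← hc]
    ring
  simp only [h2, Finset.sum_sub_distrib]
  rw [varMean, Pi.sub_apply, Pi.sub_apply, h1]
  simp only [step_iterate_eq, map_sum, Finset.sum_apply]

theorem IsDualStationary.varMean_nonneg (hν : IsDualStationary P M ν) (hP : ∀ i j, 0 ≤ P i j)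
    (hP1 : ∀ j, ∑ i, P i j = 1) (m : ℕ) (j : Fin k) (g : Matrix (Fin d) (Fin d) ℝ) :
    0 ≤ varMean P M ν m j g := by
  rw [hν.varMean_eq hP hP1]
  exact Finset.sum_nonneg fun a _ => Finset.sum_nonneg fun b _ =>
    step_iterate_nonneg hP _ (fun _ _ => sq_nonneg _) _ _ _

theorem step_iterate_varMean (n m : ℕ) :
    (step P (leftMul M))^[n] (varMean P M ν m) =
      (step P (leftMul M))^[n + m] (sqMean ν) - (step P (leftMul M))^[n] (sqMean ν) := by
  rw [varMean, step_iterate_sub, Function.iterate_add_apply]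

theorem IsDualStationary.monotone_step_sqMean (hν : IsDualStationary P M ν)
    (hP : ∀ i j, 0 ≤ P i j) (hP1 : ∀ j, ∑ i, P i j = 1) (j : Fin k)
    (g : Matrix (Fin d) (Fin d) ℝ) :
    Monotone fun n => (step P (leftMul M))^[n] (sqMean ν) j g := by
  refine monotone_nat_of_le_succ fun n => ?_
  have h := step_iterate_nonneg hP (leftMul M) (fun j g => hν.varMean_nonneg hP hP1 1 j g) n j g
  rw [step_iterate_varMean] at h
  exact sub_nonneg.1 h

theorem IsDualStationary.varMean_mono (hν : IsDualStationary P M ν)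
    (hP : ∀ i j, 0 ≤ P i j) (hP1 : ∀ j, ∑ i, P i j = 1) (j : Fin k)
    (g : Matrix (Fin d) (Fin d) ℝ) {m m' : ℕ} (h : m ≤ m') :
    varMean P M ν m j g ≤ varMean P M ν m' j g :=
  sub_le_sub_right (hν.monotone_step_sqMean hP hP1 j g h) _

/-- The mean squares of a bounded martingale increase to a finite limit, and the expected variance
over the next m steps is the difference of two of them. -/
theorem IsDualStationary.tendsto_step_varMean (hν : IsDualStationary P M ν)
    (hP : ∀ i j, 0 ≤ P i j) (hP1 : ∀ j, ∑ i, P i j = 1) (m : ℕ) (j : Fin k)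
    (g : Matrix (Fin d) (Fin d) ℝ) :
    Tendsto (fun n => (step P (leftMul M))^[n] (varMean P M ν m) j g) atTop (𝓝 0) := by
  have hb : BddAbove (Set.range fun n => (step P (leftMul M))^[n] (sqMean ν) j g) := by
    refine ⟨d * d, ?_⟩
    rintro _ ⟨n, rfl⟩
    have := step_iterate_mono hP (leftMul M) (fun j g => sqMean_le (ν := ν) j g) n j g
    rwa [step_iterate_const hP1] at this
  have h := tendsto_atTop_ciSup (hν.monotone_step_sqMean hP hP1 j g) hb
  have h' := (h.comp (tendsto_add_atTop_nat m)).sub h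
  rw [sub_self] at h'
  refine h'.congr fun n => ?_
  rw [step_iterate_varMean]
  rfl

theorem leftMul_ne_zero (i : Fin k) {g : Matrix (Fin d) (Fin d) ℝ} (hg : g ≠ 0) :
    leftMul M i g ≠ 0 := fun h => hg <| by
  have := congrArg (fun z => (((M i)⁻¹ : GL (Fin d) ℝ) : Matrix (Fin d) (Fin d) ℝ) * z) h
  simpa [leftMul, ← mul_assoc, ← Units.val_mul] using this

theorem IsProperStationary.continuousAt_varMean (hν : IsProperStationary P M ν) (m : ℕ) (j : Fin k)
    {g : Matrix (Fin d) (Fin d) ℝ} (hg : g ≠ 0) : ContinuousAt (varMean P M ν m j) g := by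
  have h0 : ∀ j {g : Matrix (Fin d) (Fin d) ℝ}, g ≠ 0 → ContinuousAt (sqMean ν j) g :=
    fun j g hg => tendsto_finsetSum _ fun a _ => tendsto_finsetSum _ fun b _ =>
      (hν.continuousAt_dualMean j a b hg).pow 2
  refine ContinuousAt.sub ?_ (h0 j hg)
  induction m generalizing j g with
  | zero => exact h0 j hg
  | succ m ih =>
    rw [Function.iterate_succ_apply']
    refine tendsto_finsetSum _ fun i _ => ContinuousAt.mul continuousAt_const ?_
    exact ContinuousAt.comp (f := leftMul M i) (ih i (leftMul_ne_zero i hg))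
      (continuous_const.matrix_mul continuous_id).continuousAt

theorem varMean_smul (m : ℕ) {t : ℝ} (ht : t ≠ 0) (j : Fin k) (g : Matrix (Fin d) (Fin d) ℝ) :
    varMean P M ν m j (t • g) = varMean P M ν m j g := by
  have h0 : (fun j g => sqMean ν j (t • g)) = sqMean ν := by
    funext j g
    simp only [sqMean, dualMean_smul (fun c z hc => projEntry_smul _ _ c z hc) ht]
  have h := step_iterate_comp P (s := leftMul M) (t := leftMul M)
    (π := fun g : Matrix (Fin d) (Fin d) ℝ => t • g) (fun i x => by simp [leftMul])
    (sqMean ν) m j g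
  rw [h0] at h
  have h1 : sqMean ν j (t • g) = sqMean ν j g := congrFun (congrFun h0 j) g
  simp only [varMean, Pi.sub_apply, ← h, h1]

end Veronese

/-! ### Positive variance at matrices of rank at least two. -/

section Rigidity

variable {k d : ℕ} {P : Fin k → Fin k → ℝ} {M : Fin k → GL (Fin d) ℝ}
  {ν : Fin k → ProbabilityMeasure (UnitVec d)}

/-- If a nonnegative function has mean zero after every number of steps, then it vanishes along
the orbit of the semigroup. -/
theorem exists_eq_zero_of_step_iterate (hP : ∀ i j, 0 < P i j)
    {A : Matrix (Fin d) (Fin d) ℝ} (hA : A ∈ matSemigroup M) (j : Fin k) :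
    ∃ i n, ∀ (f : Fin k → Matrix (Fin d) (Fin d) ℝ → ℝ), (∀ j g, 0 ≤ f j g) → ∀ g,
      (step P (leftMul M))^[n] f j g = 0 → f i (A * g) = 0 := by
  induction hA using Submonoid.closure_induction generalizing j with
  | mem A hA =>
    obtain ⟨i, rfl⟩ := hA
    refine ⟨i, 1, fun f hf g h => ?_⟩
    have h1 := (Finset.sum_eq_zero_iff_of_nonneg (s := Finset.univ)
      (fun i _ => mul_nonneg (hP i j).le (hf i (leftMul M i g)))).1 h i (Finset.mem_univ i)
    exact (mul_eq_zero.1 h1).resolve_left (hP i j).ne'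
  | one => exact ⟨j, 0, fun f _ g h => by simpa using h⟩
  | mul A B _ _ hA hB =>
    obtain ⟨i, n, hi⟩ := hB j
    obtain ⟨i', n', hi'⟩ := hA i
    refine ⟨i', n + n', fun f hf g h => ?_⟩
    rw [Function.iterate_add_apply] at h
    have := hi _ (step_iterate_nonneg (fun i j => (hP i j).le) _ hf n') g h
    rw [mul_assoc]
    exact hi' f hf _ this

/-- The span of an orbit of a nonzero matrix under the semigroup is not contained in the kernel of
a nonzero matrix. -/
theorem StronglyIrreducible.exists_mul_mul_ne_zero (hirr : StronglyIrreducible M)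
    {R C : Matrix (Fin d) (Fin d) ℝ} (hR : R ≠ 0) (hC : C ≠ 0) :
    ∃ B ∈ matSemigroup M, R * (B * C) ≠ 0 := by
  by_contra! h
  let W : Submodule ℝ (Fin d → ℝ) :=
    Submodule.span ℝ {z | ∃ B ∈ matSemigroup M, ∃ x, z = (B * C) *ᵥ x}
  have hker : W ≤ LinearMap.ker (Matrix.mulVecLin R) := by
    refine Submodule.span_le.2 ?_
    rintro _ ⟨B, hB, x, rfl⟩
    simp [Matrix.mulVec_mulVec, h B hB]
  refine hirr.false_of_finite (Set.finite_singleton W) ⟨W, rfl⟩ ?_ ?_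
  · rintro _ rfl
    refine ⟨fun hbot => hC ?_, fun htop => hR ?_⟩
    · refine Matrix.ext_of_mulVec_single fun i => ?_
      have : C *ᵥ Pi.single i 1 ∈ W :=
        Submodule.subset_span ⟨1, Submonoid.one_mem _, _, by rw [one_mul]⟩
      rw [hbot, Submodule.mem_bot] at this
      rw [this, Matrix.zero_mulVec]
    · refine Matrix.ext_of_mulVec_single fun i => ?_
      have : (Pi.single i 1 : Fin d → ℝ) ∈ W := by rw [htop]; trivial
      have h0 : R *ᵥ Pi.single i 1 = 0 := hker this
      rw [h0, Matrix.zero_mulVec]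
  · rintro _ rfl i
    refine Submodule.eq_of_le_of_finrank_eq ?_ (finrank_mapSubspace _ _)
    refine Submodule.map_le_iff_le_comap.2 (Submodule.span_le.2 ?_)
    rintro _ ⟨B, hB, x, rfl⟩
    refine Submodule.subset_span ⟨M i * B, Submonoid.mul_mem _
      (Submonoid.subset_closure ⟨i, rfl⟩) hB, x, ?_⟩
    simp [Matrix.mulVec_mulVec, mul_assoc]

theorem exists_vecMul_eq_smul {R : Matrix (Fin d) (Fin d) ℝ} (hR : R.rank = 1) :
    ∃ r : Fin d → ℝ, ∀ y, ∃ c : ℝ, y ᵥ* R = c • r := by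
  have h : Module.finrank ℝ (LinearMap.range (Matrix.mulVecLin Rᵀ)) = 1 := by
    have := Matrix.rank_transpose R
    rwa [hR, Matrix.rank] at this
  obtain ⟨⟨r, hr⟩, -, hspan⟩ := finrank_eq_one_iff'.1 h
  refine ⟨r, fun y => ?_⟩
  obtain ⟨c, hc⟩ := hspan ⟨y ᵥ* R, y, by simp⟩
  exact ⟨c, (congrArg Subtype.val hc).symm⟩

/-- If the mean projection has no variance at `C`, then `C` has rank at most one. -/
theorem IsProperStationary.exists_varMean_pos (hν : IsProperStationary P M ν)
    (hP : ∀ i j, 0 < P i j) (hP1 : ∀ j, ∑ i, P i j = 1)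
    (hirr : StronglyIrreducible M) (hcon : Contracting M) (j : Fin k)
    {C : Matrix (Fin d) (Fin d) ℝ} {u v : Fin d → ℝ}
    (hC : 0 < ((C *ᵥ u) ⬝ᵥ (C *ᵥ u)) * ((C *ᵥ v) ⬝ᵥ (C *ᵥ v)) - ((C *ᵥ u) ⬝ᵥ (C *ᵥ v)) ^ 2) :
    ∃ m, 0 < varMean P M ν m j C := by
  by_contra! hcontra
  have hP0 : ∀ i j, 0 ≤ P i j := fun i j => (hP i j).le
  have hC0 : C ≠ 0 := by
    rintro rfl
    simp at hC
  -- If every variance at C vanishes, the mean projection is constant along the whole chain started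
  -- at C. Every product A C is reached with positive probability.
  have key : ∀ A ∈ matSemigroup M, ∃ i, ∀ a b, dualMean ν (projEntry a b) i (A * C) =
      dualMean ν (projEntry a b) j C := by
    intro A hA
    obtain ⟨i, n, hi⟩ := exists_eq_zero_of_step_iterate hP hA j
    refine ⟨i, fun a b => ?_⟩
    have h0 := hν.stationary.varMean_eq hP0 hP1 n j C
    have h1 := le_antisymm (hcontra n) (hν.stationary.varMean_nonneg hP0 hP1 n j C)
    have hnn : ∀ a b, 0 ≤ (step P (leftMul M))^[n] (fun i h =>
        (dualMean ν (projEntry a b) i h - dualMean ν (projEntry a b) j C) ^ 2) j C :=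
      fun a b => step_iterate_nonneg hP0 _ (fun _ _ => sq_nonneg _) _ _ _
    rw [h1, eq_comm, Finset.sum_eq_zero_iff_of_nonneg
      fun a _ => Finset.sum_nonneg fun b _ => hnn a b] at h0
    have h2 := (Finset.sum_eq_zero_iff_of_nonneg fun b _ => hnn a b).1 (h0 a (Finset.mem_univ a)) b
      (Finset.mem_univ b)
    have h3 := hi _ (fun _ _ => sq_nonneg _) C h2
    exact sub_eq_zero.1 (pow_eq_zero_iff two_ne_zero |>.1 h3)
  obtain ⟨A, hA, R, hR1, hR⟩ := hcon
  have hR0 : R ≠ 0 := by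
    rintro rfl
    simp at hR1
  obtain ⟨B, hB, hRB⟩ := hirr.exists_mul_mul_ne_zero hR0 hC0
  choose i hi using fun n => key (A n * B) (Submonoid.mul_mem _ (hA n) hB)
  -- The final symbol depends on n. One that occurs infinitely often allows passage to the limit A_n
  -- / ‖A_n‖ → R with a fixed measure.
  obtain ⟨i₀, hi₀⟩ : ∃ i₀, ∃ᶠ n in atTop, i n = i₀ := by
    by_contra! h
    obtain ⟨n, hn⟩ := (eventually_all.2 h).exists
    exact hn (i n) rfl
  have hlim : ∀ a b, dualMean ν (projEntry a b) i₀ (R * (B * C)) =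
      dualMean ν (projEntry a b) j C := by
    intro a b
    have h1 := (hν.continuousAt_dualMean i₀ a b hRB).tendsto.comp
      (((continuous_id.matrix_mul (continuous_const (y := B * C))).tendsto R).comp hR)
    refine (isClosed_singleton (x := dualMean ν (projEntry a b) j C)).mem_of_frequently_of_tendsto
      ?_ h1
    have hne := hR.eventually_ne hR0
    refine (hi₀.and_eventually hne).mono ?_
    rintro n ⟨rfl, hn⟩
    have hc := (smul_ne_zero_iff.1 hn).1
    show dualMean ν (projEntry a b) (i n) (_ • A n * (B * C)) = dualMean ν (projEntry a b) j C
    rw [Matrix.smul_mul, dualMean_smul (fun c z hc => projEntry_smul _ _ c z hc) hc,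
      ← mul_assoc, hi]
  obtain ⟨r, hr⟩ := exists_vecMul_eq_smul hR1
  -- R B C has rank one and its row space is spanned by p. The mean projection at R B C, hence also
  -- at C, is therefore the projection onto the single line of p.
  set p := r ᵥ* (B * C) with hp
  have hp0 : p ≠ 0 := fun h => hRB <| by
    ext a b
    obtain ⟨c, hc⟩ := hr (Pi.single a 1)
    have : (Pi.single a 1 : Fin d → ℝ) ᵥ* (R * (B * C)) = 0 := by
      rw [← Matrix.vecMul_vecMul, hc, Matrix.smul_vecMul, ← hp, h, smul_zero]
    rw [Matrix.single_one_vecMul] at this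
    exact congrFun this b
  have hpp := dot_self_pos hp0
  have hproj : ∀ a b, dualMean ν (projEntry a b) j C = projEntry a b p := by
    intro a b
    rw [← hlim]
    have : ∀ᵐ y ∂(ν i₀ : Measure (UnitVec d)),
        projEntry a b (y.1 ᵥ* (R * (B * C))) = projEntry a b p := by
      filter_upwards [hν.ae_vecMul_ne_zero i₀ hRB] with y hy
      obtain ⟨c, hc⟩ := hr y.1
      have e : y.1 ᵥ* (R * (B * C)) = c • p := by
        rw [← Matrix.vecMul_vecMul, hc, Matrix.smul_vecMul]
      rw [e] at hy ⊢
      exact projEntry_smul a b c p (smul_ne_zero_iff.1 hy).1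
    rw [dualMean, integral_congr_ae this]
    simp
  have hI : ∀ a b, Integrable (fun y : UnitVec d => projEntry a b (y.1 ᵥ* C))
      (ν j : Measure (UnitVec d)) := fun a b =>
    integrable_comp_vecMul (measurable_projEntry a b) (abs_projEntry_le a b) C _
  -- The integrand is the nonnegative deficit in the Cauchy–Schwarz inequality, so a zero integral
  -- makes y C parallel to p for almost every y.
  have hint : ∫ y, (p ⬝ᵥ p - ((y.1 ᵥ* C) ⬝ᵥ p) ^ 2 / ((y.1 ᵥ* C) ⬝ᵥ (y.1 ᵥ* C)))
      ∂(ν j : Measure (UnitVec d)) = 0 := by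
    simp only [dot_sq_eq_sum_projEntry]
    rw [integral_sub (integrable_const _) (integrable_finsetSum _ fun a _ =>
      integrable_finsetSum _ fun b _ => (hI a b).const_mul _), integral_finsetSum _ fun a _ =>
      integrable_finsetSum _ fun b _ => (hI a b).const_mul _]
    have : ∀ a, ∫ y : UnitVec d, ∑ b, p a * p b * projEntry a b (y.1 ᵥ* C)
        ∂(ν j : Measure (UnitVec d)) = ∑ b, p a * p b * projEntry a b p := fun a => by
      rw [integral_finsetSum _ fun b _ => (hI a b).const_mul _]
      refine Finset.sum_congr rfl fun b _ => ?_
      rw [integral_const_mul, ← hproj]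
      rfl
    simp only [this, ← dot_sq_eq_sum_projEntry, integral_const, probReal_univ, one_smul]
    field_simp
    ring
  have hnn : ∀ y : UnitVec d,
      0 ≤ p ⬝ᵥ p - ((y.1 ᵥ* C) ⬝ᵥ p) ^ 2 / ((y.1 ᵥ* C) ⬝ᵥ (y.1 ᵥ* C)) := fun y => by
    rw [sub_nonneg]
    refine div_le_of_le_mul₀ (dot_self_nonneg _) hpp.le ?_
    rw [mul_comm]
    exact dot_sq_le _ _
  have hae : ∀ᵐ y ∂(ν j : Measure (UnitVec d)), ∃ t : ℝ, y.1 ᵥ* C = t • p := by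
    have h1 := (integral_eq_zero_iff_of_nonneg hnn ((integrable_const _).sub (by
      simp only [dot_sq_eq_sum_projEntry]
      exact integrable_finsetSum _ fun a _ => integrable_finsetSum _ fun b _ =>
        (hI a b).const_mul _))).1 hint
    filter_upwards [h1, hν.ae_vecMul_ne_zero j hC0] with y hy hy0
    set z := y.1 ᵥ* C
    have hzz := dot_self_pos hy0
    have e1 : (z ⬝ᵥ p) ^ 2 = (p ⬝ᵥ p) * (z ⬝ᵥ z) := by
      have : (z ⬝ᵥ p) ^ 2 / (z ⬝ᵥ z) = p ⬝ᵥ p := (sub_eq_zero.1 hy).symm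
      rwa [div_eq_iff hzz.ne'] at this
    refine ⟨(z ⬝ᵥ p) / (p ⬝ᵥ p), sub_eq_zero.1 (dotProduct_self_eq_zero.1 ?_)⟩
    simp only [sub_dotProduct, dotProduct_sub, smul_dotProduct, dotProduct_smul, smul_eq_mul,
      dotProduct_comm p z]
    field_simp
    linarith
  -- C u and C v are independent, so some combination w of u and v is orthogonal to p and is not
  -- killed by C. Then y · C w = 0 for almost every y, which puts all of ν_j on a hyperplane.
  obtain ⟨w, hw0, hw⟩ : ∃ w, C *ᵥ w ≠ 0 ∧ p ⬝ᵥ w = 0 := by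
    by_cases hpu : p ⬝ᵥ u = 0
    · refine ⟨u, fun h => ?_, hpu⟩
      rw [h] at hC
      simp at hC
    · refine ⟨(p ⬝ᵥ v) • u - (p ⬝ᵥ u) • v, fun h => ?_, ?_⟩
      · rw [Matrix.mulVec_sub, Matrix.mulVec_smul, Matrix.mulVec_smul, sub_eq_zero] at h
        have hv : C *ᵥ v = ((p ⬝ᵥ v) / (p ⬝ᵥ u)) • C *ᵥ u := by
          rw [div_eq_inv_mul, mul_smul, h, smul_smul, inv_mul_cancel₀ hpu, one_smul]
        rw [hv] at hC
        simp only [smul_dotProduct, dotProduct_smul, smul_eq_mul] at hC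
        ring_nf at hC
        exact lt_irrefl _ hC
      · simp only [dotProduct_sub, dotProduct_smul, smul_eq_mul]
        ring
  have hzero : ∀ᵐ y ∂(ν j : Measure (UnitVec d)), y.1 ⬝ᵥ (C *ᵥ w) = 0 := by
    filter_upwards [hae] with y ⟨t, ht⟩
    rw [Matrix.dotProduct_mulVec, ht, smul_dotProduct, hw, smul_zero]
  have h0 := hν.proper j _ hw0
  have : (ν j : Measure (UnitVec d)) Set.univ = 0 := by
    rw [ae_iff] at hzero
    refine measure_mono_null (fun y _ => ?_) (measure_union_null h0 hzero)
    by_cases h : y.1 ⬝ᵥ (C *ᵥ w) = 0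
    · exact Or.inl h
    · exact Or.inr h
  simp at this

end Rigidity

/-! ### From small variance to contraction of distances and of their moments. -/

section ContractionInProbability

variable {k d : ℕ} {P : Fin k → Fin k → ℝ} {M : Fin k → GL (Fin d) ℝ}
  {ν : Fin k → ProbabilityMeasure (UnitVec d)}

/-- The Gram determinant of two vectors. -/
def gram (v w : Fin d → ℝ) : ℝ := (v ⬝ᵥ v) * (w ⬝ᵥ w) - (v ⬝ᵥ w) ^ 2

theorem gram_add_smul (v w : Fin d → ℝ) (t : ℝ) : gram v (w + t • v) = gram v w := by
  simp only [gram, dotProduct_add, add_dotProduct, smul_dotProduct, dotProduct_smul, smul_eq_mul,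
    dotProduct_comm w v]
  ring

theorem gram_smul_right (v w : Fin d → ℝ) (t : ℝ) : gram v (t • w) = t ^ 2 * gram v w := by
  simp only [gram, smul_dotProduct, dotProduct_smul, smul_eq_mul]
  ring

theorem gram_smul_smul (v w : Fin d → ℝ) (t : ℝ) : gram (t • v) (t • w) = t ^ 4 * gram v w := by
  simp only [gram, smul_dotProduct, dotProduct_smul, smul_eq_mul]
  ring

theorem projDist_sq_mul (v w : Fin d → ℝ) (hv : v ≠ 0) (hw : w ≠ 0) :
    projDist (Projectivization.mk ℝ v hv) (Projectivization.mk ℝ w hw) ^ 2 *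
      ((v ⬝ᵥ v) * (w ⬝ᵥ w)) = gram v w := by
  have := dot_self_pos hw
  rw [← mul_assoc, projDist_sq_mk, gram]
  field_simp

theorem isCompact_frobSq_eq_one :
    IsCompact {g : Matrix (Fin d) (Fin d) ℝ | frobSq g = 1} := by
  have hc : IsCompact (Set.univ.pi fun _ : Fin d => Set.univ.pi fun _ : Fin d =>
      Set.Icc (-1 : ℝ) 1) := isCompact_univ_pi fun _ => isCompact_univ_pi fun _ => isCompact_Icc
  have hcont : Continuous (frobSq (d := d)) :=
    continuous_finsetSum _ fun i _ => (continuous_apply i).dotProduct (continuous_apply i)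
  refine hc.of_isClosed_subset (isClosed_eq hcont continuous_const) fun g hg i _ a _ => ?_
  refine abs_le.1 (abs_apply_le_of_dot_self_le zero_le_one ?_ a)
  have hg' : frobSq g = 1 := hg
  rw [one_pow, ← hg']
  exact Finset.single_le_sum (f := fun i => g i ⬝ᵥ g i) (fun i _ => dot_self_nonneg _)
    (Finset.mem_univ i)

/-- Compactness turns positivity of some variance into a uniform bound. Variances increase with m,
so the sets where the m-step variance exceeds 1/(m + 1) increase as well, and one index m serves
both as the number of steps and as the lower bound. -/
theorem IsProperStationary.exists_le_varMean_aux (hν : IsProperStationary P M ν)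
    (hP : ∀ i j, 0 < P i j) (hP1 : ∀ j, ∑ i, P i j = 1)
    (hirr : StronglyIrreducible M) (hcon : Contracting M) {c : ℝ} (hc : 0 < c) (j : Fin k) :
    ∃ m : ℕ, ∀ (g : Matrix (Fin d) (Fin d) ℝ) (u v : UnitVec d), frobSq g = 1 →
      c ≤ gram (g *ᵥ u.1) (g *ᵥ v.1) → 1 / ((m : ℝ) + 1) < varMean P M ν m j g := by
  have hP0 : ∀ i j, 0 ≤ P i j := fun i j => (hP i j).le
  let K : Set (Matrix (Fin d) (Fin d) ℝ × UnitVec d × UnitVec d) :=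
    {p | frobSq p.1 = 1 ∧ c ≤ gram (p.1 *ᵥ p.2.1.1) (p.1 *ᵥ p.2.2.1)}
  have hK : IsCompact K := by
    have h1 : IsCompact ({g : Matrix (Fin d) (Fin d) ℝ | frobSq g = 1} ×ˢ
        (Set.univ : Set (UnitVec d × UnitVec d))) := isCompact_frobSq_eq_one.prod isCompact_univ
    have hu : Continuous fun p : Matrix (Fin d) (Fin d) ℝ × UnitVec d × UnitVec d =>
        p.1 *ᵥ p.2.1.1 := continuous_fst.matrix_mulVec
      (continuous_subtype_val.comp (continuous_fst.comp continuous_snd))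
    have hv : Continuous fun p : Matrix (Fin d) (Fin d) ℝ × UnitVec d × UnitVec d =>
        p.1 *ᵥ p.2.2.1 := continuous_fst.matrix_mulVec
      (continuous_subtype_val.comp (continuous_snd.comp continuous_snd))
    have h2 : IsClosed {p : Matrix (Fin d) (Fin d) ℝ × UnitVec d × UnitVec d |
        c ≤ gram (p.1 *ᵥ p.2.1.1) (p.1 *ᵥ p.2.2.1)} :=
      isClosed_le continuous_const
        (((hu.dotProduct hu).mul (hv.dotProduct hv)).sub ((hu.dotProduct hv).pow 2))
    have h3 : K = ({g : Matrix (Fin d) (Fin d) ℝ | frobSq g = 1} ×ˢ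
        (Set.univ : Set (UnitVec d × UnitVec d))) ∩
          {p | c ≤ gram (p.1 *ᵥ p.2.1.1) (p.1 *ᵥ p.2.2.1)} := by
      ext p; simp [K]
    rw [h3]
    exact h1.inter_right h2
  let O : ℕ → Set (Matrix (Fin d) (Fin d) ℝ) :=
    fun m => {g | g ≠ 0 ∧ 1 / ((m : ℝ) + 1) < varMean P M ν m j g}
  have hO : ∀ m, IsOpen (O m) := fun m => by
    rw [isOpen_iff_mem_nhds]
    rintro g ⟨hg, h⟩
    have hne : ∀ᶠ g' in 𝓝 g, g' ≠ 0 := continuousAt_id.eventually_ne hg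
    filter_upwards [hne, (hν.continuousAt_varMean m j hg).eventually (lt_mem_nhds h)] with g' h1 h2
    exact ⟨h1, h2⟩
  have hmono : Monotone O := by
    rintro m m' hmm g ⟨hg, h⟩
    refine ⟨hg, lt_of_le_of_lt ?_ (h.trans_le (hν.stationary.varMean_mono hP0 hP1 j g hmm))⟩
    exact one_div_le_one_div_of_le (by positivity) (by exact_mod_cast Nat.succ_le_succ hmm)
  obtain ⟨m, hm⟩ := hK.elim_directed_cover (fun m => Prod.fst ⁻¹' O m)
    (fun m => (hO m).preimage continuous_fst) (by
      rintro ⟨g, u, v⟩ ⟨hg, hgr⟩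
      obtain ⟨m, hm⟩ := hν.exists_varMean_pos hP hP1 hirr hcon j (C := g) (u := u.1) (v := v.1)
        (hc.trans_le hgr)
      obtain ⟨n, hn⟩ := exists_nat_one_div_lt hm
      refine Set.mem_iUnion.2 ⟨max m n, ?_, ?_⟩
      · rintro rfl
        simp [frobSq_eq_zero.2] at hg
      · refine lt_of_le_of_lt ?_ (hn.trans_le
          (hν.stationary.varMean_mono hP0 hP1 j g (le_max_left m n)))
        exact one_div_le_one_div_of_le (by positivity)
          (by exact_mod_cast Nat.succ_le_succ (le_max_right m n)))
    (directed_of_isDirected_le fun a b hab => Set.preimage_mono (hmono hab))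
  exact ⟨m, fun g u v hg h => (hm (show (g, u, v) ∈ K from ⟨hg, h⟩)).2⟩

theorem IsProperStationary.exists_le_varMean (hν : IsProperStationary P M ν)
    (hP : ∀ i j, 0 < P i j) (hP1 : ∀ j, ∑ i, P i j = 1)
    (hirr : StronglyIrreducible M) (hcon : Contracting M) {c : ℝ} (hc : 0 < c) :
    ∃ m : ℕ, ∃ δ : ℝ, 0 < δ ∧ ∀ j (g : Matrix (Fin d) (Fin d) ℝ) (u v : UnitVec d), g ≠ 0 →
      c * frobSq g ^ 2 ≤ gram (g *ᵥ u.1) (g *ᵥ v.1) → δ ≤ varMean P M ν m j g := by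
  have hP0 : ∀ i j, 0 ≤ P i j := fun i j => (hP i j).le
  choose m hm using fun j => hν.exists_le_varMean_aux hP hP1 hirr hcon hc j
  set N := Finset.univ.sup m with hN
  refine ⟨N, 1 / ((N : ℝ) + 1), by positivity, fun j g u v hg h => ?_⟩
  have hf := frobSq_pos hg
  set t := (√(frobSq g))⁻¹ with ht
  have ht0 : t ≠ 0 := inv_ne_zero (Real.sqrt_pos.2 hf).ne'
  have ht2 : t ^ 2 = (frobSq g)⁻¹ := by rw [ht, inv_pow, Real.sq_sqrt hf.le]
  have h1 : frobSq (t • g) = 1 := by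
    have : frobSq (t • g) = t ^ 2 * frobSq g := by
      simp only [frobSq, Matrix.smul_apply, dotProduct, smul_eq_mul, Finset.mul_sum]
      exact Finset.sum_congr rfl fun i _ => Finset.sum_congr rfl fun a _ => by ring
    rw [this, ht2, inv_mul_cancel₀ hf.ne']
  have h2 : c ≤ gram ((t • g) *ᵥ u.1) ((t • g) *ᵥ v.1) := by
    rw [Matrix.smul_mulVec, Matrix.smul_mulVec, gram_smul_smul,
      show t ^ 4 = (t ^ 2) ^ 2 by ring, ht2, inv_pow, ← div_eq_inv_mul,
      le_div_iff₀ (by positivity)]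
    exact h
  have h3 := hm j (t • g) u v h1 h2
  rw [varMean_smul _ ht0] at h3
  have hmN : m j ≤ N := Finset.le_sup (f := m) (Finset.mem_univ j)
  refine le_trans ?_ (h3.le.trans (hν.stationary.varMean_mono hP0 hP1 j g hmN))
  exact one_div_le_one_div_of_le (by positivity) (by exact_mod_cast Nat.succ_le_succ hmN)

/-- If the distance of two points is not contracted, then one of the two points is contracted
too much or the matrix is far from having rank one. -/
theorem exists_gram_ge {c ε η : ℝ} (hη : 0 < η) (hε : 0 < ε) (hc : c = η ^ 2 * ε ^ 4)
    (g : GL (Fin d) ℝ) (v w : UnitVec d)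
    (h : η * projDist (Projectivization.mk ℝ v.1 v.ne_zero) (Projectivization.mk ℝ w.1 w.ne_zero) <
      projDist (g • Projectivization.mk ℝ v.1 v.ne_zero) (g • Projectivization.mk ℝ w.1 w.ne_zero))
    (hv : ε ^ 2 * frobSq (g : Matrix (Fin d) (Fin d) ℝ) <
      ((g : Matrix (Fin d) (Fin d) ℝ) *ᵥ v.1) ⬝ᵥ ((g : Matrix (Fin d) (Fin d) ℝ) *ᵥ v.1))
    (hw : ε ^ 2 * frobSq (g : Matrix (Fin d) (Fin d) ℝ) <
      ((g : Matrix (Fin d) (Fin d) ℝ) *ᵥ w.1) ⬝ᵥ ((g : Matrix (Fin d) (Fin d) ℝ) *ᵥ w.1)) :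
    ∃ u : UnitVec d, c * frobSq (g : Matrix (Fin d) (Fin d) ℝ) ^ 2 ≤
      gram ((g : Matrix (Fin d) (Fin d) ℝ) *ᵥ v.1) ((g : Matrix (Fin d) (Fin d) ℝ) *ᵥ u.1) := by
  set G := (g : Matrix (Fin d) (Fin d) ℝ) with hG
  rw [Projectivization.smul_mk, Projectivization.smul_mk] at h
  set x := Projectivization.mk ℝ v.1 v.ne_zero
  set y := Projectivization.mk ℝ w.1 w.ne_zero
  have e1 : projDist x y ^ 2 = gram v.1 w.1 := by
    rw [← projDist_sq_mul v.1 w.1 v.ne_zero w.ne_zero, v.2, w.2, mul_one, mul_one]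
  have e2 := projDist_sq_mul (g • v.1) (g • w.1) ((smul_ne_zero_iff_ne g).mpr v.ne_zero)
    ((smul_ne_zero_iff_ne g).mpr w.ne_zero)
  set D := projDist (Projectivization.mk ℝ (g • v.1) ((smul_ne_zero_iff_ne g).mpr v.ne_zero))
    (Projectivization.mk ℝ (g • w.1) ((smul_ne_zero_iff_ne g).mpr w.ne_zero))
  set E := projDist x y
  have hE : 0 ≤ E := projDist_nonneg _ _
  have hgv : g • v.1 = G *ᵥ v.1 := rfl
  have hgw : g • w.1 = G *ᵥ w.1 := rfl
  rw [hgv, hgw] at e2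
  -- The component of w orthogonal to v has length d(x, y) and gives the same Gram determinant.
  -- Normalising it divides this determinant by d(x, y)², so its direction is the required u.
  set z := w.1 - (v.1 ⬝ᵥ w.1) • v.1 with hz
  have hw' : w.1 = z + (v.1 ⬝ᵥ w.1) • v.1 := (sub_add_cancel _ _).symm
  have hzz : z ⬝ᵥ z = E ^ 2 := by
    rw [e1, gram, hz]
    simp only [sub_dotProduct, dotProduct_sub, smul_dotProduct, dotProduct_smul, smul_eq_mul,
      dotProduct_comm w.1 v.1, v.2, w.2]
    ring
  have hgram : gram (G *ᵥ v.1) (G *ᵥ w.1) = gram (G *ᵥ v.1) (G *ᵥ z) := by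
    conv_lhs => rw [hw']
    rw [Matrix.mulVec_add, Matrix.mulVec_smul, gram_add_smul]
  have hD : 0 < D := lt_of_le_of_lt (by positivity) h
  have hGv : 0 < (G *ᵥ v.1) ⬝ᵥ (G *ᵥ v.1) := lt_of_le_of_lt
    (mul_nonneg (by positivity) (frobSq_nonneg G)) hv
  have hGw : 0 < (G *ᵥ w.1) ⬝ᵥ (G *ᵥ w.1) := lt_of_le_of_lt
    (mul_nonneg (by positivity) (frobSq_nonneg G)) hw
  have hz0 : z ≠ 0 := by
    intro h0
    have : 0 < D ^ 2 * (((G *ᵥ v.1) ⬝ᵥ (G *ᵥ v.1)) * ((G *ᵥ w.1) ⬝ᵥ (G *ᵥ w.1))) := by positivity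
    rw [e2, hgram, h0, Matrix.mulVec_zero] at this
    simp [gram] at this
  have hE2 : 0 < E ^ 2 := hzz ▸ dot_self_pos hz0
  refine ⟨unitOf z hz0, ?_⟩
  have e3 : E ^ 2 * gram (G *ᵥ v.1) (G *ᵥ (unitOf z hz0).1) = gram (G *ᵥ v.1) (G *ᵥ z) := by
    rw [unitOf, Matrix.mulVec_smul, gram_smul_right, inv_pow, Real.sq_sqrt (dot_self_nonneg z), hzz,
      ← mul_assoc, mul_inv_cancel₀ hE2.ne', one_mul]
  refine le_of_mul_le_mul_left ?_ hE2
  rw [e3, ← hgram, ← e2, hc]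
  have h1 : (η * E) ^ 2 ≤ D ^ 2 := pow_le_pow_left₀ (by positivity) h.le 2
  have h2 : (ε ^ 2 * frobSq G) * (ε ^ 2 * frobSq G) ≤
      ((G *ᵥ v.1) ⬝ᵥ (G *ᵥ v.1)) * ((G *ᵥ w.1) ⬝ᵥ (G *ᵥ w.1)) :=
    mul_le_mul hv.le hw.le (mul_nonneg (by positivity) (frobSq_nonneg G)) hGv.le
  calc E ^ 2 * (η ^ 2 * ε ^ 4 * frobSq G ^ 2)
      = (η * E) ^ 2 * ((ε ^ 2 * frobSq G) * (ε ^ 2 * frobSq G)) := by ring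
    _ ≤ _ := mul_le_mul h1 h2 (mul_self_nonneg _) (sq_nonneg _)

-- If g does not shrink the distance by η, then g contracts v too much, or contracts w too much, or
-- is far from rank one, so that the variance at g is at least δ. `Ψ` dominates the indicator in
-- each case. Its expectation from the identity is at most η/4 + η/4 + η/2: two slabs of mass η/8,
-- doubled, and Markov's inequality for the variance after many steps.
open Classical in
theorem IsProperStationary.exists_contraction_in_probability (hν : IsProperStationary P M ν)
    (hP : ∀ i j, 0 < P i j) (hP1 : ∀ j, ∑ i, P i j = 1) (hd : 0 < d)
    (hirr : StronglyIrreducible M) (hcon : Contracting M) {η : ℝ} (hη : 0 < η) :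
    ∃ n, ∀ j (x y : Proj d), (step P (pairAct M))^[n]
      (fun _ q => if η * projDist x y < projDist q.1 q.2 then 1 else 0) j (x, y) ≤ η := by
  have hP0 : ∀ i j, 0 ≤ P i j := fun i j => (hP i j).le
  have hd' : (0 : ℝ) < d := by exact_mod_cast hd
  obtain ⟨δ₁, hδ₁, h1⟩ := exists_concentration_le hν.proper (show (0 : ℝ) < η / 8 by positivity)
  obtain ⟨δ₂, hδ₂, h2⟩ := exists_concentration_le hν.proper (show (0 : ℝ) < 1 / 2 by norm_num)
  obtain ⟨ε, hε, hε1, hε2⟩ : ∃ ε : ℝ, 0 < ε ∧ ε ≤ δ₁ ∧ d * ε ≤ δ₂ :=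
    ⟨min δ₁ (δ₂ / d), lt_min hδ₁ (by positivity), min_le_left _ _, by
      rw [← le_div_iff₀' hd']; exact min_le_right _ _⟩
  obtain ⟨m, δ, hδ, hm⟩ := hν.exists_le_varMean hP hP1 hirr hcon
    (show (0 : ℝ) < η ^ 2 * ε ^ 4 by positivity)
  obtain ⟨n, hn⟩ : ∃ n, ∀ j, (step P (leftMul M))^[n] (varMean P M ν m) j 1 < δ * (η / 2) :=
    (eventually_all.2 fun j => (hν.stationary.tendsto_step_varMean hP0 hP1 m j 1).eventually
      (gt_mem_nhds (show 0 < δ * (η / 2) by positivity))).exists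
  refine ⟨n, fun j x y => ?_⟩
  obtain ⟨v, rfl⟩ := exists_unitVec_mk_eq x
  obtain ⟨w, rfl⟩ := exists_unitVec_mk_eq y
  set x := Projectivization.mk ℝ v.1 v.ne_zero with hx
  set y := Projectivization.mk ℝ w.1 w.ne_zero with hy
  let Ψ : Fin k → Matrix (Fin d) (Fin d) ℝ → ℝ := (2 : ℝ) • dualMean ν (nearPerp v.1 ε) +
    ((2 : ℝ) • dualMean ν (nearPerp w.1 ε) + δ⁻¹ • varMean P M ν m)
  let s : Fin k → GL (Fin d) ℝ → GL (Fin d) ℝ := fun i g => M i * g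
  have e1 := step_iterate_comp P (s := s) (t := pairAct M)
    (π := fun g : GL (Fin d) ℝ => (g • x, g • y)) (fun i g => by simp [s, pairAct, mul_smul])
    (fun _ q => if η * projDist x y < projDist q.1 q.2 then 1 else 0) n j 1
  have e2 := step_iterate_comp P (s := s) (t := leftMul M)
    (π := fun g : GL (Fin d) ℝ => (g : Matrix (Fin d) (Fin d) ℝ)) (fun i g => rfl) Ψ n j 1
  simp only [one_smul] at e1
  rw [← e1]
  have hle : ∀ j (g : GL (Fin d) ℝ), (if η * projDist x y < projDist (g • x) (g • y)
      then (1 : ℝ) else 0) ≤ Ψ j g := by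
    intro j g
    have p1 : 0 ≤ dualMean ν (nearPerp v.1 ε) j (g : Matrix (Fin d) (Fin d) ℝ) :=
      dualMean_nearPerp_nonneg _ _ _ _
    have p2 : 0 ≤ dualMean ν (nearPerp w.1 ε) j (g : Matrix (Fin d) (Fin d) ℝ) :=
      dualMean_nearPerp_nonneg _ _ _ _
    have p3 : 0 ≤ δ⁻¹ * varMean P M ν m j (g : Matrix (Fin d) (Fin d) ℝ) :=
      mul_nonneg (by positivity) (hν.stationary.varMean_nonneg hP0 hP1 m j _)
    have hΨ : Ψ j g = 2 * dualMean ν (nearPerp v.1 ε) j (g : Matrix (Fin d) (Fin d) ℝ) +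
      (2 * dualMean ν (nearPerp w.1 ε) j (g : Matrix (Fin d) (Fin d) ℝ) +
        δ⁻¹ * varMean P M ν m j (g : Matrix (Fin d) (Fin d) ℝ)) := rfl
    have hg0 := GL_val_ne_zero hd g
    rw [hΨ]
    split_ifs with h
    · rcases le_or_gt (((g : Matrix (Fin d) (Fin d) ℝ) *ᵥ v.1) ⬝ᵥ
        ((g : Matrix (Fin d) (Fin d) ℝ) *ᵥ v.1))
          (ε ^ 2 * frobSq (g : Matrix (Fin d) (Fin d) ℝ)) with hv | hv
      · have := half_le_dualMean_nearPerp hd hε (h2 _ hε2) hg0 hv j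
        linarith
      rcases le_or_gt (((g : Matrix (Fin d) (Fin d) ℝ) *ᵥ w.1) ⬝ᵥ
        ((g : Matrix (Fin d) (Fin d) ℝ) *ᵥ w.1))
          (ε ^ 2 * frobSq (g : Matrix (Fin d) (Fin d) ℝ)) with hw | hw
      · have := half_le_dualMean_nearPerp hd hε (h2 _ hε2) hg0 hw j
        linarith
      obtain ⟨u, hu⟩ := exists_gram_ge hη hε rfl g v w h hv hw
      have h3 := hm j _ v u hg0 hu
      have h4 : 1 ≤ δ⁻¹ * varMean P M ν m j (g : Matrix (Fin d) (Fin d) ℝ) := by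
        rwa [← div_eq_inv_mul, one_le_div hδ]
      linarith
    · linarith
  refine (step_iterate_mono hP0 s hle n j 1).trans ?_
  rw [e2]
  simp only [Ψ, Units.val_one, step_iterate_add, step_iterate_smul,
    Function.iterate_fixed (hν.stationary.harmonic_nearPerp hP0 _ ε)]
  simp only [Pi.add_apply, Pi.smul_apply, smul_eq_mul, dualMean_nearPerp_one]
  have h3 := h1 _ hε1 j v
  have h4 := h1 _ hε1 j w
  have h5 : δ⁻¹ * (step P (leftMul M))^[n] (varMean P M ν m) j 1 ≤ η / 2 := by
    rw [← div_eq_inv_mul, div_le_iff₀' hδ]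
    exact (hn j).le
  linarith

/-- Small moments of the distance are contracted. -/
theorem IsProperStationary.exists_moment_contraction (hν : IsProperStationary P M ν)
    (hP : ∀ i j, 0 < P i j) (hP1 : ∀ j, ∑ i, P i j = 1) (hd : 0 < d)
    (hirr : StronglyIrreducible M) (hcon : Contracting M) :
    ∃ α₀ : ℝ, 0 < α₀ ∧ ∀ α : ℝ, 0 < α → α ≤ α₀ → ∃ n, ∀ j p,
      (step P (pairAct M))^[n] (distPow k d α) j p ≤ 3 / 4 * projDist p.1 p.2 ^ α := by
  have hP0 : ∀ i j, 0 ≤ P i j := fun i j => (hP i j).le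
  have hd' : (0 : ℝ) < d := by exact_mod_cast hd
  obtain ⟨δ₁, hδ₁, h1⟩ := exists_concentration_le hν.proper (show (0 : ℝ) < 1 / 16 by norm_num)
  obtain ⟨δ₂, hδ₂, h2⟩ := exists_concentration_le hν.proper (show (0 : ℝ) < 1 / 2 by norm_num)
  obtain ⟨ε, hε, hε0, hε1, hε2⟩ : ∃ ε : ℝ, 0 < ε ∧ ε ≤ 1 ∧ ε ≤ δ₁ ∧ d * ε ≤ δ₂ :=
    ⟨min 1 (min δ₁ (δ₂ / d)), lt_min one_pos (lt_min hδ₁ (by positivity)), min_le_left _ _,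
      (min_le_right _ _).trans (min_le_left _ _), by
      rw [← le_div_iff₀' hd']; exact (min_le_right _ _).trans (min_le_right _ _)⟩
  obtain ⟨C, hC, hlip⟩ := exists_common_lipschitz M
  have hhit : ∀ n j (x y : Proj d),
      hit P (pairAct M) {p | projDist x y / ε < projDist p.1 p.2} n j (x, y) ≤ 1 / 8 :=
    fun n j x y => (hν.stationary.hit_le hP0 hd hε (h1 _ hε1) (h2 _ hε2) n j x y).trans
      (by norm_num)
  have hCε : 1 ≤ C / ε := by
    rw [one_le_div hε]; exact hε0.trans hC
  obtain ⟨β, hβ, hβ2⟩ : ∃ β : ℝ, 0 < β ∧ (C / ε) ^ β ≤ 2 := by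
    have hcont : Tendsto (fun β : ℝ => (C / ε) ^ β) (𝓝 0) (𝓝 ((C / ε) ^ (0 : ℝ))) :=
      (Real.continuousAt_const_rpow (zero_lt_one.trans_le hCε).ne').tendsto
    rw [Real.rpow_zero] at hcont
    obtain ⟨β, hβ, h⟩ := ((hcont.mono_left nhdsWithin_le_nhds).eventually
      (gt_mem_nhds (show (1 : ℝ) < 2 by norm_num)) |>.and
        (self_mem_nhdsWithin (s := Set.Ioi (0 : ℝ)))).exists
    exact ⟨β, h, hβ.le⟩
  -- Both the moment of order α and that of order 2α must stay bounded.
  refine ⟨β / 2, by positivity, fun α hα hαβ => ?_⟩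
  have hmom : ∀ γ : ℝ, 0 < γ → γ ≤ β → ∀ n j p,
      (step P (pairAct M))^[n] (distPow k d γ) j p ≤ 4 * projDist p.1 p.2 ^ γ :=
    fun γ hγ hγβ => step_iterate_distPow_le hP0 hP1 hC hlip hε hε0 hγ
      ((Real.rpow_le_rpow_of_exponent_le hCε hγβ).trans hβ2) hhit
  refine exists_step_iterate_distPow_le hP0 hP1 hα (hmom α hα (by linarith))
    (hmom (2 * α) (by linarith) (by linarith)) fun η hη => ?_
  exact hν.exists_contraction_in_probability hP hP1 hd hirr hcon hη

end ContractionInProbability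

/-! ### Contraction of the Hölder seminorm -/

section Coupling

/-- Averages with respect to two probability vectors with overlap at least `κ`. -/
theorem norm_average_sub_le {ι : Type*} [Fintype ι] {p q : ι → ℝ} (hp : ∀ i, 0 ≤ p i)
    (hq : ∀ i, 0 ≤ q i) (hp1 : ∑ i, p i = 1) (hq1 : ∑ i, q i = 1) {κ : ℝ}
    (hκ : κ ≤ ∑ i, min (p i) (q i)) {u v : ι → ℂ} {B D : ℝ} (hB : 0 ≤ B) (hD : 0 ≤ D)
    (huv : ∀ i, ‖u i - v i‖ ≤ B) (huv' : ∀ i l, ‖u i - v l‖ ≤ D) :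
    ‖∑ i, (p i : ℂ) * u i - ∑ i, (q i : ℂ) * v i‖ ≤ B + (1 - κ) * D := by
  -- A coupling: the common part r is matched with itself at cost B, and the two remainders, of mass
  -- 1 - s ≤ 1 - κ, are matched at cost D.
  set r : ι → ℝ := fun i => min (p i) (q i) with hr
  have hr0 : ∀ i, 0 ≤ r i := fun i => le_min (hp i) (hq i)
  set s := ∑ i, r i with hs
  have hs0 : 0 ≤ s := Finset.sum_nonneg fun i _ => hr0 i
  have hs1 : s ≤ 1 := hp1 ▸ Finset.sum_le_sum fun i _ => min_le_left _ _
  set A : ι → ℝ := fun i => p i - r i with hA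
  set E : ι → ℝ := fun i => q i - r i with hE
  have hA0 : ∀ i, 0 ≤ A i := fun i => sub_nonneg.2 (min_le_left _ _)
  have hE0 : ∀ i, 0 ≤ E i := fun i => sub_nonneg.2 (min_le_right _ _)
  have hAs : ∑ i, A i = 1 - s := by rw [Finset.sum_sub_distrib, hp1]
  have hEs : ∑ i, E i = 1 - s := by rw [Finset.sum_sub_distrib, hq1]
  set X : ℂ := ∑ i, (A i : ℂ) * u i - ∑ i, (E i : ℂ) * v i with hX
  have e1 : ∑ i, (p i : ℂ) * u i - ∑ i, (q i : ℂ) * v i = ∑ i, (r i : ℂ) * (u i - v i) + X := by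
    simp only [hX, hA, hE, Complex.ofReal_sub, mul_sub, sub_mul, Finset.sum_sub_distrib]
    ring
  have e2 : ‖∑ i, (r i : ℂ) * (u i - v i)‖ ≤ s * B := by
    rw [hs, Finset.sum_mul]
    refine norm_sum_le_of_le _ fun i _ => ?_
    rw [norm_mul, Complex.norm_real, Real.norm_of_nonneg (hr0 i)]
    exact mul_le_mul_of_nonneg_left (huv i) (hr0 i)
  have e3 : ‖X‖ ≤ (1 - s) * D := by
    rcases (sub_nonneg.2 hs1).eq_or_lt with h0 | h0
    · have hA' : ∀ i, A i = 0 := fun i =>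
        (Finset.sum_eq_zero_iff_of_nonneg fun i _ => hA0 i).1 (hAs.trans h0.symm) i
          (Finset.mem_univ i)
      have hE' : ∀ i, E i = 0 := fun i =>
        (Finset.sum_eq_zero_iff_of_nonneg fun i _ => hE0 i).1 (hEs.trans h0.symm) i
          (Finset.mem_univ i)
      have : X = 0 := by simp [hX, hA', hE']
      rw [this, norm_zero, ← h0, zero_mul]
    -- The remainders are coupled independently. The product A ⊗ E has marginals (1 - s) A and (1 -
    -- s) E, which accounts for the extra factor.
    · have h1 : ((1 - s : ℝ) : ℂ) * X = ∑ i, ∑ l, ((A i * E l : ℝ) : ℂ) * (u i - v l) := by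
        have hx : ∀ i l, ((A i * E l : ℝ) : ℂ) * (u i - v l) =
            ((A i : ℂ) * u i) * (E l : ℂ) - (A i : ℂ) * ((E l : ℂ) * v l) := fun i l => by
          push_cast; ring
        simp only [hx, Finset.sum_sub_distrib, ← Finset.mul_sum, ← Finset.sum_mul,
          ← Complex.ofReal_sum, hAs, hEs]
        rw [hX]
        ring
      have h2 : ‖((1 - s : ℝ) : ℂ) * X‖ ≤ (1 - s) * ((1 - s) * D) := by
        rw [h1]
        have : (1 - s) * ((1 - s) * D) = ∑ i, ∑ l, A i * E l * D := by
          simp only [← Finset.sum_mul, ← Finset.mul_sum, hAs, hEs]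
          ring
        rw [this]
        refine norm_sum_le_of_le _ fun i _ => norm_sum_le_of_le _ fun l _ => ?_
        rw [norm_mul, Complex.norm_real, Real.norm_of_nonneg (mul_nonneg (hA0 i) (hE0 l))]
        exact mul_le_mul_of_nonneg_left (huv' i l) (mul_nonneg (hA0 i) (hE0 l))
      rw [norm_mul, Complex.norm_real, Real.norm_of_nonneg h0.le] at h2
      exact le_of_mul_le_mul_left h2 h0
  rw [e1]
  refine (norm_add_le _ _).trans ?_
  nlinarith [mul_le_mul_of_nonneg_right hs1 hB, mul_le_mul_of_nonneg_right hκ hD]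

end Coupling

/-! ### Oscillations under the transfer operator. -/

section Seminorm

variable {k d : ℕ} {θ : Set.Ioo (0 : ℝ) 1} {α : Set.Ioi (0 : ℝ)} {μ : Measure (SymbolSeq k)}
  {M : Fin k → GL (Fin d) ℝ}

theorem projDist_self (x : Proj d) : projDist x x = 0 := by
  refine Projectivization.ind (fun v hv => ?_) x
  have := (dot_self_pos hv).ne'
  rw [projDist_mk, sq, div_self (by positivity), sub_self, Real.sqrt_zero]

theorem seqDist_cons_le_mul (θ : Set.Ioo (0 : ℝ) 1) (i : Fin k) (ω ω' : SymbolSeq k) :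
    seqDist θ (consSeq i ω) (consSeq i ω') ≤ θ * seqDist θ ω ω' := by
  by_cases h : ω = ω'
  · simp [h, seqDist]
  have h' : consSeq i ω ≠ consSeq i ω' := fun e => h (congrArg shift e)
  simp only [seqDist, h, h', if_false]
  rw [← pow_succ']
  apply pow_le_pow_of_le_one θ.2.1.le θ.2.2.le
  by_contra hlt
  push Not at hlt
  set m := PiNat.firstDiff (consSeq i ω) (consSeq i ω') with hm
  have hne := PiNat.apply_firstDiff_ne h'
  rw [← hm] at hne
  cases hmm : m with
  | zero => rw [hmm] at hne; exact hne rfl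
  | succ j =>
    rw [hmm] at hne
    exact hne (PiNat.apply_eq_of_lt_firstDiff (x := ω) (y := ω') (by omega))

/-- Bounds on the oscillations of a function: in the projective variable, in the sequence when the
first symbol is fixed, and in the sequence without restriction. -/
structure OscBound (w : HolderSpace k d θ α) (a b c : ℝ) : Prop where
  proj : ∀ ω x y, ‖w (ω, x) - w (ω, y)‖ ≤ a * projDist x y ^ (α : ℝ)
  seq : ∀ ω ω' x, ω 0 = ω' 0 → ‖w (ω, x) - w (ω', x)‖ ≤ b * seqDist θ ω ω'
  osc : ∀ ω ω' x, ‖w (ω, x) - w (ω', x)‖ ≤ c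

theorem OscBound.mono {w : HolderSpace k d θ α} {a b c a' b' c' : ℝ} (h : OscBound w a b c)
    (ha : a ≤ a') (hb : b ≤ b') (hc : c ≤ c') : OscBound w a' b' c' where
  proj ω x y := (h.proj ω x y).trans
    (mul_le_mul_of_nonneg_right ha (Real.rpow_nonneg (projDist_nonneg _ _) _))
  seq ω ω' x h0 := (h.seq ω ω' x h0).trans
    (mul_le_mul_of_nonneg_right hb (seqDist_nonneg θ _ _))
  osc ω ω' x := (h.osc ω ω' x).trans hc

theorem oscBound_holderSeminorm (w : HolderSpace k d θ α) :
    OscBound w w.holderSeminorm w.holderSeminorm w.holderSeminorm := by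
  have h0 : ∀ (ω ω' : SymbolSeq k) (x : Proj d),
      ‖w (ω, x) - w (ω', x)‖ ≤ w.holderSeminorm * seqDist θ ω ω' := fun ω ω' x => by
    have := w.norm_sub_le (ω, x) (ω', x)
    rwa [pairDist, projDist_self, Real.zero_rpow (ne_of_gt α.2), zero_add] at this
  refine ⟨fun ω x y => ?_, fun ω ω' x _ => h0 ω ω' x, fun ω ω' x => (h0 ω ω' x).trans ?_⟩
  · have := w.norm_sub_le (ω, x) (ω, y)
    rwa [pairDist, seqDist, if_pos rfl, add_zero] at this
  · exact mul_le_of_le_one_right w.holderSeminorm_nonneg (seqDist_le_one θ _ _)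

/-- Sequences with different first symbols are at distance 1, so for them the plain oscillation
bound is already a Lipschitz bound. -/
theorem OscBound.holderSeminorm_le {w : HolderSpace k d θ α} {a b c A : ℝ} (h : OscBound w a b c)
    (hA : 0 ≤ A) (ha : a ≤ A) (hb : b ≤ A) (hc : c ≤ A) : w.holderSeminorm ≤ A := by
  have h' := h.mono ha hb hc
  refine HolderSpace.holderSeminorm_le _ hA ?_
  rintro ⟨ω, x⟩ ⟨ω', y⟩
  have e1 := h'.proj ω x y
  have e2 : ‖w (ω, y) - w (ω', y)‖ ≤ A * seqDist θ ω ω' := by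
    by_cases h0 : ω 0 = ω' 0
    · exact h'.seq ω ω' y h0
    · rw [seqDist_of_ne _ h0, mul_one]
      exact h'.osc ω ω' y
  calc ‖w (ω, x) - w (ω', y)‖ = ‖(w (ω, x) - w (ω, y)) + (w (ω, y) - w (ω', y))‖ := by
        rw [sub_add_sub_cancel]
    _ ≤ _ := norm_add_le _ _
    _ ≤ _ := add_le_add e1 e2
    _ = _ := by simp only [pairDist]; ring

theorem norm_transferOp_sub_le (w : HolderSpace k d θ α) (ω : SymbolSeq k) (x y : Proj d)
    {F : Fin k → ℝ} (h : ∀ i, ‖w (consSeq i ω, M i • x) - w (consSeq i ω, M i • y)‖ ≤ F i) :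
    ‖transferOp μ M θ α w (ω, x) - transferOp μ M θ α w (ω, y)‖ ≤
      ∑ i, transProb μ i (ω 0) * F i := by
  rw [transferOp_apply, transferOp_apply, ← Finset.sum_sub_distrib]
  refine norm_sum_le_of_le _ fun i _ => ?_
  rw [← mul_sub, norm_mul, Complex.norm_real, Real.norm_of_nonneg (transProb_nonneg _ _ _)]
  exact mul_le_mul_of_nonneg_left (h i) (transProb_nonneg _ _ _)

/-- The weights depend on ω only through its first symbol, so the variation in x is dominated by the
finite chain on symbols and pairs of points. Moment estimates for that chain enter here. -/
theorem norm_transferOp_pow_sub_le (w : HolderSpace k d θ α)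
    {F : Fin k → Proj d × Proj d → ℝ}
    (h : ∀ (ω : SymbolSeq k) x y, ‖w (ω, x) - w (ω, y)‖ ≤ F (ω 0) (x, y)) (n : ℕ)
    (ω : SymbolSeq k) (x y : Proj d) :
    ‖(transferOp μ M θ α ^ n) w (ω, x) - (transferOp μ M θ α ^ n) w (ω, y)‖ ≤
      (step (transProb μ) (pairAct M))^[n] F (ω 0) (x, y) := by
  induction n generalizing ω x y with
  | zero => exact h ω x y
  | succ n ih =>
    rw [pow_succ', Function.iterate_succ_apply']
    exact norm_transferOp_sub_le _ ω x y fun i => ih (consSeq i ω) (M i • x) (M i • y)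

/-- Equal first symbols give equal weights, and the sequences iω, iω' are closer by a factor θ. For
different first symbols the two weight vectors overlap by at least κ. On the overlap the same symbol
is prepended, at cost θ b; elsewhere the cost is at most a + c, projective space having diameter at
most 1. In the projective variable one step may expand. -/
theorem OscBound.transferOp (hμ : IsMarkovianFullShift μ) {w : HolderSpace k d θ α}
    {a b c C κ : ℝ} (h : OscBound w a b c) (ha : 0 ≤ a) (hb : 0 ≤ b) (hc : 0 ≤ c) (hC : 0 ≤ C)
    (hlip : ∀ i (x y : Proj d), projDist (M i • x) (M i • y) ≤ C * projDist x y)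
    (hκ : ∀ i j, κ ≤ transProb μ i j) :
    OscBound (transferOp μ M θ α w) (C ^ (α : ℝ) * a) (θ * b) (θ * b + (1 - κ) * (a + c)) where
  proj ω x y := by
    refine (norm_transferOp_sub_le w ω x y (F := fun _ =>
      C ^ (α : ℝ) * a * projDist x y ^ (α : ℝ)) fun i => ?_).trans_eq ?_
    · refine (h.proj _ _ _).trans ?_
      have := Real.rpow_le_rpow (projDist_nonneg _ _) (hlip i x y) (le_of_lt α.2)
      rw [Real.mul_rpow hC (projDist_nonneg _ _)] at this
      calc a * projDist (M i • x) (M i • y) ^ (α : ℝ) ≤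
            a * (C ^ (α : ℝ) * projDist x y ^ (α : ℝ)) := mul_le_mul_of_nonneg_left this ha
        _ = _ := by ring
    · rw [← Finset.sum_mul, hμ.sum_transProb, one_mul]
  seq ω ω' x h0 := by
    rw [transferOp_apply, transferOp_apply, ← Finset.sum_sub_distrib]
    have e : θ * b * seqDist θ ω ω' =
        ∑ i, transProb μ i (ω 0) * (θ * b * seqDist θ ω ω') := by
      rw [← Finset.sum_mul, hμ.sum_transProb, one_mul]
    rw [e]
    refine norm_sum_le_of_le _ fun i _ => ?_
    have h0' : (ω, x).1 0 = (ω', x).1 0 := h0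
    rw [← h0', ← mul_sub, norm_mul, Complex.norm_real, Real.norm_of_nonneg (transProb_nonneg _ _ _)]
    refine mul_le_mul_of_nonneg_left ?_ (transProb_nonneg _ _ _)
    refine (h.seq (consSeq i ω) (consSeq i ω') (M i • x) rfl).trans ?_
    have := mul_le_mul_of_nonneg_left (seqDist_cons_le_mul θ i ω ω') hb
    linarith
  osc ω ω' x := by
    rw [transferOp_apply, transferOp_apply]
    refine norm_average_sub_le (fun i => transProb_nonneg _ _ _) (fun i => transProb_nonneg _ _ _)
      (hμ.sum_transProb _) (hμ.sum_transProb _) ?_ (mul_nonneg θ.2.1.le hb) (add_nonneg ha hc) ?_ ?_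
    · refine le_trans (le_min (hκ (ω 0) _) (hκ (ω 0) _)) (Finset.single_le_sum
        (f := fun i => min (transProb μ i (ω 0)) (transProb μ i (ω' 0)))
        (fun i _ => le_min (transProb_nonneg _ _ _) (transProb_nonneg _ _ _))
        (Finset.mem_univ (ω 0)))
    · intro i
      refine (h.seq (consSeq i ω) (consSeq i ω') (M i • x) rfl).trans ?_
      have h1 := seqDist_cons_le_mul θ i ω ω'
      have h2 := mul_le_of_le_one_right θ.2.1.le (seqDist_le_one θ ω ω')
      rw [mul_comm]
      exact mul_le_mul_of_nonneg_right (h1.trans h2) hb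
    · intro i l
      have h1 := h.proj (consSeq i ω) (M i • x) (M l • x)
      have h2 := h.osc (consSeq i ω) (consSeq l ω') (M l • x)
      have h3 := Real.rpow_le_one (projDist_nonneg (M i • x) (M l • x)) (projDist_le_one _ _)
        (le_of_lt α.2)
      calc ‖w (consSeq i ω, M i • x) - w (consSeq l ω', M l • x)‖
          = ‖(w (consSeq i ω, M i • x) - w (consSeq i ω, M l • x)) +
              (w (consSeq i ω, M l • x) - w (consSeq l ω', M l • x))‖ := by rw [sub_add_sub_cancel]
        _ ≤ _ := norm_add_le _ _
        _ ≤ a + c := add_le_add (h1.trans (mul_le_of_le_one_right ha h3)) h2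

/-- The bounds are triangular. Only the factors θ and 1 - κ on the diagonal matter, and they survive
any positive number of steps; all other contributions go into a crude constant K. -/
theorem exists_oscBound_pow (hμ : IsMarkovianFullShift μ) (M : Fin k → GL (Fin d) ℝ)
    (θ : Set.Ioo (0 : ℝ) 1) (α : Set.Ioi (0 : ℝ)) {κ : ℝ} (hκ0 : 0 ≤ κ) (hκ1 : κ ≤ 1)
    (hκ : ∀ i j, κ ≤ transProb μ i j) (n : ℕ) :
    ∃ K : ℝ, 0 ≤ K ∧ ∀ (w : HolderSpace k d θ α) (a b c : ℝ), 0 ≤ a → 0 ≤ b → 0 ≤ c →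
      OscBound w a b c → OscBound ((transferOp μ M θ α ^ (n + 1)) w) (K * a) (θ * b)
        ((1 - κ) * c + K * (a + b)) := by
  obtain ⟨C, hC1, hlip⟩ := exists_common_lipschitz M
  have hC : 0 ≤ C := zero_le_one.trans hC1
  have hCα : 0 ≤ C ^ (α : ℝ) := Real.rpow_nonneg hC _
  have hθ0 := θ.2.1
  have hθ1 := θ.2.2
  induction n with
  | zero =>
    refine ⟨C ^ (α : ℝ) + 1, by positivity, fun w a b c ha hb hc h => ?_⟩
    rw [zero_add, pow_one]
    refine (h.transferOp hμ ha hb hc hC hlip hκ).mono ?_ le_rfl ?_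
    · nlinarith
    · nlinarith [mul_nonneg hκ0 ha, mul_nonneg hCα (add_nonneg ha hb),
        mul_le_mul_of_nonneg_right hθ1.le hb]
  | succ n ih =>
    obtain ⟨K, hK, h⟩ := ih
    refine ⟨C ^ (α : ℝ) * K + 1 + 2 * K, by positivity, fun w a b c ha hb hc hw => ?_⟩
    have h1 := h w a b c ha hb hc hw
    have hκ' : 0 ≤ 1 - κ := sub_nonneg.2 hκ1
    have hc' : 0 ≤ (1 - κ) * c + K * (a + b) := by positivity
    have hKa : 0 ≤ K * a := mul_nonneg hK ha
    have hKb : 0 ≤ K * b := mul_nonneg hK hb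
    have hθb : 0 ≤ θ * b := mul_nonneg hθ0.le hb
    have hθb1 : θ * b ≤ b := mul_le_of_le_one_left hb hθ1.le
    have hθθb : θ * (θ * b) ≤ θ * b := mul_le_of_le_one_left hθb hθ1.le
    rw [pow_succ']
    refine (h1.transferOp hμ hKa hθb hc' hC hlip hκ).mono ?_ hθθb ?_
    · have : 0 ≤ (1 + 2 * K) * a := by positivity
      nlinarith
    · have e1 : (1 - κ) * (K * a + ((1 - κ) * c + K * (a + b))) ≤
          (1 - κ) * c + (K * a + K * (a + b)) := by
        have h2 : (1 - κ) * (K * a + K * (a + b)) ≤ K * a + K * (a + b) :=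
          mul_le_of_le_one_left (by positivity) (by linarith)
        have h3 : (1 - κ) * ((1 - κ) * c) ≤ (1 - κ) * c :=
          mul_le_of_le_one_left (by positivity) (by linarith)
        linarith
      have e2 : 0 ≤ C ^ (α : ℝ) * K * (a + b) := by positivity
      nlinarith

/-- The Hölder seminorm is contracted exponentially. -/
theorem exists_holderSeminorm_contraction (hμ : IsMarkovianFullShift μ)
    (θ : Set.Ioo (0 : ℝ) 1) (α : Set.Ioi (0 : ℝ))
    (hmom : ∃ n, ∀ j p, (step (transProb μ) (pairAct M))^[n] (distPow k d α) j p ≤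
      3 / 4 * projDist p.1 p.2 ^ (α : ℝ)) :
    ∃ (N : ℕ) (B ρ : ℝ), 0 ≤ ρ ∧ ρ < 1 ∧ 0 ≤ B ∧ 0 < N ∧ ∀ (m : ℕ) (w : HolderSpace k d θ α),
      ((transferOp μ M θ α ^ (N * m)) w).holderSeminorm ≤ B * ρ ^ m * w.holderSeminorm := by
  have := hμ.isProbability
  obtain ⟨ω₀⟩ := nonempty_of_isProbabilityMeasure μ
  -- At least one step is needed to gain the factors θ and 1 - κ. A contraction after zero steps
  -- would force all distances to vanish, and then one step contracts as well.
  have hmom' : ∃ n, ∀ j p, (step (transProb μ) (pairAct M))^[n + 1] (distPow k d α) j p ≤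
      3 / 4 * projDist p.1 p.2 ^ (α : ℝ) := by
    obtain ⟨n, hn⟩ := hmom
    cases n with
    | succ n => exact ⟨n, hn⟩
    | zero =>
      have h0 : ∀ p : Proj d × Proj d, projDist p.1 p.2 ^ (α : ℝ) ≤ 0 := fun p => by
        have : projDist p.1 p.2 ^ (α : ℝ) ≤ 3 / 4 * projDist p.1 p.2 ^ (α : ℝ) := hn (ω₀ 0) p
        linarith
      refine ⟨0, fun j p => ?_⟩
      have h1 : step (transProb μ) (pairAct M) (distPow k d α) j p ≤ 0 :=
        Finset.sum_nonpos fun i _ =>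
          mul_nonpos_of_nonneg_of_nonpos (transProb_nonneg _ _ _) (h0 _)
      exact h1.trans (mul_nonneg (by norm_num) (Real.rpow_nonneg (projDist_nonneg _ _) _))
  obtain ⟨n, hn⟩ := hmom'
  obtain ⟨κ, hκ0, hκ⟩ : ∃ κ : ℝ, 0 < κ ∧ ∀ i j, κ ≤ transProb μ i j := by
    have : Nonempty (Fin k × Fin k) := ⟨(ω₀ 0, ω₀ 0)⟩
    obtain ⟨p, hp⟩ := Finite.exists_min fun p : Fin k × Fin k => transProb μ p.1 p.2
    exact ⟨_, hμ.transProb_pos p.1 p.2, fun i j => hp (i, j)⟩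
  have hκ1 : κ ≤ 1 := (hκ (ω₀ 0) (ω₀ 0)).trans (transProb_le_one _ _ _)
  obtain ⟨K, hK, hpow⟩ := exists_oscBound_pow (d := d) hμ M θ α hκ0.le hκ1 hκ n
  set ρ : ℝ := max (3 / 4) (max θ (1 - κ / 2)) with hρ
  have hρ0 : 0 ≤ ρ := le_max_of_le_left (by norm_num)
  have hρ1 : ρ < 1 := max_lt (by norm_num) (max_lt θ.2.2 (by linarith))
  -- The oscillation is allowed a larger weight Λ, so that the contribution 2K A of the other two
  -- bounds costs at most half of the gain κ Λ A.
  set Λ : ℝ := 1 + 4 * K / κ with hΛ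
  have hΛ1 : 1 ≤ Λ := le_add_of_nonneg_right (by positivity)
  have hΛK : 2 * K ≤ κ / 2 * Λ := by
    rw [hΛ]
    field_simp
    nlinarith
  have hstep : ∀ (w : HolderSpace k d θ α) (A : ℝ), 0 ≤ A → OscBound w A A (Λ * A) →
      OscBound ((transferOp μ M θ α ^ (n + 1)) w) (ρ * A) (ρ * A) (Λ * (ρ * A)) := by
    intro w A hA h
    have h1 := hpow w A A (Λ * A) hA hA (by positivity) h
    refine ⟨fun ω x y => ?_, (h1.mono le_rfl ?_ le_rfl).seq, (h1.mono le_rfl le_rfl ?_).osc⟩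
    -- The crude constant K is replaced here by the factor 3/4 from the contraction of moments.
    · have h2 := norm_transferOp_pow_sub_le (μ := μ) (M := M) w (F := A • distPow k d α)
        h.proj (n + 1) ω x y
      rw [step_iterate_smul] at h2
      refine h2.trans ?_
      have h3 := mul_le_mul_of_nonneg_left (hn (ω 0) (x, y)) hA
      have h4 : 3 / 4 ≤ ρ := le_max_left _ _
      have h5 : 0 ≤ A * projDist x y ^ (α : ℝ) :=
        mul_nonneg hA (Real.rpow_nonneg (projDist_nonneg _ _) _)
      refine h3.trans ?_
      nlinarith
    · exact mul_le_mul_of_nonneg_right ((le_max_left _ _).trans (le_max_right _ _)) hA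
    · have h4 : 1 - κ / 2 ≤ ρ := (le_max_right _ _).trans (le_max_right _ _)
      have h5 := mul_le_mul_of_nonneg_right hΛK hA
      have h6 := mul_le_mul_of_nonneg_right h4 (by positivity : 0 ≤ Λ * A)
      linarith
  refine ⟨n + 1, Λ, ρ, hρ0, hρ1, by positivity, Nat.succ_pos n, fun m w => ?_⟩
  set h := w.holderSeminorm with hh
  have hh0 : 0 ≤ h := w.holderSeminorm_nonneg
  have key : OscBound ((transferOp μ M θ α ^ ((n + 1) * m)) w) (ρ ^ m * h) (ρ ^ m * h)
      (Λ * (ρ ^ m * h)) := by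
    induction m with
    | zero =>
      simp only [mul_zero, pow_zero, one_mul, one_apply_eq_self]
      exact (oscBound_holderSeminorm w).mono le_rfl le_rfl (le_mul_of_one_le_left hh0 hΛ1)
    | succ m ih =>
      rw [Nat.mul_succ, add_comm, pow_add, pow_succ' ρ, mul_assoc ρ]
      exact hstep _ _ (by positivity) ih
  have hA : 0 ≤ ρ ^ m * h := by positivity
  have hle : ρ ^ m * h ≤ Λ * (ρ ^ m * h) := le_mul_of_one_le_left hA hΛ1
  rw [mul_assoc]
  exact key.holderSeminorm_le (hA.trans hle) hle hle le_rfl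

end Seminorm

/-! ### The dual of the transfer operator -/

section DualTransfer

theorem map_withDensity_comp {X Y : Type*} [MeasurableSpace X] [MeasurableSpace Y] {f : X → Y}
    (hf : Measurable f) {p : Y → ENNReal} (hp : Measurable p) (m : Measure X) :
    (m.withDensity fun x => p (f x)).map f = (m.map f).withDensity p := by
  ext s hs
  rw [Measure.map_apply hf hs, withDensity_apply _ (hf hs), withDensity_apply _ hs,
    setLIntegral_map hs hp hf]

variable {k : ℕ} {Y Z : Type*} [MeasurableSpace Y] [MeasurableSpace Z]
  {μ : Measure (SymbolSeq k)}

/-- The dual of the transfer operator acting on measures. -/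
def dualStep (μ : Measure (SymbolSeq k)) (F : Fin k → Y → Y) (m : Measure (SymbolSeq k × Y)) :
    Measure (SymbolSeq k × Y) :=
  ∑ i, (m.withDensity fun a => ENNReal.ofReal (transProb μ i (a.1 0))).map
    fun a => (consSeq i a.1, F i a.2)

theorem measurable_weight (μ : Measure (SymbolSeq k)) (i : Fin k) :
    Measurable fun a : SymbolSeq k × Y => ENNReal.ofReal (transProb μ i (a.1 0)) :=
  (measurable_transProb_zero μ i).comp measurable_fst

theorem measurable_branch {F : Fin k → Y → Y} (hF : ∀ i, Measurable (F i)) (i : Fin k) :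
    Measurable fun a : SymbolSeq k × Y => (consSeq i a.1, F i a.2) :=
  ((continuous_consSeq i).measurable.comp measurable_fst).prodMk ((hF i).comp measurable_snd)

theorem IsMarkovianFullShift.sum_withDensity (hμ : IsMarkovianFullShift μ)
    (m : Measure (SymbolSeq k × Y)) :
    ∑ i, m.withDensity (fun a => ENNReal.ofReal (transProb μ i (a.1 0))) = m := by
  ext s hs
  rw [Measure.finsetSum_apply]
  simp only [withDensity_apply _ hs]
  rw [← lintegral_finsetSum _ fun i _ => measurable_weight μ i]
  simp [hμ.sum_ofReal_transProb]

theorem _root_.MeasureTheory.Measure.map_finsetSum {ι X Y : Type*} [MeasurableSpace X]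
    [MeasurableSpace Y] {f : X → Y} (hf : Measurable f) (s : Finset ι) (m : ι → Measure X) :
    (∑ i ∈ s, m i).map f = ∑ i ∈ s, (m i).map f := by
  ext t ht
  simp only [Measure.map_apply hf ht, Measure.finsetSum_apply]

/-- A map inverting all branches preserves every measure fixed by the dual transfer operator. -/
theorem IsMarkovianFullShift.map_dualStep (hμ : IsMarkovianFullShift μ) {F : Fin k → Y → Y}
    (hF : ∀ i, Measurable (F i)) {Ψ : SymbolSeq k × Y → SymbolSeq k × Y} (hΨ : Measurable Ψ)
    (h : ∀ i a, Ψ (consSeq i a.1, F i a.2) = a) (m : Measure (SymbolSeq k × Y)) :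
    (dualStep μ F m).map Ψ = m := by
  rw [dualStep, Measure.map_finsetSum hΨ]
  conv_rhs => rw [← hμ.sum_withDensity m]
  refine Finset.sum_congr rfl fun i _ => ?_
  rw [Measure.map_map hΨ (measurable_branch hF i)]
  have : (Ψ ∘ fun a : SymbolSeq k × Y => (consSeq i a.1, F i a.2)) = id := funext (h i)
  rw [this, Measure.map_id]

theorem IsMarkovianFullShift.map_fst_dualStep (hμ : IsMarkovianFullShift μ) {F : Fin k → Y → Y}
    (hF : ∀ i, Measurable (F i)) {m : Measure (SymbolSeq k × Y)} (hm : m.map Prod.fst = μ) :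
    (dualStep μ F m).map Prod.fst = μ := by
  rw [dualStep, Measure.map_finsetSum measurable_fst]
  conv_rhs => rw [← hμ.sum_map_cons]
  refine Finset.sum_congr rfl fun i _ => ?_
  rw [Measure.map_map measurable_fst (measurable_branch hF i)]
  have : (Prod.fst ∘ fun a : SymbolSeq k × Y => (consSeq i a.1, F i a.2)) =
      consSeq i ∘ Prod.fst := rfl
  rw [this, ← Measure.map_map (continuous_consSeq i).measurable measurable_fst]
  congr 1
  have := map_withDensity_comp (Y := SymbolSeq k) measurable_fst (measurable_transProb_zero μ i) m
  rw [this, hm]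

/-- Serves to push a fixed measure from the unit sphere down to projective space. -/
theorem map_dualStep_of_semiconj {F : Fin k → Y → Y} (hF : ∀ i, Measurable (F i))
    {G : Fin k → Z → Z} (hG : ∀ i, Measurable (G i)) {h : Y → Z} (hh : Measurable h)
    (hFG : ∀ i y, h (F i y) = G i (h y)) (m : Measure (SymbolSeq k × Y)) :
    (dualStep μ F m).map (Prod.map id h) = dualStep μ G (m.map (Prod.map id h)) := by
  have hm : Measurable (Prod.map id h : SymbolSeq k × Y → SymbolSeq k × Z) :=
    measurable_id.prodMap hh
  rw [dualStep, dualStep, Measure.map_finsetSum hm]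
  refine Finset.sum_congr rfl fun i _ => ?_
  rw [← map_withDensity_comp hm (measurable_weight μ i), Measure.map_map hm (measurable_branch hF i),
    Measure.map_map (measurable_branch hG i) hm]
  congr 1
  funext a
  exact Prod.ext rfl (hFG i a.2)

theorem isProbabilityMeasure_dualStep (hμ : IsMarkovianFullShift μ) {F : Fin k → Y → Y}
    (hF : ∀ i, Measurable (F i)) (m : Measure (SymbolSeq k × Y)) [IsProbabilityMeasure m] :
    IsProbabilityMeasure (dualStep μ F m) := by
  constructor
  have h := congrArg (fun m' : Measure (SymbolSeq k × Y) => m' Set.univ) (hμ.sum_withDensity m)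
  simp only [Measure.finsetSum_apply] at h
  rw [measure_univ] at h
  rw [dualStep, Measure.finsetSum_apply, ← h]
  refine Finset.sum_congr rfl fun i _ => ?_
  rw [Measure.map_apply (measurable_branch hF i) MeasurableSet.univ, Set.preimage_univ]

theorem integral_dualStep {E : Type*} [NormedAddCommGroup E] [NormedSpace ℝ E]
    {F : Fin k → Y → Y} (hF : ∀ i, Measurable (F i)) (m : Measure (SymbolSeq k × Y))
    [IsFiniteMeasure m] {w : SymbolSeq k × Y → E} (hw : StronglyMeasurable w) {B : ℝ}
    (hB : ∀ a, ‖w a‖ ≤ B) :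
    ∫ a, w a ∂dualStep μ F m =
      ∑ i, ∫ a, transProb μ i (a.1 0) • w (consSeq i a.1, F i a.2) ∂m := by
  have hfin : ∀ i, IsFiniteMeasure (m.withDensity fun a : SymbolSeq k × Y =>
      ENNReal.ofReal (transProb μ i (a.1 0))) := fun i => by
    refine isFiniteMeasure_withDensity ?_
    refine ne_top_of_le_ne_top (measure_ne_top m Set.univ) ?_
    refine (lintegral_mono (g := fun _ => 1) fun a => ?_).trans (by simp)
    exact ENNReal.ofReal_le_one.2 (transProb_le_one _ _ _)
  rw [dualStep, integral_finsetSum_measure]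
  · refine Finset.sum_congr rfl fun i _ => ?_
    rw [integral_map (measurable_branch hF i).aemeasurable hw.aestronglyMeasurable,
      integral_withDensity_eq_integral_toReal_smul (measurable_weight μ i)
        (Eventually.of_forall fun _ => ENNReal.ofReal_lt_top)]
    refine integral_congr_ae (Eventually.of_forall fun a => ?_)
    simp only [ENNReal.toReal_ofReal (transProb_nonneg _ _ _)]
  · intro i _
    have := hfin i
    exact Integrable.of_bound hw.aestronglyMeasurable B (Eventually.of_forall hB)

end DualTransfer

/-! ### Fixed points of the dual transfer operator on a compact metrizable fibre. -/

section Stationary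

variable {k : ℕ} {Y : Type*} [TopologicalSpace Y] [CompactSpace Y] [TopologicalSpace.MetrizableSpace Y]
  [MeasurableSpace Y] [BorelSpace Y] {μ : Measure (SymbolSeq k)}

/-- A Cesàro limit of the iterates of μ ⊗ δ. Each iterate has marginal μ, hence so does the limit.
The weights are continuous because they depend on one symbol only. -/
theorem IsMarkovianFullShift.exists_dualStep_eq (hμ : IsMarkovianFullShift μ) {F : Fin k → Y → Y}
    (hF : ∀ i, Continuous (F i)) (y₀ : Y) :
    ∃ m : ProbabilityMeasure (SymbolSeq k × Y),
      dualStep μ F (m : Measure (SymbolSeq k × Y)) = m ∧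
        (m : Measure (SymbolSeq k × Y)).map Prod.fst = μ := by
  have := hμ.isProbability
  let _ := TopologicalSpace.metrizableSpaceMetric Y
  have : SecondCountableTopology Y := inferInstance
  have : BorelSpace (SymbolSeq k × Y) := inferInstance
  have hFm : ∀ i, Measurable (F i) := fun i => (hF i).measurable
  let S : ProbabilityMeasure (SymbolSeq k × Y) → ProbabilityMeasure (SymbolSeq k × Y) := fun m =>
    ⟨dualStep μ F m, isProbabilityMeasure_dualStep hμ hFm m⟩
  have hG : ∀ i, Continuous fun a : SymbolSeq k × Y => (consSeq i a.1, F i a.2) := fun i =>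
    ((continuous_consSeq i).comp continuous_fst).prodMk ((hF i).comp continuous_snd)
  have hp : ∀ i, Continuous fun a : SymbolSeq k × Y => transProb μ i (a.1 0) := fun i =>
    (continuous_of_discreteTopology (f := transProb μ i)).comp
      ((continuous_apply 0).comp continuous_fst)
  have hS : ∀ (m : ProbabilityMeasure (SymbolSeq k × Y)) (f : C(SymbolSeq k × Y, ℝ)),
      ∫ x, f x ∂(S m : Measure (SymbolSeq k × Y)) =
      ∑ i, ∫ x, ((⟨_, hp i⟩ : C(SymbolSeq k × Y, ℝ)) * f.comp ⟨_, hG i⟩) x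
        ∂(m : Measure (SymbolSeq k × Y)) := fun m f =>
    integral_dualStep hFm (m : Measure (SymbolSeq k × Y)) f.continuous.stronglyMeasurable
      f.norm_coe_le_norm
  let m₀ : ProbabilityMeasure (SymbolSeq k × Y) := ⟨μ.prod (Measure.dirac y₀), inferInstance⟩
  let a : ℕ → Unit → ProbabilityMeasure (SymbolSeq k × Y) := fun n _ => S^[n] m₀
  have ha : ∀ t j, a (t + 1) j = S (a t j) := fun t _ => Function.iterate_succ_apply' S t m₀
  have hmarg : ∀ t, (a t () : Measure (SymbolSeq k × Y)).map Prod.fst = μ := fun t => by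
    induction t with
    | zero =>
      show (μ.prod (Measure.dirac y₀)).map Prod.fst = μ
      rw [Measure.map_fst_prod]
      simp
    | succ t ih =>
      rw [ha t ()]
      exact hμ.map_fst_dualStep hFm ih
  obtain ⟨ν, hν1, hν2⟩ := exists_cesaro_limit a
  refine ⟨ν (), ?_, ?_⟩
  · have : IsProbabilityMeasure (dualStep μ F (ν () : Measure (SymbolSeq k × Y))) := (S (ν ())).2
    refine ext_of_forall_integral_eq_of_IsFiniteMeasure fun f => ?_
    have h1 := hν1 () f.toContinuousMap
      (fun i => (⟨_, hp i⟩ : C(SymbolSeq k × Y, ℝ)) * f.toContinuousMap.comp ⟨_, hG i⟩) (fun _ => ())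
      fun t => by rw [ha t (), hS]
    exact (hS (ν ()) f.toContinuousMap).trans h1.symm
  · have := Measure.isProbabilityMeasure_map (μ := (ν () : Measure (SymbolSeq k × Y)))
      measurable_fst.aemeasurable
    refine ext_of_forall_integral_eq_of_IsFiniteMeasure fun f => ?_
    rw [integral_map measurable_fst.aemeasurable f.continuous.measurable.aestronglyMeasurable]
    refine hν2 () (f.toContinuousMap.comp ⟨Prod.fst, continuous_fst⟩) _ fun t => ?_
    conv_rhs => rw [← hmarg t]
    rw [integral_map measurable_fst.aemeasurable f.continuous.measurable.aestronglyMeasurable]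
    rfl

end Stationary

/-! ### The invariant measure ν₀ and the algebra of its mean operator. -/

section Invariant

variable {k d : ℕ} {μ : Measure (SymbolSeq k)} {M : Fin k → GL (Fin d) ℝ}

theorem continuous_GL_smul (g : GL (Fin d) ℝ) : Continuous fun x : Proj d => g • x := by
  refine continuous_coinduced_dom.2 ?_
  have h : Continuous fun v : {v : Fin d → ℝ // v ≠ 0} =>
      (⟨(g : Matrix (Fin d) (Fin d) ℝ) *ᵥ v.1, mulVec_GL_ne_zero g v.2⟩ : {v : Fin d → ℝ // v ≠ 0}) :=
    Continuous.subtype_mk (continuous_const.matrix_mulVec continuous_subtype_val) _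
  exact continuous_coinduced_rng.comp h

theorem continuous_mk_unitVec :
    Continuous fun v : UnitVec d => (Projectivization.mk ℝ v.1 v.ne_zero : Proj d) := by
  have h : Continuous fun v : UnitVec d => (⟨v.1, v.ne_zero⟩ : {v : Fin d → ℝ // v ≠ 0}) :=
    Continuous.subtype_mk continuous_subtype_val _
  exact continuous_coinduced_rng.comp h

theorem measurable_skewProduct (M : Fin k → GL (Fin d) ℝ) : Measurable (skewProduct M) := by
  have h1 : Measurable fun a : SymbolSeq k × Proj d => shift a.1 := measurable_shift.comp measurable_fst
  have h : Measurable (Function.uncurry fun (i : Fin k) (x : Proj d) => (M i)⁻¹ • x) :=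
    measurable_from_prod_countable_right fun i => (continuous_GL_smul (M i)⁻¹).measurable
  have h2 : Measurable fun a : SymbolSeq k × Proj d => (a.1 0, a.2) :=
    ((measurable_pi_apply 0).comp measurable_fst).prodMk measurable_snd
  exact h1.prodMk (h.comp h2)

/-- There is an invariant measure fixed by the dual of the transfer operator. -/
theorem IsMarkovianFullShift.exists_invariantMeasure (hμ : IsMarkovianFullShift μ) (hd : 0 < d)
    (M : Fin k → GL (Fin d) ℝ) :
    ∃ ν : ProbabilityMeasure (SymbolSeq k × Proj d), IsInvariantMeasure μ M ν ∧
      dualStep μ (fun i x => M i • x) (ν : Measure (SymbolSeq k × Proj d)) = ν := by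
  -- The fixed measure is found on the unit sphere, which is compact and metrizable, and then
  -- projected.
  let F : Fin k → UnitVec d → UnitVec d := fun i v =>
    unitOf ((M i : Matrix (Fin d) (Fin d) ℝ) *ᵥ v.1) (mulVec_GL_ne_zero (M i) v.ne_zero)
  have hF : ∀ i, Continuous (F i) := fun i =>
    continuous_unitOf (continuous_const.matrix_mulVec continuous_subtype_val) _
  obtain ⟨v₀⟩ := exists_unitVec hd
  obtain ⟨m, hm, hm'⟩ := hμ.exists_dualStep_eq hF v₀
  have hG : ∀ i, Measurable fun x : Proj d => M i • x := fun i => (continuous_GL_smul (M i)).measurable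
  have hh := (continuous_mk_unitVec (d := d)).measurable
  have hq : Measurable (Prod.map id (fun v : UnitVec d => (Projectivization.mk ℝ v.1 v.ne_zero : Proj d)) :
      SymbolSeq k × UnitVec d → SymbolSeq k × Proj d) := measurable_id.prodMap hh
  let ν : ProbabilityMeasure (SymbolSeq k × Proj d) :=
    ⟨_, Measure.isProbabilityMeasure_map (μ := (m : Measure (SymbolSeq k × UnitVec d))) hq.aemeasurable⟩
  have hν : (ν : Measure (SymbolSeq k × Proj d)) = (m : Measure (SymbolSeq k × UnitVec d)).map
    (Prod.map id fun v : UnitVec d => (Projectivization.mk ℝ v.1 v.ne_zero : Proj d)) := rfl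
  have hfix : dualStep μ (fun i x => M i • x) (ν : Measure (SymbolSeq k × Proj d)) = ν := by
    rw [hν, ← map_dualStep_of_semiconj (fun i => (hF i).measurable) hG hh, hm]
    intro i v
    obtain ⟨c, hc, he⟩ := exists_unitOf_eq ((M i : Matrix (Fin d) (Fin d) ℝ) *ᵥ v.1)
      (mulVec_GL_ne_zero (M i) v.ne_zero)
    rw [Projectivization.smul_mk, Projectivization.mk_eq_mk_iff']
    exact ⟨c, he.symm⟩
  refine ⟨ν, ⟨⟨measurable_skewProduct M, ?_⟩, ?_⟩, hfix⟩
  -- The skew product undoes every branch (ω, x) ↦ (iω, M_i x), so it preserves each measure fixed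
  -- by the dual operator.
  · conv_lhs => rw [← hfix]
    refine hμ.map_dualStep hG (measurable_skewProduct M) (fun i a => ?_) _
    exact Prod.ext rfl (inv_smul_smul (M i) a.2)
  · rw [hν, Measure.map_map measurable_fst hq]
    exact hm'

variable {θ : Set.Ioo (0 : ℝ) 1} {α : Set.Ioi (0 : ℝ)}

theorem integral_transferOp {ν : ProbabilityMeasure (SymbolSeq k × Proj d)}
    (hν : dualStep μ (fun i x => M i • x) (ν : Measure (SymbolSeq k × Proj d)) = ν)
    (w : HolderSpace k d θ α) :
    ∫ a, transferOp μ M θ α w a ∂(ν : Measure (SymbolSeq k × Proj d)) =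
      ∫ a, w a ∂(ν : Measure (SymbolSeq k × Proj d)) := by
  conv_rhs => rw [← hν]
  rw [integral_dualStep (fun i => (continuous_GL_smul (M i)).measurable) _
    w.continuous.measurable.stronglyMeasurable w.norm_apply_le, ← integral_finsetSum]
  · rfl
  · intro i _
    refine Integrable.of_bound (C := w.supNorm) ?_ (Eventually.of_forall fun a => ?_)
    · have h0 : Measurable fun a : SymbolSeq k × Proj d => a.1 0 :=
        (measurable_pi_apply 0).comp measurable_fst
      have h1 : AEStronglyMeasurable (fun a : SymbolSeq k × Proj d => transProb μ i (a.1 0))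
          (ν : Measure (SymbolSeq k × Proj d)) :=
        ((measurable_of_countable (transProb μ i)).comp h0).aestronglyMeasurable
      exact h1.smul (w.continuous.measurable.comp (measurable_branch
        (fun i => (continuous_GL_smul (M i)).measurable) i)).aestronglyMeasurable
    · rw [norm_smul, Real.norm_of_nonneg (transProb_nonneg _ _ _)]
      exact (mul_le_of_le_one_left (norm_nonneg _) (transProb_le_one _ _ _)).trans
        (w.norm_apply_le _)

theorem meanOp_mul_transferOp {ν : ProbabilityMeasure (SymbolSeq k × Proj d)}
    (hν : dualStep μ (fun i x => M i • x) (ν : Measure (SymbolSeq k × Proj d)) = ν) :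
    meanOp ν θ α * transferOp μ M θ α = meanOp ν θ α := by
  ext w a
  exact integral_transferOp hν w

theorem IsMarkovianFullShift.transferOp_mul_meanOp (hμ : IsMarkovianFullShift μ)
    (M : Fin k → GL (Fin d) ℝ) (ν : ProbabilityMeasure (SymbolSeq k × Proj d)) :
    transferOp μ M θ α * meanOp ν θ α = meanOp ν θ α := by
  ext w a
  show transferOp μ M θ α (meanOp ν θ α w) a = _
  rw [transferOp_apply]
  simp only [meanOp_apply]
  rw [← Finset.sum_mul, ← Complex.ofReal_sum, hμ.sum_transProb, Complex.ofReal_one, one_mul]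

theorem meanOp_mul_meanOp (ν : ProbabilityMeasure (SymbolSeq k × Proj d)) :
    meanOp ν θ α * meanOp ν θ α = meanOp ν θ α := by
  ext w a
  show ∫ b, meanOp ν θ α w b ∂(ν : Measure (SymbolSeq k × Proj d)) = _
  simp

end Invariant

/-! ### Operators whose powers converge in norm to a projection -/

section PowersConverge

variable {E : Type*} [NormedAddCommGroup E] [NormedSpace ℂ E] {L Q : E →L[ℂ] E}

theorem pow_succ_sub_of_absorb (hQL : Q * L = Q) (hLQ : L * Q = Q) (hQ : Q * Q = Q) (n : ℕ) :
    (L - Q) ^ (n + 1) = L ^ (n + 1) - Q := by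
  have h : ∀ n, L ^ n * Q = Q := fun n => by
    induction n with
    | zero => rw [pow_zero, one_mul]
    | succ n ih => rw [pow_succ, mul_assoc, hLQ, ih]
  induction n with
  | zero => simp
  | succ n ih =>
    rw [pow_succ, ih, pow_succ L (n + 1), mul_sub, sub_mul, sub_mul, hQL, hQ, h (n + 1)]
    abel

/-- The factorisation z - L = (z - (L - Q)) (1 - z⁻¹ Q) holds, and since Q is idempotent the last
factor has inverse 1 + (z - 1)⁻¹ Q. So away from 0 and 1 the spectrum of L lies in that of L - Q. -/
theorem isUnit_sub_of_absorb (hLQ : L * Q = Q) (hQ : Q * Q = Q) {z : ℂ}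
    (h0 : z ≠ 0) (h1 : z ≠ 1) (hz : IsUnit (algebraMap ℂ (E →L[ℂ] E) z - (L - Q))) :
    IsUnit (algebraMap ℂ (E →L[ℂ] E) z - L) := by
  have h1' : z - 1 ≠ 0 := sub_ne_zero.2 h1
  have e1 : (1 - z⁻¹ • Q) * (1 + (z - 1)⁻¹ • Q) = 1 := by
    rw [sub_mul, one_mul, mul_add, mul_one, smul_mul_smul_comm, hQ, add_sub_assoc, ← add_smul,
      ← sub_smul]
    have : (z - 1)⁻¹ - (z⁻¹ + z⁻¹ * (z - 1)⁻¹) = 0 := by field_simp; ring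
    rw [this, zero_smul, add_zero]
  have e2 : (1 + (z - 1)⁻¹ • Q) * (1 - z⁻¹ • Q) = 1 := by
    rw [mul_sub, mul_one, add_mul, one_mul, smul_mul_smul_comm, hQ, add_sub_assoc, ← add_smul,
      ← sub_smul]
    have : (z - 1)⁻¹ - (z⁻¹ + (z - 1)⁻¹ * z⁻¹) = 0 := by field_simp; ring
    rw [this, zero_smul, add_zero]
  have hu : IsUnit (1 - z⁻¹ • Q) := ⟨⟨_, _, e1, e2⟩, rfl⟩
  have e3 : algebraMap ℂ (E →L[ℂ] E) z - L =
      (algebraMap ℂ (E →L[ℂ] E) z - (L - Q)) * (1 - z⁻¹ • Q) := by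
    rw [mul_sub, mul_one, mul_smul_comm, sub_mul, sub_mul, hLQ, hQ, sub_self, sub_zero,
      ← Algebra.smul_def, smul_smul, inv_mul_cancel₀ h0, one_smul]
    abel
  rw [e3]
  exact hz.mul hu

/-- If L u - u is fixed by Q, it is zero because Q (L - 1) = 0. By induction on the order a
generalised eigenvector is thus fixed by L, and then u = L^n u tends to Q u. -/
theorem apply_eq_self_of_mem_maxGenEigenspace (hQL : Q * L = Q)
    (hlim : Tendsto (fun n => ‖L ^ n - Q‖) atTop (𝓝 0)) {u : E}
    (hu : u ∈ Module.End.maxGenEigenspace L.toLinearMap 1) : Q u = u := by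
  obtain ⟨n, hn⟩ := (Module.End.mem_maxGenEigenspace _ _ _).1 hu
  clear hu
  induction n generalizing u with
  | zero =>
    have : u = 0 := by simpa using hn
    rw [this, map_zero]
  | succ n ih =>
    rw [pow_succ] at hn
    have h1 : Q (L u - u) = L u - u := ih (by simpa using hn)
    have h2 : Q (L u) = Q u := congrArg (fun T : E →L[ℂ] E => T u) hQL
    rw [map_sub, h2, sub_self] at h1
    have h3 : L u = u := (sub_eq_zero.1 h1.symm)
    have h4 : ∀ n, (L ^ n) u = u := fun n => by
      induction n with
      | zero => rfl
      | succ n ih =>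
        rw [pow_succ]
        show (L ^ n) (L u) = u
        rw [h3, ih]
    have h5 : Tendsto (fun _ : ℕ => ‖u - Q u‖) atTop (𝓝 0) := by
      refine squeeze_zero (fun _ => norm_nonneg _) (fun n => ?_)
        (g := fun n => ‖L ^ n - Q‖ * ‖u‖) (by simpa using hlim.mul_const ‖u‖)
      have := (L ^ n - Q).le_opNorm u
      rwa [_root_.sub_apply, h4] at this
    have h6 := tendsto_nhds_unique h5 tendsto_const_nhds
    exact (sub_eq_zero.1 (norm_eq_zero.1 h6.symm)).symm

variable [CompleteSpace E]

theorem spectralRadius_sub_lt_one [Nontrivial E] (hQL : Q * L = Q) (hLQ : L * Q = Q)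
    (hQ : Q * Q = Q) (hlim : Tendsto (fun n => ‖L ^ n - Q‖) atTop (𝓝 0)) :
    spectralRadius ℂ (L - Q) < 1 := by
  obtain ⟨n, hn⟩ := ((tendsto_order.1 (hlim.comp (tendsto_add_atTop_nat 1))).2 1 one_pos).exists
  have hn' : ‖L ^ (n + 1) - Q‖ < 1 := hn
  have h := spectrum.spectralRadius_le_pow_nnnorm_pow_one_div ℂ (L - Q) n
  rw [pow_succ_sub_of_absorb hQL hLQ hQ, nnnorm_one, ENNReal.coe_one, ENNReal.one_rpow, mul_one] at h
  refine h.trans_lt (ENNReal.rpow_lt_one ?_ (by positivity))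
  exact_mod_cast hn'

theorem exists_spectral_gap [Nontrivial E] (hQL : Q * L = Q) (hLQ : L * Q = Q)
    (hQ : Q * Q = Q) (hlim : Tendsto (fun n => ‖L ^ n - Q‖) atTop (𝓝 0)) :
    ∃ r : ℝ, r < 1 ∧ ∀ z ∈ spectrum ℂ L, z ≠ 1 → ‖z‖ ≤ r := by
  have h := spectralRadius_sub_lt_one hQL hLQ hQ hlim
  have hfin : spectralRadius ℂ (L - Q) ≠ ⊤ := h.ne_top
  refine ⟨(spectralRadius ℂ (L - Q)).toReal, ?_, fun z hz h1 => ?_⟩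
  · rw [← ENNReal.toReal_one]
    exact (ENNReal.toReal_lt_toReal hfin ENNReal.one_ne_top).2 h
  · by_cases h0 : z = 0
    · rw [h0, norm_zero]
      exact ENNReal.toReal_nonneg
    have hz' : z ∈ spectrum ℂ (L - Q) := fun hu => hz (isUnit_sub_of_absorb hLQ hQ h0 h1 hu)
    have hle : (‖z‖₊ : ENNReal) ≤ spectralRadius ℂ (L - Q) :=
      le_iSup₂ (f := fun z (_ : z ∈ spectrum ℂ (L - Q)) => (‖z‖₊ : ENNReal)) z hz'
    have := ENNReal.toReal_mono hfin hle
    simpa using this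

end PowersConverge

/-! ### The Hölder space is a Banach space -/

namespace HolderSpace

variable {k d : ℕ} {θ : Set.Ioo (0 : ℝ) 1} {α : Set.Ioi (0 : ℝ)}

theorem norm_apply_le_norm (f : HolderSpace k d θ α) (a : SymbolSeq k × Proj d) : ‖f a‖ ≤ ‖f‖ :=
  (f.norm_apply_le a).trans (le_add_of_nonneg_right f.holderSeminorm_nonneg)

theorem holderSeminorm_le_norm (f : HolderSpace k d θ α) : f.holderSeminorm ≤ ‖f‖ :=
  le_add_of_nonneg_left f.supNorm_nonneg

theorem sub_apply (f g : HolderSpace k d θ α) (a : SymbolSeq k × Proj d) :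
    (f - g) a = f a - g a := rfl

/-- A Cauchy sequence converges pointwise, and the defining inequalities of both parts of the norm
pass to the limit. The spectral radius bounds rely on completeness. -/
instance : CompleteSpace (HolderSpace k d θ α) := by
  refine Metric.complete_of_cauchySeq_tendsto fun u hu => ?_
  have hpt : ∀ a, CauchySeq fun n => u n a := fun a => by
    refine Metric.cauchySeq_iff.2 fun ε hε => ?_
    obtain ⟨N, hN⟩ := Metric.cauchySeq_iff.1 hu ε hε
    refine ⟨N, fun m hm n hn => lt_of_le_of_lt ?_ (hN m hm n hn)⟩
    rw [dist_eq_norm, dist_eq_norm]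
    exact (u m - u n).norm_apply_le_norm a
  choose f hf using fun a => cauchySeq_tendsto_of_complete (hpt a)
  obtain ⟨R, -, hR⟩ := cauchySeq_bdd hu
  have hbound : ∀ n, (u n).holderSeminorm ≤ ‖u 0‖ + R := fun n => by
    refine (u n).holderSeminorm_le_norm.trans ?_
    have h1 := hR n 0
    rw [dist_eq_norm] at h1
    have h2 := norm_le_norm_add_norm_sub (u 0) (u n)
    rw [norm_sub_rev] at h2
    linarith
  have hholder : ∀ a b, ‖f a - f b‖ ≤ (‖u 0‖ + R) * pairDist θ α a b := fun a b =>
    le_of_tendsto ((hf a).sub (hf b)).norm (Eventually.of_forall fun n =>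
      ((u n).norm_sub_le a b).trans
        (mul_le_mul_of_nonneg_right (hbound n) (pairDist_nonneg θ α a b)))
  let F : HolderSpace k d θ α := ⟨f, isHolder_of_bound hholder⟩
  refine ⟨F, Metric.tendsto_atTop.2 fun ε hε => ?_⟩
  obtain ⟨N, hN⟩ := Metric.cauchySeq_iff.1 hu (ε / 3) (by positivity)
  refine ⟨N, fun n hn => ?_⟩
  have hle : ∀ m, N ≤ m → ‖u n - u m‖ ≤ ε / 3 := fun m hm => by
    rw [← dist_eq_norm]
    exact (hN n hn m hm).le
  have h1 : (u n - F).supNorm ≤ ε / 3 := by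
    refine supNorm_le _ (by positivity) fun a => ?_
    refine le_of_tendsto (((tendsto_const_nhds (x := u n a)).sub (hf a)).norm)
      (eventually_atTop.2 ⟨N, fun m hm => ?_⟩)
    exact ((u n - u m).norm_apply_le_norm a).trans (hle m hm)
  have h2 : (u n - F).holderSeminorm ≤ ε / 3 := by
    refine holderSeminorm_le _ (by positivity) fun a b => ?_
    refine le_of_tendsto ((((tendsto_const_nhds (x := u n a)).sub (hf a)).sub
      ((tendsto_const_nhds (x := u n b)).sub (hf b))).norm) (eventually_atTop.2 ⟨N, fun m hm => ?_⟩)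
    exact ((u n - u m).norm_sub_le a b).trans (mul_le_mul_of_nonneg_right
      ((u n - u m).holderSeminorm_le_norm.trans (hle m hm)) (pairDist_nonneg θ α a b))
  rw [dist_eq_norm, norm_def]
  linarith

/-- The constant function. -/
def const (k d : ℕ) (θ : Set.Ioo (0 : ℝ) 1) (α : Set.Ioi (0 : ℝ)) (c : ℂ) : HolderSpace k d θ α :=
  ⟨fun _ => c, isHolder_const θ α c⟩

theorem norm_const_le (c : ℂ) : ‖const k d θ α c‖ ≤ ‖c‖ := by
  have h1 : (const k d θ α c).supNorm ≤ ‖c‖ := supNorm_le _ (norm_nonneg c) fun _ => le_rfl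
  have h2 : (const k d θ α c).holderSeminorm ≤ 0 :=
    holderSeminorm_le _ le_rfl fun _ _ => by simp [const]
  rw [norm_def]
  linarith

end HolderSpace

/-! ### Convergence of the powers and comparison of invariant measures. -/

section Convergence

variable {k d : ℕ} {θ : Set.Ioo (0 : ℝ) 1} {α : Set.Ioi (0 : ℝ)} {μ : Measure (SymbolSeq k)}
  {M : Fin k → GL (Fin d) ℝ}

/-- Subtracting a constant leaves the seminorm unchanged, and the sup norm of the difference is at
most twice the seminorm because `pairDist` is at most 2. Hence a contraction of the seminorm alone
suffices. -/
theorem norm_sub_meanOp_le (ν : ProbabilityMeasure (SymbolSeq k × Proj d))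
    (w : HolderSpace k d θ α) : ‖w - meanOp ν θ α w‖ ≤ 3 * w.holderSeminorm := by
  have h0 := w.holderSeminorm_nonneg
  have h1 : (w - meanOp ν θ α w).supNorm ≤ 2 * w.holderSeminorm := by
    refine HolderSpace.supNorm_le _ (by positivity) fun a => ?_
    rw [HolderSpace.sub_apply, meanOp_apply]
    have e : w a - ∫ b, w b ∂(ν : Measure (SymbolSeq k × Proj d)) =
        ∫ b, (w a - w b) ∂(ν : Measure (SymbolSeq k × Proj d)) := by
      rw [integral_sub (integrable_const _) (w.integrable ν)]
      simp
    rw [e]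
    refine (norm_integral_le_of_norm_le_const (C := 2 * w.holderSeminorm)
      (Eventually.of_forall fun b => ?_)).trans_eq (by simp)
    refine (w.norm_sub_le a b).trans ?_
    rw [mul_comm]
    exact mul_le_mul_of_nonneg_right (pairDist_le_two θ α a b) h0
  have h2 : (w - meanOp ν θ α w).holderSeminorm ≤ w.holderSeminorm := by
    refine HolderSpace.holderSeminorm_le _ h0 fun a b => ?_
    rw [HolderSpace.sub_apply, HolderSpace.sub_apply, meanOp_apply, meanOp_apply,
      sub_sub_sub_cancel_right]
    exact w.norm_sub_le a b
  rw [HolderSpace.norm_def]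
  linarith

/-- From Q L = Q one has L^n - Q = (1 - Q) L^n, whose value at w is bounded by three times the
seminorm of L^n w. Full blocks of N steps contract, and the n mod N remaining steps cost a bounded
factor. -/
theorem tendsto_norm_transferOp_pow_sub {ν : ProbabilityMeasure (SymbolSeq k × Proj d)}
    (hν : meanOp ν θ α * transferOp μ M θ α = meanOp ν θ α) {N : ℕ} {B ρ : ℝ} (hρ0 : 0 ≤ ρ)
    (hρ1 : ρ < 1) (hB : 0 ≤ B) (hN : 0 < N) (h : ∀ (m : ℕ) (w : HolderSpace k d θ α),
      ((transferOp μ M θ α ^ (N * m)) w).holderSeminorm ≤ B * ρ ^ m * w.holderSeminorm) :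
    Tendsto (fun n => ‖transferOp μ M θ α ^ n - meanOp ν θ α‖) atTop (𝓝 0) := by
  set L := transferOp μ M θ α with hL
  set K : ℝ := ∑ r ∈ Finset.range N, ‖L ^ r‖ with hK
  have hQ : ∀ n, meanOp ν θ α * L ^ n = meanOp ν θ α := fun n => by
    induction n with
    | zero => rw [pow_zero, mul_one]
    | succ n ih => rw [pow_succ, ← mul_assoc, ih, hν]
  have hlim : Tendsto (fun n : ℕ => 3 * (B * ρ ^ (n / N) * K)) atTop (𝓝 0) := by
    have h1 := (tendsto_pow_atTop_nhds_zero_of_lt_one hρ0 hρ1).comp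
      (Nat.tendsto_div_const_atTop hN.ne')
    simpa using (((h1.const_mul B).mul_const K).const_mul 3)
  refine squeeze_zero (fun _ => norm_nonneg _) (fun n => ?_) hlim
  have hK0 : 0 ≤ K := Finset.sum_nonneg fun _ _ => norm_nonneg _
  refine ContinuousLinearMap.opNorm_le_bound _ (by positivity) fun w => ?_
  have e1 : (L ^ n - meanOp ν θ α) w = (L ^ n) w - meanOp ν θ α ((L ^ n) w) := by
    have : meanOp ν θ α ((L ^ n) w) = meanOp ν θ α w :=
      congrArg (fun T : HolderSpace k d θ α →L[ℂ] HolderSpace k d θ α => T w) (hQ n)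
    rw [this]
    rfl
  have e2 : (L ^ n) w = (L ^ (N * (n / N))) ((L ^ (n % N)) w) := by
    conv_lhs => rw [← Nat.div_add_mod n N, pow_add]
    rfl
  have e3 : ((L ^ (n % N)) w).holderSeminorm ≤ K * ‖w‖ := by
    refine (HolderSpace.holderSeminorm_le_norm _).trans (((L ^ (n % N)).le_opNorm w).trans ?_)
    exact mul_le_mul_of_nonneg_right (Finset.single_le_sum (f := fun r => ‖L ^ r‖)
      (fun _ _ => norm_nonneg _) (Finset.mem_range.2 (Nat.mod_lt n hN))) (norm_nonneg w)
  rw [e1]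
  refine (norm_sub_meanOp_le ν _).trans ?_
  rw [mul_assoc 3]
  refine mul_le_mul_of_nonneg_left ?_ (by norm_num)
  rw [e2]
  refine (h _ _).trans ?_
  rw [mul_assoc (B * ρ ^ (n / N))]
  exact mul_le_mul_of_nonneg_left e3 (by positivity)

/-- The integrals of a function with respect to two measures with the same marginal differ by at
most the oscillation in the projective variable. -/
theorem re_integral_le_add_holderSeminorm {ν ν' : ProbabilityMeasure (SymbolSeq k × Proj d)}
    (hν : (ν : Measure (SymbolSeq k × Proj d)).map Prod.fst = μ)
    (hν' : (ν' : Measure (SymbolSeq k × Proj d)).map Prod.fst = μ) (w : HolderSpace k d θ α) :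
    (∫ a, w a ∂(ν : Measure (SymbolSeq k × Proj d))).re ≤
      (∫ a, w a ∂(ν' : Measure (SymbolSeq k × Proj d))).re + w.holderSeminorm := by
  set h := w.holderSeminorm with hh
  have hh0 : 0 ≤ h := w.holderSeminorm_nonneg
  obtain ⟨a₀⟩ := nonempty_of_isProbabilityMeasure (ν : Measure (SymbolSeq k × Proj d))
  have : Nonempty (Proj d) := ⟨a₀.2⟩
  have hre : ∀ a b, (w a).re ≤ (w b).re + h * pairDist θ α a b := fun a b => by
    have h1 := (Complex.re_le_norm (w a - w b)).trans (w.norm_sub_le a b)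
    rw [Complex.sub_re] at h1
    linarith
  have hosc : ∀ ω x y, (w (ω, x)).re ≤ (w (ω, y)).re + h := fun ω x y => by
    refine (hre (ω, x) (ω, y)).trans (add_le_add_right ?_ _)
    refine mul_le_of_le_one_right hh0 ?_
    rw [pairDist, seqDist, if_pos rfl, add_zero]
    exact Real.rpow_le_one (projDist_nonneg _ _) (projDist_le_one _ _) (le_of_lt α.2)
  -- The fibrewise supremum depends on ω only, so its integral is the same for both measures. It
  -- lies between the real part of w and that real part plus the seminorm.
  let S : SymbolSeq k → ℝ := fun ω => ⨆ x, (w (ω, x)).re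
  have hbdd : ∀ ω, BddAbove (Set.range fun x => (w (ω, x)).re) := fun ω =>
    ⟨(w (ω, a₀.2)).re + h, by rintro _ ⟨x, rfl⟩; exact hosc ω x a₀.2⟩
  have hS1 : ∀ ω x, (w (ω, x)).re ≤ S ω := fun ω x => le_ciSup (hbdd ω) x
  have hS2 : ∀ ω x, S ω ≤ (w (ω, x)).re + h := fun ω x => ciSup_le fun y => hosc ω y x
  have hS3 : ∀ ω ω', S ω ≤ S ω' + h * seqDist θ ω ω' := fun ω ω' => ciSup_le fun x => by
    have h1 := hre (ω, x) (ω', x)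
    rw [pairDist, projDist_self, Real.zero_rpow (ne_of_gt α.2), zero_add] at h1
    linarith [hS1 ω' x]
  have hcont : Continuous S := by
    rw [continuous_iff_continuousAt]
    intro ω
    rw [ContinuousAt, tendsto_iff_norm_sub_tendsto_zero]
    refine squeeze_zero (fun _ => norm_nonneg _) (fun ω' => ?_)
      (by simpa using (tendsto_seqDist θ ω).const_mul h)
    have hsymm : seqDist (θ : ℝ) ω' ω = seqDist θ ω ω' := by
      by_cases e : ω = ω'
      · rw [e]
      · rw [seqDist, seqDist, if_neg e, if_neg (Ne.symm e), PiNat.firstDiff_comm]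
    have h1 := hS3 ω ω'
    have h2 := hS3 ω' ω
    rw [hsymm] at h2
    rw [Real.norm_eq_abs, abs_le]
    constructor <;> linarith
  have hint : ∀ η : ProbabilityMeasure (SymbolSeq k × Proj d),
      Integrable (fun a => (w a).re) (η : Measure (SymbolSeq k × Proj d)) := fun η =>
    (w.integrable η).re
  have hSint : ∀ η : ProbabilityMeasure (SymbolSeq k × Proj d),
      Integrable (fun a : SymbolSeq k × Proj d => S a.1) (η : Measure (SymbolSeq k × Proj d)) :=
    fun η => by
      refine Integrable.of_bound (C := w.supNorm + h)
        (hcont.comp continuous_fst).measurable.aestronglyMeasurable (Eventually.of_forall fun a => ?_)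
      have h1 := hS1 a.1 a.2
      have h2 := hS2 a.1 a.2
      have h3 := abs_le.1 ((Complex.abs_re_le_norm (w a)).trans (w.norm_apply_le a))
      rw [Real.norm_eq_abs, abs_le]
      constructor <;> linarith [h3.1, h3.2]
  have hre_int : ∀ η : ProbabilityMeasure (SymbolSeq k × Proj d),
      (∫ a, w a ∂(η : Measure (SymbolSeq k × Proj d))).re =
        ∫ a, (w a).re ∂(η : Measure (SymbolSeq k × Proj d)) := fun η =>
    (integral_re (w.integrable η)).symm
  have hmarg : ∀ η : ProbabilityMeasure (SymbolSeq k × Proj d),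
      (η : Measure (SymbolSeq k × Proj d)).map Prod.fst = μ →
        ∫ a, S a.1 ∂(η : Measure (SymbolSeq k × Proj d)) = ∫ ω, S ω ∂μ := fun η hη => by
    rw [← hη, integral_map measurable_fst.aemeasurable hcont.measurable.aestronglyMeasurable]
  rw [hre_int, hre_int]
  have e1 : ∫ a, (w a).re ∂(ν : Measure (SymbolSeq k × Proj d)) ≤ ∫ ω, S ω ∂μ := by
    rw [← hmarg ν hν]
    exact integral_mono (hint ν) (hSint ν) fun a => hS1 a.1 a.2
  have e2 : ∫ ω, S ω ∂μ ≤ ∫ a, (w a).re ∂(ν' : Measure (SymbolSeq k × Proj d)) + h := by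
    rw [← hmarg ν' hν']
    refine (integral_mono (hSint ν') ((hint ν').add (integrable_const h))
      fun a => hS2 a.1 a.2).trans_eq ?_
    rw [integral_add' (hint ν') (integrable_const h)]
    simp
  exact e1.trans e2

/-- The difference c of the two integrals satisfies |c| ≤ 2 sup|w|, and also |c| is at most the
seminorm of w because the marginals agree. Adding twice the second bound to the first gives 3|c| ≤
2‖w‖. -/
theorem norm_meanOp_sub_meanOp_le {ν ν' : ProbabilityMeasure (SymbolSeq k × Proj d)}
    (hν : (ν : Measure (SymbolSeq k × Proj d)).map Prod.fst = μ)
    (hν' : (ν' : Measure (SymbolSeq k × Proj d)).map Prod.fst = μ) :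
    ‖meanOp ν θ α - meanOp ν' θ α‖ ≤ 2 / 3 := by
  refine ContinuousLinearMap.opNorm_le_bound _ (by norm_num) fun w => ?_
  set c : ℂ := (∫ a, w a ∂(ν : Measure (SymbolSeq k × Proj d))) -
    ∫ a, w a ∂(ν' : Measure (SymbolSeq k × Proj d)) with hc
  have e1 : (meanOp ν θ α - meanOp ν' θ α) w = HolderSpace.const k d θ α c := rfl
  have hsup : ∀ η : ProbabilityMeasure (SymbolSeq k × Proj d),
      ‖∫ a, w a ∂(η : Measure (SymbolSeq k × Proj d))‖ ≤ w.supNorm := fun η => by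
    simpa using norm_integral_le_of_norm_le_const (μ := (η : Measure (SymbolSeq k × Proj d)))
      (Eventually.of_forall w.norm_apply_le)
  have h1 : ‖c‖ ≤ 2 * w.supNorm := by
    refine (_root_.norm_sub_le _ _).trans ?_
    linarith [hsup ν, hsup ν']
  have h2 : ‖c‖ ≤ w.holderSeminorm := by
    rcases (norm_nonneg c).eq_or_lt with h0 | h0
    · rw [← h0]
      exact w.holderSeminorm_nonneg
    -- Multiplying w by the conjugate of c makes the difference of the integrals real and equal to
    -- |c|².
    have h3 := re_integral_le_add_holderSeminorm hν hν' ((starRingEnd ℂ) c • w)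
    simp only [HolderSpace.smul_apply, integral_const_mul] at h3
    have h4 : ((starRingEnd ℂ) c • w).holderSeminorm ≤ ‖c‖ * w.holderSeminorm := by
      refine HolderSpace.holderSeminorm_le _ (mul_nonneg h0.le w.holderSeminorm_nonneg) fun a b => ?_
      rw [HolderSpace.smul_apply, HolderSpace.smul_apply, ← mul_sub, norm_mul, RCLike.norm_conj,
        mul_assoc]
      exact mul_le_mul_of_nonneg_left (w.norm_sub_le a b) h0.le
    have h5 : ((starRingEnd ℂ) c * c).re = ‖c‖ * ‖c‖ := by
      rw [← Complex.normSq_eq_conj_mul_self, Complex.ofReal_re, Complex.normSq_eq_norm_sq, sq]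
    have h6 : ((starRingEnd ℂ) c * c).re =
        ((starRingEnd ℂ) c * ∫ a, w a ∂(ν : Measure (SymbolSeq k × Proj d))).re -
          ((starRingEnd ℂ) c * ∫ a, w a ∂(ν' : Measure (SymbolSeq k × Proj d))).re := by
      rw [← Complex.sub_re, ← mul_sub]
    exact le_of_mul_le_mul_left (by linarith) h0
  rw [e1]
  refine (HolderSpace.norm_const_le c).trans ?_
  rw [HolderSpace.norm_def]
  linarith

end Convergence

end MarkovTransfer

end

/-! ### Assembly of the theorem. -/

theorem mainTheorem2 (k d : ℕ) (hd : 2 ≤ d) (μ : Measure (SymbolSeq k)) (hμ : IsMarkovianFullShift μ)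
    (M : Fin k → GL (Fin d) ℝ) (hirr : StronglyIrreducible M) (hcon : Contracting M) :
    ∃ ν₀ : ProbabilityMeasure (SymbolSeq k × Proj d), IsInvariantMeasure μ M ν₀ ∧
      ∃ α₀ : ℝ, 0 < α₀ ∧ ∀ α : Set.Ioi (0 : ℝ), (α : ℝ) ≤ α₀ →
        ∃ θ₀ : ℝ, 0 < θ₀ ∧ ∀ θ : Set.Ioo (0 : ℝ) 1, (θ : ℝ) < θ₀ →
          -- the norm bound, for every invariant measure
          (∀ ν : ProbabilityMeasure (SymbolSeq k × Proj d), IsInvariantMeasure μ M ν →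
            ∀ᶠ n : ℕ in atTop,
              ‖transferOp μ M θ α ^ n - meanOp ν θ α‖ ^ (1 / (n : ℝ)) < 1) ∧
          -- `1` is an eigenvalue of algebraic multiplicity one
          Module.End.HasEigenvalue (transferOp μ M θ α).toLinearMap 1 ∧
          Module.finrank ℂ
            (Module.End.maxGenEigenspace (transferOp μ M θ α).toLinearMap 1) = 1 ∧
          -- the rest of the spectrum lies in a disc of radius less than `1`
          (∃ r : ℝ, r < 1 ∧ ∀ z ∈ spectrum ℂ (transferOp μ M θ α), z ≠ 1 → ‖z‖ ≤ r) ∧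
          -- `Q` for `ν₀` is the spectral projection, and the remainder has spectral radius `< 1`
          meanOp ν₀ θ α * transferOp μ M θ α = meanOp ν₀ θ α ∧
          transferOp μ M θ α * meanOp ν₀ θ α = meanOp ν₀ θ α ∧
          spectralRadius ℂ (transferOp μ M θ α - meanOp ν₀ θ α) < 1 := by
  have hd0 : 0 < d := by omega
  have hP : ∀ i j, 0 < transProb μ i j := hμ.transProb_pos
  have hP1 : ∀ j, ∑ i, transProb μ i j = 1 := hμ.sum_transProb
  obtain ⟨v₀⟩ := exists_unitVec hd0
  obtain ⟨η, hη⟩ := exists_stationary_family (fun i j => (hP i j).le) hP1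
    (fun i => continuous_dualAct (M i)) v₀
  have hη' : IsProperStationary (transProb μ) M η :=
    ⟨hη, fun j x hx => IsDualStationary.measure_hyperplane hη hP hP1 hirr j hx⟩
  obtain ⟨α₀, hα₀, hmom⟩ := hη'.exists_moment_contraction hP hP1 hd0 hirr hcon
  obtain ⟨ν₀, hν₀, hfix⟩ := hμ.exists_invariantMeasure hd0 M
  -- The contraction of the seminorm holds for every θ in (0, 1), so θ₀ = 1 serves.
  refine ⟨ν₀, hν₀, α₀, hα₀, fun α hα => ⟨1, one_pos, fun θ _ => ?_⟩⟩
  have hQL : meanOp ν₀ θ α * transferOp μ M θ α = meanOp ν₀ θ α := meanOp_mul_transferOp hfix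
  have hLQ : transferOp μ M θ α * meanOp ν₀ θ α = meanOp ν₀ θ α := hμ.transferOp_mul_meanOp M ν₀
  have hQ := meanOp_mul_meanOp (θ := θ) (α := α) ν₀
  obtain ⟨N, B, ρ, hρ0, hρ1, hB, hN, hcontr⟩ :=
    exists_holderSeminorm_contraction hμ θ α (hmom α α.2 hα)
  have hlim := tendsto_norm_transferOp_pow_sub hQL hρ0 hρ1 hB hN hcontr
  obtain ⟨a₀⟩ := nonempty_of_isProbabilityMeasure (ν₀ : Measure (SymbolSeq k × Proj d))
  have h1 : HolderSpace.const k d θ α 1 ≠ 0 := fun h => by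
    have : (1 : ℂ) = 0 := congrArg (fun w : HolderSpace k d θ α => w a₀) h
    exact one_ne_zero this
  have : Nontrivial (HolderSpace k d θ α) := ⟨⟨_, _, h1⟩⟩
  have hL1 : transferOp μ M θ α (HolderSpace.const k d θ α 1) = HolderSpace.const k d θ α 1 := by
    ext a
    rw [transferOp_apply]
    simp only [HolderSpace.const, mul_one]
    rw [← Complex.ofReal_sum, hP1, Complex.ofReal_one]
  have heig : Module.End.HasEigenvector (transferOp μ M θ α).toLinearMap 1
      (HolderSpace.const k d θ α 1) :=
    ⟨Module.End.mem_eigenspace_iff.2 (by rw [one_smul]; exact hL1), h1⟩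
  refine ⟨fun ν hν => ?_, Module.End.hasEigenvalue_of_hasEigenvector heig, ?_,
    exists_spectral_gap hQL hLQ hQ hlim, hQL, hLQ, spectralRadius_sub_lt_one hQL hLQ hQ hlim⟩
  -- A distance below 1/3 to the mean operator of ν₀, plus at most 2/3 from there to that of ν, is
  -- less than 1. The condition n ≥ 1 makes the exponent 1/n positive.
  · filter_upwards [(tendsto_order.1 hlim).2 (1 / 3) (by norm_num), eventually_ge_atTop 1]
      with n hn hn1
    have h2 := norm_meanOp_sub_meanOp_le (θ := θ) (α := α) hν₀.2 hν.2
    have h3 := norm_sub_le_norm_sub_add_norm_sub (transferOp μ M θ α ^ n) (meanOp ν₀ θ α)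
      (meanOp ν θ α)
    exact Real.rpow_lt_one (norm_nonneg _) (by linarith) (by positivity)
  -- Generalised eigenvectors are fixed by Q, whose values are constant functions.
  · have hspan : Module.End.maxGenEigenspace (transferOp μ M θ α).toLinearMap 1 =
        ℂ ∙ HolderSpace.const k d θ α 1 := by
      refine le_antisymm (fun u hu => ?_) ?_
      · have h2 := apply_eq_self_of_mem_maxGenEigenspace hQL hlim hu
        refine Submodule.mem_span_singleton.2
          ⟨∫ b, u b ∂(ν₀ : Measure (SymbolSeq k × Proj d)), ?_⟩
        conv_rhs => rw [← h2]
        ext a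
        exact mul_one _
      · rw [Submodule.span_singleton_le_iff_mem]
        exact Module.End.mem_maxGenEigenspace _ _ _ |>.2 ⟨1, by simp [hL1]⟩
    rw [hspan, finrank_span_singleton h1]
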